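/- Let $L>0$, $T>0$, $\alpha>0$, $\delta>0$, $\beta\ge 0$ (the case $\beta=0$ is the linear Nwogu system), and let $\eta,u$ be real-valued functions on $[-L,L]\times[0,T)$, of class $C^3$ and $C^4$ respectively (up to the boundary $x=\pm L$ and $t=0$), that satisfy the linear generalized Nwogu system $$\eta_t+u_x-\alpha u_{xxx}-\beta\eta_{xxt}=0,\qquad u_t+\eta_x-\delta u_{xxt}=0,\qquad (x,t)\in(-L,L)\times(0,T),$$ with initial data $\eta(x,0)=\eta_0(x)$, $u(x,0)=u_0(x)$ and boundary values $u(-L,t)=g_0(t)$, $u(L,t)=h_0(t)$, $u_{xx}(-L,t)=g_2(t)$, $u_{xx}(L,t)=h_2(t)$. Notation. $\widehat f(k)=\int_{-L}^{L}e^{-ikx}f(x)\,dx$. For $a\in\{\alpha,\beta,\delta\}$, $\mu_a(k)$ is a square root of $1+ak^2$ (any choice of the roots may be made; the integrands below do not depend on it), $\omega=k\mu_\alpha/(\mu_\delta\mu_\beta)$, and $$B_f^{\pm}(\omega,t)=e^{i\omega t}\int_0^t e^{-i\omega\tau}f(\tau)\,d\tau\ \pm\ e^{-i\omega t}\int_0^t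 e^{i\omega\tau}f(\tau)\,d\tau .$$ Put $c=e^{i\omega t}+e^{-i\omega t}$, $s=e^{i\omega t}-e^{-i\omega t}$ and, for the pairs $f=(f_0,f_2)=(g_0,g_2)$ and $(h_0,h_2)$, $$E_f=-\tfrac{1+\alpha k^2}{1+\beta k^2}B^+_{f_0}+\tfrac{\alpha}{1+\beta k^2}B^+_{f_2}+\tfrac{\beta\delta}{1+\beta k^2}B^+_{f_2''}-\tfrac{\beta}{1+\beta k^2}B^+_{f_0''}-\tfrac{i\delta k\mu_\alpha}{\mu_\delta\mu_\beta}B^-_{f_0'},$$ $$U_f=\tfrac{\mu_\alpha}{\mu_\delta\mu_\beta}B^-_{f_0}+\tfrac{i\delta k}{1+\delta k^2}B^+_{f_0'}+\tfrac{\beta}{\mu_\alpha\mu_\delta\mu_\beta}B^-_{f_0''}-\tfrac{\alpha}{\mu_\alpha\mu_\delta\mu_\beta}B^-_{f_2}-\tfrac{\beta\delta}{\mu_\alpha\mu_\delta\mu_\beta}B^-_{f_2''}.$$ Let $k_n=\frac{n\pi}{2L}$, $n\in\mathbb Z$, and let $0<r<\frac{\pi}{4L}$ with $r\sqrt\delta<1$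 and $r\sqrt\beta<1$ (for instance $r=\frac{\pi}{6L}$ whenever $\pi\sqrt\delta<6L$ and $\pi\sqrt\beta<6L$). The contour $\mathcal L^{+}$ (respectively $\mathcal L^-$) is the real line, oriented from left to right, in which every interval $[k_n-r,k_n+r]$ is replaced by the semicircle of radius $r$ about $k_n$ in the upper (respectively lower) half-plane. Then for all $x\in(-L,L)$, $t\in(0,T)$, $$\begin{aligned}2\pi\,\eta(x,t)&=\int_{\mathbb R}\frac{e^{ikx}}2\Big[c\,\widehat\eta_0(k)-\frac{\mu_\alpha\mu_\delta}{\mu_\beta}s\,\widehat u_0(k)\Big]dk\\ &+\int_{\mathcal L^-}\frac{e^{ik(x-L)}}{2(1-e^{-4ikL})}\Big\{c\big[e^{-3ikL}\widehat\eta_0(k)+e^{-ikL}\widehat\eta_0(-k)\big]-\frac{\mu_\alpha\mu_\delta}{\mu_\beta}s\big[e^{-3ikL}\widehat u_0(k)-e^{-ikL}\widehat u_0(-k)\big]\Big\}dk\\ &+\int_{\mathcal L^+}\frac{e^{ik(x+L)}}{2(1-e^{4ikL})}\Big\{c\big[e^{3ikL}\widehat\eta_0(k)+e^{ikL}\widehat\eta_0(-k)\big]-\frac{\mu_\alpha\mu_\delta}{\mu_\beta}s\big[e^{3ikL}\widehat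 u_0(k)-e^{ikL}\widehat u_0(-k)\big]\Big\}dk\\ &+\int_{\mathcal L^-}\frac{e^{ik(x-L)}}{1-e^{-4ikL}}E_h\,dk-\int_{\mathcal L^+}\frac{e^{ik(x+L)}}{1-e^{4ikL}}E_g\,dk+\int_{\mathcal L^-}\frac{e^{ik(x+L)}}{1-e^{4ikL}}E_g\,dk-\int_{\mathcal L^+}\frac{e^{ik(x-L)}}{1-e^{-4ikL}}E_h\,dk\end{aligned}$$ and $$\begin{aligned}2\pi\,u(x,t)&=\int_{\mathbb R}\frac{e^{ikx}}2\Big[-\frac{\mu_\beta}{\mu_\alpha\mu_\delta}s\,\widehat\eta_0(k)+c\,\widehat u_0(k)\Big]dk\\ &+\int_{\mathcal L^-}\frac{e^{ik(x-L)}}{2(1-e^{-4ikL})}\Big\{-\frac{\mu_\beta}{\mu_\alpha\mu_\delta}s\big[e^{-3ikL}\widehat\eta_0(k)+e^{-ikL}\widehat\eta_0(-k)\big]+c\big[e^{-3ikL}\widehat u_0(k)-e^{-ikL}\widehat u_0(-k)\big]\Big\}dk\\ &+\int_{\mathcal L^+}\frac{e^{ik(x+L)}}{2(1-e^{4ikL})}\Big\{-\frac{\mu_\beta}{\mu_\alpha\mu_\delta}s\big[e^{3ikL}\widehat\eta_0(k)+e^{ikL}\widehat\eta_0(-k)\big]+c\big[e^{3ikL}\widehat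 u_0(k)-e^{ikL}\widehat u_0(-k)\big]\Big\}dk\\ &+\int_{\mathcal L^-}\frac{e^{ik(x-L)}}{1-e^{-4ikL}}U_h\,dk-\int_{\mathcal L^+}\frac{e^{ik(x+L)}}{1-e^{4ikL}}U_g\,dk+\int_{\mathcal L^-}\frac{e^{ik(x+L)}}{1-e^{4ikL}}U_g\,dk-\int_{\mathcal L^+}\frac{e^{ik(x-L)}}{1-e^{-4ikL}}U_h\,dk .\end{aligned}$$ Here the right-hand sides are improper integrals in the following sense: if all seven contours are truncated to $|\mathrm{Re}\,k|\le\frac{(2N+1)\pi}{4L}$, the sum of the seven truncated integrals converges to the left-hand side as $N\to\infty$; and whenever the seven integrals converge individually (as limits of these truncations), the left-hand side is the sum of their values. -/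

import Mathlib

open Set Filter Topology

noncomputable section

namespace Nwogu

/-- Partial derivative in `x` on the closed interval `[-L, L]` (one-sided at the endpoints). -/
def dx (L : ℝ) (f : ℝ → ℝ → ℝ) : ℝ → ℝ → ℝ :=
  fun x t => derivWithin (fun y => f y t) (Icc (-L) L) x

/-- Partial derivative in `t` on `[0, ∞)` (one-sided at `t = 0`). -/
def dt (f : ℝ → ℝ → ℝ) : ℝ → ℝ → ℝ :=
  fun x t => derivWithin (fun s => f x s) (Ici 0) t

/-- `(η, u)` satisfies the linear generalized Nwogu system on `(-L, L) × (0, T)`: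
`η_t + u_x - α u_xxx - β η_xxt = 0` and `u_t + η_x - δ u_xxt = 0`. -/
def SolvesSystem (α β δ L T : ℝ) (η u : ℝ → ℝ → ℝ) : Prop :=
  ∀ x ∈ Ioo (-L) L, ∀ t ∈ Ioo 0 T,
    dt η x t + dx L u x t - α * dx L (dx L (dx L u)) x t - β * dt (dx L (dx L η)) x t = 0 ∧
    dt u x t + dx L η x t - δ * dt (dx L (dx L u)) x t = 0

/-- `μ` is a choice of square root of `1 + a k ^ 2` at every complex `k` (no matter where the
branch cuts are placed). -/
def IsSqrtBranch (a : ℝ) (μ : ℂ → ℂ) : Prop :=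
  ∀ k : ℂ, μ k ^ 2 = 1 + (a : ℂ) * k ^ 2

/-- The finite-interval Fourier transform `∫_{-L}^{L} e^{-ikx} f(x) dx`. -/
def fhat (L : ℝ) (f : ℝ → ℝ) (k : ℂ) : ℂ :=
  ∫ x in (-L)..L, Complex.exp (-(Complex.I * k * x)) * (f x : ℂ)

/-- `B_f^+(ω, t)`. -/
def Bplus (f : ℝ → ℝ) (ω : ℂ) (t : ℝ) : ℂ :=
  Complex.exp (Complex.I * ω * t) *
      (∫ τ in (0 : ℝ)..t, Complex.exp (-(Complex.I * ω * τ)) * (f τ : ℂ)) +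
    Complex.exp (-(Complex.I * ω * t)) *
      (∫ τ in (0 : ℝ)..t, Complex.exp (Complex.I * ω * τ) * (f τ : ℂ))

/-- `B_f^-(ω, t)`. -/
def Bminus (f : ℝ → ℝ) (ω : ℂ) (t : ℝ) : ℂ :=
  Complex.exp (Complex.I * ω * t) *
      (∫ τ in (0 : ℝ)..t, Complex.exp (-(Complex.I * ω * τ)) * (f τ : ℂ)) -
    Complex.exp (-(Complex.I * ω * t)) *
      (∫ τ in (0 : ℝ)..t, Complex.exp (Complex.I * ω * τ) * (f τ : ℂ))

/-! ### The contours, exhausted by the cells `|Re k - k_n| ≤ π / (4L)`, `|n| ≤ N` -/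

/-- The centres `k_n = n π / (2L)`. -/
def kn (L : ℝ) (n : ℤ) : ℝ := n * Real.pi / (2 * L)

/-- `∫ f(k) dk` over the arc `k_n + r e^{iθ}`, with `θ` running from `a` to `b`. -/
def arcInt (L r : ℝ) (n : ℤ) (a b : ℝ) (f : ℂ → ℂ) : ℂ :=
  ∫ θ in a..b, f ((kn L n : ℂ) + r * Complex.exp (Complex.I * θ)) *
    (Complex.I * r * Complex.exp (Complex.I * θ))

/-- The two straight pieces of a contour in the `n`-th cell. -/
def flatInt (L r : ℝ) (n : ℤ) (f : ℂ → ℂ) : ℂ :=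
  (∫ k in (kn L n - Real.pi / (4 * L))..(kn L n - r), f (k : ℂ)) +
    ∫ k in (kn L n + r)..(kn L n + Real.pi / (4 * L)), f (k : ℂ)

/-- `∫ f(k) dk` over the part `|k| ≤ (2N+1) π / (4L)` of the real line. -/
def lineInt (L : ℝ) (N : ℕ) (f : ℂ → ℂ) : ℂ :=
  ∫ k in (-((2 * N + 1) * Real.pi / (4 * L)))..((2 * N + 1) * Real.pi / (4 * L)), f (k : ℂ)

/-- `∫ f(k) dk` over the part `|Re k| ≤ (2N+1) π / (4L)` of the contour `𝓛⁺`: the real line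
oriented from left to right, indented into the upper half-plane by the (clockwise) semicircles of
radius `r` around the points `k_n`. -/
def upperInt (L r : ℝ) (N : ℕ) (f : ℂ → ℂ) : ℂ :=
  ∑ n ∈ Finset.Icc (-(N : ℤ)) (N : ℤ), (flatInt L r n f + arcInt L r n Real.pi 0 f)

/-- The same for the contour `𝓛⁻`, indented into the lower half-plane by the (counterclockwise)
semicircles of radius `r` around the points `k_n`. -/
def lowerInt (L r : ℝ) (N : ℕ) (f : ℂ → ℂ) : ℂ :=
  ∑ n ∈ Finset.Icc (-(N : ℤ)) (N : ℤ),
    (flatInt L r n f + arcInt L r n Real.pi (2 * Real.pi) f)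

/-! ### The solution formulas -/

/-- `ω(k) = k μ_α / (μ_δ μ_β)`. -/
def omega (μα μβ μδ : ℂ → ℂ) (k : ℂ) : ℂ := k * μα k / (μδ k * μβ k)

/-- `e^{iωt} + e^{-iωt}`. -/
def expSum (ω : ℂ) (t : ℝ) : ℂ :=
  Complex.exp (Complex.I * ω * t) + Complex.exp (-(Complex.I * ω * t))

/-- `e^{iωt} - e^{-iωt}`. -/
def expDiff (ω : ℂ) (t : ℝ) : ℂ :=
  Complex.exp (Complex.I * ω * t) - Complex.exp (-(Complex.I * ω * t))

/-- The combination of the boundary values `f₀` (of `u`) and `f₂` (of `u_xx`) at one endpoint that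
enters the formula for `η`. -/
def etaBdry (α β δ : ℝ) (μα μβ μδ : ℂ → ℂ) (f₀ f₂ : ℝ → ℝ) (t : ℝ) (k : ℂ) : ℂ :=
  -((1 + α * k ^ 2) / (1 + β * k ^ 2)) * Bplus f₀ (omega μα μβ μδ k) t
    + α / (1 + β * k ^ 2) * Bplus f₂ (omega μα μβ μδ k) t
    + β * δ / (1 + β * k ^ 2) * Bplus (deriv (deriv f₂)) (omega μα μβ μδ k) t
    - β / (1 + β * k ^ 2) * Bplus (deriv (deriv f₀)) (omega μα μβ μδ k) t
    - Complex.I * δ * k * μα k / (μδ k * μβ k) * Bminus (deriv f₀) (omega μα μβ μδ k) t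

/-- The combination of the boundary values `f₀` (of `u`) and `f₂` (of `u_xx`) at one endpoint that
enters the formula for `u`. -/
def uBdry (α β δ : ℝ) (μα μβ μδ : ℂ → ℂ) (f₀ f₂ : ℝ → ℝ) (t : ℝ) (k : ℂ) : ℂ :=
  μα k / (μδ k * μβ k) * Bminus f₀ (omega μα μβ μδ k) t
    + Complex.I * δ * k / (1 + δ * k ^ 2) * Bplus (deriv f₀) (omega μα μβ μδ k) t
    + β / (μα k * μδ k * μβ k) * Bminus (deriv (deriv f₀)) (omega μα μβ μδ k) t
    - α / (μα k * μδ k * μβ k) * Bminus f₂ (omega μα μβ μδ k) t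
    - β * δ / (μα k * μδ k * μβ k) * Bminus (deriv (deriv f₂)) (omega μα μβ μδ k) t

/-- The seven contour integrals in the formula for `2π η(x, t)`, truncated at stage `N`. They
involve only the initial data `η₀, u₀` and the boundary data `g₀ = u(-L, ·)`, `h₀ = u(L, ·)`,
`g₂ = u_xx(-L, ·)`, `h₂ = u_xx(L, ·)`. -/
def etaTerms (α β δ L r : ℝ) (μα μβ μδ : ℂ → ℂ) (η₀ u₀ g₀ h₀ g₂ h₂ : ℝ → ℝ) (x t : ℝ)
    (N : ℕ) : Fin 7 → ℂ :=
  ![lineInt L N fun k =>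
      Complex.exp (Complex.I * k * x) * (1 / 2) *
        (expSum (omega μα μβ μδ k) t * fhat L η₀ k
          - μα k * μδ k / μβ k * expDiff (omega μα μβ μδ k) t * fhat L u₀ k),
    lowerInt L r N fun k =>
      Complex.exp (Complex.I * k * (x - L)) / (2 * (1 - Complex.exp (-(4 * Complex.I * k * L)))) *
        (expSum (omega μα μβ μδ k) t *
            (Complex.exp (-(3 * Complex.I * k * L)) * fhat L η₀ k
              + Complex.exp (-(Complex.I * k * L)) * fhat L η₀ (-k))
          - μα k * μδ k / μβ k * expDiff (omega μα μβ μδ k) t *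
            (Complex.exp (-(3 * Complex.I * k * L)) * fhat L u₀ k
              - Complex.exp (-(Complex.I * k * L)) * fhat L u₀ (-k))),
    upperInt L r N fun k =>
      Complex.exp (Complex.I * k * (x + L)) / (2 * (1 - Complex.exp (4 * Complex.I * k * L))) *
        (expSum (omega μα μβ μδ k) t *
            (Complex.exp (3 * Complex.I * k * L) * fhat L η₀ k
              + Complex.exp (Complex.I * k * L) * fhat L η₀ (-k))
          - μα k * μδ k / μβ k * expDiff (omega μα μβ μδ k) t *
            (Complex.exp (3 * Complex.I * k * L) * fhat L u₀ k
              - Complex.exp (Complex.I * k * L) * fhat L u₀ (-k))),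
    lowerInt L r N fun k =>
      Complex.exp (Complex.I * k * (x - L)) / (1 - Complex.exp (-(4 * Complex.I * k * L))) *
        etaBdry α β δ μα μβ μδ h₀ h₂ t k,
    upperInt L r N fun k =>
      Complex.exp (Complex.I * k * (x + L)) / (1 - Complex.exp (4 * Complex.I * k * L)) *
        -etaBdry α β δ μα μβ μδ g₀ g₂ t k,
    lowerInt L r N fun k =>
      Complex.exp (Complex.I * k * (x + L)) / (1 - Complex.exp (4 * Complex.I * k * L)) *
        etaBdry α β δ μα μβ μδ g₀ g₂ t k,
    upperInt L r N fun k =>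
      Complex.exp (Complex.I * k * (x - L)) / (1 - Complex.exp (-(4 * Complex.I * k * L))) *
        -etaBdry α β δ μα μβ μδ h₀ h₂ t k]

/-- The seven contour integrals in the formula for `2π u(x, t)`, truncated at stage `N`. -/
def uTerms (α β δ L r : ℝ) (μα μβ μδ : ℂ → ℂ) (η₀ u₀ g₀ h₀ g₂ h₂ : ℝ → ℝ) (x t : ℝ)
    (N : ℕ) : Fin 7 → ℂ :=
  ![lineInt L N fun k =>
      Complex.exp (Complex.I * k * x) * (1 / 2) *
        (-(μβ k / (μα k * μδ k)) * expDiff (omega μα μβ μδ k) t * fhat L η₀ k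
          + expSum (omega μα μβ μδ k) t * fhat L u₀ k),
    lowerInt L r N fun k =>
      Complex.exp (Complex.I * k * (x - L)) / (2 * (1 - Complex.exp (-(4 * Complex.I * k * L)))) *
        (-(μβ k / (μα k * μδ k)) * expDiff (omega μα μβ μδ k) t *
            (Complex.exp (-(3 * Complex.I * k * L)) * fhat L η₀ k
              + Complex.exp (-(Complex.I * k * L)) * fhat L η₀ (-k))
          + expSum (omega μα μβ μδ k) t *
            (Complex.exp (-(3 * Complex.I * k * L)) * fhat L u₀ k
              - Complex.exp (-(Complex.I * k * L)) * fhat L u₀ (-k))),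
    upperInt L r N fun k =>
      Complex.exp (Complex.I * k * (x + L)) / (2 * (1 - Complex.exp (4 * Complex.I * k * L))) *
        (-(μβ k / (μα k * μδ k)) * expDiff (omega μα μβ μδ k) t *
            (Complex.exp (3 * Complex.I * k * L) * fhat L η₀ k
              + Complex.exp (Complex.I * k * L) * fhat L η₀ (-k))
          + expSum (omega μα μβ μδ k) t *
            (Complex.exp (3 * Complex.I * k * L) * fhat L u₀ k
              - Complex.exp (Complex.I * k * L) * fhat L u₀ (-k))),
    lowerInt L r N fun k =>
      Complex.exp (Complex.I * k * (x - L)) / (1 - Complex.exp (-(4 * Complex.I * k * L))) *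
        uBdry α β δ μα μβ μδ h₀ h₂ t k,
    upperInt L r N fun k =>
      Complex.exp (Complex.I * k * (x + L)) / (1 - Complex.exp (4 * Complex.I * k * L)) *
        -uBdry α β δ μα μβ μδ g₀ g₂ t k,
    lowerInt L r N fun k =>
      Complex.exp (Complex.I * k * (x + L)) / (1 - Complex.exp (4 * Complex.I * k * L)) *
        uBdry α β δ μα μβ μδ g₀ g₂ t k,
    upperInt L r N fun k =>
      Complex.exp (Complex.I * k * (x - L)) / (1 - Complex.exp (-(4 * Complex.I * k * L))) *
        -uBdry α β δ μα μβ μδ h₀ h₂ t k]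

/-- `v = (1 / 2π) (I₁ + ⋯ + I₇)` for seven improper contour integrals with truncations `I N j`:
the sum of the seven truncated integrals tends to `2π v`, and whenever the seven integrals
converge one by one, `2π v` is the sum of their values. -/
def EqContourSum (v : ℝ) (I : ℕ → Fin 7 → ℂ) : Prop :=
  Tendsto (fun N => 1 / (2 * Real.pi) * ∑ j, I N j) atTop (𝓝 (v : ℂ)) ∧
    ∀ J : Fin 7 → ℂ, (∀ j, Tendsto (fun N => I N j) atTop (𝓝 (J j))) →
      (v : ℂ) = 1 / (2 * Real.pi) * ∑ j, J j

end Nwogu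

end

open MeasureTheory Metric

namespace Nwogu

/-! ### Integrals over the arcs and the flat pieces -/

/-! The truncated formula is a partial sum of a half-range Fourier series written as contour
integrals. In one cell the first three integrands add up to zero off the poles, and the first has no
pole, so its diameter can be bent onto the lower semicircle. Everything then cancels except a
clockwise circle about `k_n` (`cell_three`). The other four integrals form two pairs `±f` over `𝓛∓`,
each leaving a full circle (`cell_two`). Since `1 - e^{±4ikL}` has a simple zero at `k_n`, the
residues are explicit, and the truncated sum is `(π/2L) Σ e^{ik_n(x+L)} c_n` over `|n| ≤ N`
(`sum_contours_eq_residues`).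

The numbers `c_n` are modes of the solution: twice the cosine mode of `η(·,t)` in one formula, and
`-2i` times the sine mode of `u(·,t)` in the other. Testing the first equation with `cos(k_n(x+L))`
and the second with `sin(k_n(x+L))` gives a forced oscillator for these two modes (`cosMode_ode`,
`sinMode_ode`). The term with `β` produces the unprescribed trace `η_xt`; the second equation, valid
up to the endpoints, trades it for `δ u_xxtt - u_tt`. Hence the second time derivatives of the
boundary data. Variation of constants (`oscillator_solution`) produces the transforms `B^±`, and
`modes_eq` identifies the outcome with the residues.

The half-range series sums to the solution at interior points: its partial sums are integrals
against the Dirichlet kernel of period `4L`, at `x - y` and at the reflected argument `x + y + 2L`.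
Only the first is singular inside the interval (`tendsto_cos_series`, `tendsto_sin_series`).

The square roots, arbitrary and possibly discontinuous, are harmless: `c` and `B^+` are even in `ω`,
while `s` and `B^-` are odd and come with a coefficient whose product with `ω` is rational in `k`.
So all data agree, off the countable set of zeros of the roots, with functions holomorphic where
`1+βk²` and `1+δk²` do not vanish (`HolomorphicOff`). The conditions on `r` keep the discs in that
region. -/

theorem arcInt_eq_integral_circleMap (L r : ℝ) (n : ℤ) (a b : ℝ) (f : ℂ → ℂ) :
    arcInt L r n a b f =
      ∫ θ in a..b, deriv (circleMap (kn L n) r) θ • f (circleMap (kn L n) r θ) := by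
  unfold arcInt
  congr 1
  ext θ
  simp only [deriv_circleMap, circleMap, smul_eq_mul]
  rw [mul_comm Complex.I (θ : ℂ)]
  ring

theorem arcInt_full (L r : ℝ) (n : ℤ) (f : ℂ → ℂ) :
    arcInt L r n 0 (2 * Real.pi) f = ∮ z in C((kn L n : ℂ), r), f z :=
  arcInt_eq_integral_circleMap L r n 0 _ f

/-- A countable set pulls back to a null set of angles. This is needed because `r√α` is not
restricted: a zero of `μα` may lie on an arc, and the integrand as written divides by zero there. -/
theorem arcInt_congr {L r : ℝ} (hr : r ≠ 0) (n : ℤ) (a b : ℝ) {f g : ℂ → ℂ} {Z : Set ℂ}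
    (hZ : Z.Countable) (h : ∀ k ∉ Z, f k = g k) : arcInt L r n a b f = arcInt L r n a b g := by
  rw [arcInt_eq_integral_circleMap, arcInt_eq_integral_circleMap]
  refine intervalIntegral.integral_congr_ae ?_
  filter_upwards [(hZ.preimage_circleMap (kn L n : ℂ) hr).ae_notMem volume] with θ hθ _
  rw [h _ hθ]

theorem integral_ofReal_congr (a b : ℝ) {f g : ℂ → ℂ} {Z : Set ℂ}
    (hZ : Z.Countable) (h : ∀ k ∉ Z, f k = g k) :
    ∫ k in a..b, f (k : ℂ) = ∫ k in a..b, g (k : ℂ) := by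
  refine intervalIntegral.integral_congr_ae ?_
  filter_upwards [(hZ.preimage Complex.ofReal_injective).ae_notMem volume] with k hk _
  rw [h _ hk]

theorem flatInt_congr (L r : ℝ) (n : ℤ) {f g : ℂ → ℂ} {Z : Set ℂ}
    (hZ : Z.Countable) (h : ∀ k ∉ Z, f k = g k) : flatInt L r n f = flatInt L r n g := by
  unfold flatInt
  rw [integral_ofReal_congr _ _ hZ h, integral_ofReal_congr _ _ hZ h]

theorem lineInt_congr (L : ℝ) (N : ℕ) {f g : ℂ → ℂ} {Z : Set ℂ}
    (hZ : Z.Countable) (h : ∀ k ∉ Z, f k = g k) : lineInt L N f = lineInt L N g :=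
  integral_ofReal_congr _ _ hZ h

theorem upperInt_congr (L : ℝ) {r : ℝ} (hr : r ≠ 0) (N : ℕ) {f g : ℂ → ℂ} {Z : Set ℂ}
    (hZ : Z.Countable) (h : ∀ k ∉ Z, f k = g k) : upperInt L r N f = upperInt L r N g := by
  unfold upperInt
  refine Finset.sum_congr rfl fun n _ => ?_
  rw [flatInt_congr L r n hZ h, arcInt_congr hr n _ _ hZ h]

theorem lowerInt_congr (L : ℝ) {r : ℝ} (hr : r ≠ 0) (N : ℕ) {f g : ℂ → ℂ} {Z : Set ℂ}
    (hZ : Z.Countable) (h : ∀ k ∉ Z, f k = g k) : lowerInt L r N f = lowerInt L r N g := by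
  unfold lowerInt
  refine Finset.sum_congr rfl fun n _ => ?_
  rw [flatInt_congr L r n hZ h, arcInt_congr hr n _ _ hZ h]

theorem flatInt_neg (L r : ℝ) (n : ℤ) (f : ℂ → ℂ) :
    flatInt L r n (fun k => -f k) = -flatInt L r n f := by
  simp only [flatInt, intervalIntegral.integral_neg]
  ring

theorem arcInt_neg (L r : ℝ) (n : ℤ) (a b : ℝ) (f : ℂ → ℂ) :
    arcInt L r n a b (fun k => -f k) = -arcInt L r n a b f := by
  simp only [arcInt, neg_mul, intervalIntegral.integral_neg]

section arc

variable {L r : ℝ} {n : ℤ} {f g : ℂ → ℂ}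

theorem intervalIntegrable_arc (hr : 0 ≤ r) (hf : ContinuousOn f (sphere (kn L n : ℂ) r))
    (a b : ℝ) :
    IntervalIntegrable
      (fun θ => deriv (circleMap (kn L n) r) θ • f (circleMap (kn L n) r θ)) volume a b := by
  refine Continuous.intervalIntegrable ?_ a b
  have h1 : Continuous fun θ => f (circleMap (kn L n) r θ) :=
    hf.comp_continuous (continuous_circleMap _ _) fun θ => circleMap_mem_sphere _ hr θ
  simp only [deriv_circleMap]
  exact ((continuous_circleMap _ _).mul continuous_const).smul h1

theorem arcInt_add (hr : 0 ≤ r) (hf : ContinuousOn f (sphere (kn L n : ℂ) r))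
    (hg : ContinuousOn g (sphere (kn L n : ℂ) r)) (a b : ℝ) :
    arcInt L r n a b (fun k => f k + g k) = arcInt L r n a b f + arcInt L r n a b g := by
  simp only [arcInt_eq_integral_circleMap, smul_add]
  exact intervalIntegral.integral_add (intervalIntegrable_arc hr hf a b)
    (intervalIntegrable_arc hr hg a b)

/-- The lower arc followed by the reversed upper arc is the full circle. -/
theorem arcInt_lower_sub_upper (hr : 0 ≤ r) (hf : ContinuousOn f (sphere (kn L n : ℂ) r)) :
    arcInt L r n Real.pi (2 * Real.pi) f - arcInt L r n Real.pi 0 f =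
      ∮ z in C((kn L n : ℂ), r), f z := by
  rw [← arcInt_full]
  simp only [arcInt_eq_integral_circleMap]
  rw [intervalIntegral.integral_symm 0 Real.pi, sub_eq_iff_eq_add, ← sub_eq_add_neg,
    eq_comm, sub_eq_iff_eq_add, add_comm]
  exact (intervalIntegral.integral_add_adjacent_intervals
    (intervalIntegrable_arc hr hf 0 Real.pi)
    (intervalIntegrable_arc hr hf Real.pi (2 * Real.pi))).symm

/-- For a function that is holomorphic near the disc, a diameter and the lower semicircle give the
same integral. -/
theorem integral_diameter_eq_arcInt {R : ℝ} (hr : 0 ≤ r) (hrR : r < R)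
    (hf : DifferentiableOn ℂ f (ball (kn L n : ℂ) R)) :
    ∫ k in (kn L n - r)..(kn L n + r), f (k : ℂ) = arcInt L r n Real.pi (2 * Real.pi) f := by
  -- With a primitive `F` on the disc both integrals equal `F(k_n + r) - F(k_n - r)`, since angles
  -- `π` and `2π` are the two ends of the diameter.
  obtain ⟨F, hF⟩ := hf.isExactOn_ball
  have hR : 0 < R := hr.trans_lt hrR
  have hsph : sphere (kn L n : ℂ) r ⊆ ball (kn L n : ℂ) R := fun z hz => by
    rw [mem_sphere] at hz; rw [mem_ball, hz]; exact hrR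
  have hseg : ∀ k ∈ uIcc (kn L n - r) (kn L n + r), (k : ℂ) ∈ ball (kn L n : ℂ) R := by
    intro k hk
    rw [uIcc_of_le (by linarith)] at hk
    rw [mem_ball, dist_eq_norm, ← Complex.ofReal_sub, Complex.norm_real, Real.norm_eq_abs, abs_lt]
    constructor <;> linarith [hk.1, hk.2]
  rw [arcInt_eq_integral_circleMap]
  rw [intervalIntegral.integral_eq_sub_of_hasDerivAt (f := fun k : ℝ => F k)
    (fun k hk => (hF _ (hseg k hk)).comp_ofReal)]
  · rw [intervalIntegral.integral_eq_sub_of_hasDerivAt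
      (f := fun θ : ℝ => F (circleMap (kn L n) r θ))]
    · simp [circleMap, sub_eq_add_neg]
    · intro θ _
      have h1 := hF _ (hsph (circleMap_mem_sphere (kn L n : ℂ) hr θ))
      have h2 := (differentiable_circleMap (kn L n : ℂ) r θ).hasDerivAt
      have := h1.scomp θ h2
      simpa [Function.comp_def] using this
    · exact intervalIntegrable_arc hr (hf.continuousOn.mono hsph) _ _
  · refine ContinuousOn.intervalIntegrable ?_
    exact hf.continuousOn.comp Complex.continuous_ofReal.continuousOn hseg

end arc

/-! ### The centres `k_n` -/

theorem exp_four_kn {L : ℝ} (hL : L ≠ 0) (n : ℤ) :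
    Complex.exp (4 * Complex.I * (kn L n : ℂ) * L) = 1 := by
  rw [Complex.exp_eq_one_iff]
  refine ⟨n, ?_⟩
  have : (L : ℂ) ≠ 0 := Complex.ofReal_ne_zero.mpr hL
  simp only [kn]
  push_cast
  field_simp
  ring

/-- The solutions of `e^{4ikL} = 1` are exactly the points `k_m`, spaced by `π/(2L)`, so a closed
disc of half that radius about `k_n` contains no other one. -/
theorem eq_kn_of_exp_eq_one {L : ℝ} (hL : 0 < L) (n : ℤ) {k : ℂ}
    (hk : Complex.exp (4 * Complex.I * k * L) = 1)
    (hkn : ‖k - kn L n‖ ≤ Real.pi / (4 * L)) : k = kn L n := by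
  rw [Complex.exp_eq_one_iff] at hk
  obtain ⟨m, hm⟩ := hk
  have hLC : (L : ℂ) ≠ 0 := Complex.ofReal_ne_zero.mpr hL.ne'
  have hkm : k = kn L m := by
    simp only [kn]
    push_cast
    field_simp
    have h4 : (2 * Complex.I) * (k * (2 * L)) = (2 * Complex.I) * (m * Real.pi) := by
      rw [show (2 * Complex.I) * (k * (2 * (L : ℂ))) = 4 * Complex.I * k * L by ring, hm]; ring
    have := mul_left_cancel₀ (mul_ne_zero two_ne_zero Complex.I_ne_zero) h4
    rw [← this]; ring
  subst hkm
  rw [← Complex.ofReal_sub, Complex.norm_real, Real.norm_eq_abs] at hkn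
  have h1 : kn L m - kn L n = ((m - n : ℤ) : ℝ) * (Real.pi / (2 * L)) := by
    simp only [kn]; push_cast; ring
  have hpos : 0 < Real.pi / (4 * L) := by positivity
  have h2 : Real.pi / (2 * L) = 2 * (Real.pi / (4 * L)) := by field_simp; norm_num
  rw [h1, abs_mul, h2, abs_of_pos (by positivity : 0 < 2 * (Real.pi / (4 * L)))] at hkn
  have h3 : |((m - n : ℤ) : ℝ)| < 1 := by nlinarith
  rw [← Int.cast_abs] at h3
  have h4 : |m - n| < 1 := by exact_mod_cast h3
  have : m = n := by have := Int.abs_lt_one_iff.mp h4; omega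
  rw [this]

/-- The residue theorem for a simple pole of `1 / (1 - e^{ck})` at `k_n`. -/
theorem circleIntegral_div_one_sub_exp {c z₀ : ℂ} {r R : ℝ} (hr : 0 < r) (hrR : r < R) (hc : c ≠ 0)
    (h1 : Complex.exp (c * z₀) = 1)
    (hne : ∀ z ∈ ball z₀ R, Complex.exp (c * z) = 1 → z = z₀) {f : ℂ → ℂ}
    (hf : DifferentiableOn ℂ f (ball z₀ R)) :
    (∮ z in C(z₀, r), f z / (1 - Complex.exp (c * z))) =
      -(2 * Real.pi * Complex.I / c) * f z₀ := by
  have hR : 0 < R := hr.trans hrR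
  set e : ℂ → ℂ := fun z => 1 - Complex.exp (c * z) with he
  -- Division by the simple zero: `1 - e^{cz} = (z - z₀) q(z)` with `q` holomorphic, zero-free on
  -- the ball and `q(z₀) = -c`. Cauchy's formula for `f / q` then gives the residue.
  set q : ℂ → ℂ := dslope e z₀ with hq
  have hsub : closedBall z₀ r ⊆ ball z₀ R := closedBall_subset_ball hrR
  have he0 : e z₀ = 0 := by simp [he, h1]
  have hde : HasDerivAt e (-c) z₀ := by
    have : HasDerivAt (fun z => 1 - Complex.exp (c * z)) (-(Complex.exp (c * z₀) * (c * 1))) z₀ :=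
      (((hasDerivAt_id z₀).const_mul c).cexp).const_sub 1
    simpa [h1] using this
  have hq0 : q z₀ = -c := by rw [hq, dslope_same, hde.deriv]
  have heq : ∀ z, e z = (z - z₀) * q z := fun z => by
    have := sub_smul_dslope e z₀ z
    rw [he0, sub_zero, smul_eq_mul] at this
    exact this.symm
  have hqne : ∀ z ∈ ball z₀ R, q z ≠ 0 := by
    intro z hz h0
    by_cases hzz : z = z₀
    · rw [hzz, hq0] at h0; exact hc (neg_eq_zero.mp h0)
    · refine hzz (hne z hz ?_)
      have := heq z
      rw [h0, mul_zero] at this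
      exact (sub_eq_zero.mp this).symm
  have hqd : DifferentiableOn ℂ q (ball z₀ R) := by
    rw [hq, Complex.differentiableOn_dslope (ball_mem_nhds z₀ hR)]
    exact (by fun_prop : Differentiable ℂ e).differentiableOn
  have hfq : DifferentiableOn ℂ (fun z => f z / q z) (closedBall z₀ r) :=
    (hf.div hqd hqne).mono hsub
  have key := hfq.circleIntegral_sub_inv_smul (mem_ball_self hr)
  rw [hq0, smul_eq_mul] at key
  rw [show -(2 * Real.pi * Complex.I / c) * f z₀ = 2 * Real.pi * Complex.I * (f z₀ / -c) by
    field_simp, ← key]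
  refine circleIntegral.integral_congr hr.le fun z _ => ?_
  change f z / e z = _
  rw [heq z, smul_eq_mul, div_mul_eq_div_div, div_eq_inv_mul, div_eq_inv_mul, div_eq_inv_mul]
  ring

/-! ### Collapse of the contours to circles, cell by cell. -/

section cell

variable {L r R : ℝ} {U : Set ℂ}

theorem exp_ne_one_of_flat (hL : 0 < L) (hr : 0 < r) (n : ℤ) {k : ℝ}
    (h1 : |k - kn L n| ≤ Real.pi / (4 * L)) (h2 : r ≤ |k - kn L n|) :
    Complex.exp (4 * Complex.I * (k : ℂ) * L) ≠ 1 := by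
  intro h
  have h3 := eq_kn_of_exp_eq_one hL n h
    (by rw [← Complex.ofReal_sub, Complex.norm_real]; exact h1)
  have h4 : k = kn L n := by exact_mod_cast h3
  rw [h4, sub_self, abs_zero] at h2
  linarith

theorem exp_ne_one_of_sphere (hL : 0 < L) (hr : 0 < r) (hrL : r < Real.pi / (4 * L)) (n : ℤ)
    {k : ℂ} (h : k ∈ sphere (kn L n : ℂ) r) :
    Complex.exp (4 * Complex.I * k * L) ≠ 1 := by
  intro h1
  rw [mem_sphere, dist_eq_norm] at h
  have := eq_kn_of_exp_eq_one hL n h1 (by rw [h]; exact hrL.le)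
  rw [this, sub_self, norm_zero] at h
  linarith

theorem flat_bounds (hrL : r ≤ Real.pi / (4 * L)) (hr : 0 < r) (n : ℤ) {k : ℝ}
    (hk : k ∈ uIcc (kn L n - Real.pi / (4 * L)) (kn L n - r) ∨
      k ∈ uIcc (kn L n + r) (kn L n + Real.pi / (4 * L))) :
    |k - kn L n| ≤ Real.pi / (4 * L) ∧ r ≤ |k - kn L n| := by
  rw [uIcc_of_le (by linarith), uIcc_of_le (by linarith), mem_Icc, mem_Icc] at hk
  rcases hk with hk | hk
  · rw [abs_of_neg (by linarith [hk.2])]; constructor <;> linarith [hk.1, hk.2]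
  · rw [abs_of_pos (by linarith [hk.1])]; constructor <;> linarith [hk.1, hk.2]

theorem flatInt_congr_on (hL : 0 < L) (hr : 0 < r) (hrL : r ≤ Real.pi / (4 * L)) (n : ℤ)
    {f g : ℂ → ℂ}
    (h : ∀ k : ℝ, Complex.exp (4 * Complex.I * (k : ℂ) * L) ≠ 1 → f k = g k) :
    flatInt L r n f = flatInt L r n g := by
  have key : ∀ k : ℝ, (k ∈ uIcc (kn L n - Real.pi / (4 * L)) (kn L n - r) ∨
      k ∈ uIcc (kn L n + r) (kn L n + Real.pi / (4 * L))) → f k = g k := fun k hk =>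
    have := flat_bounds hrL hr n hk
    h k (exp_ne_one_of_flat hL hr n this.1 this.2)
  unfold flatInt
  rw [intervalIntegral.integral_congr fun k hk => key k (Or.inl hk),
    intervalIntegral.integral_congr fun k hk => key k (Or.inr hk)]

theorem intervalIntegrable_flat (hL : 0 < L) (hr : 0 < r) (hrL : r ≤ Real.pi / (4 * L)) (n : ℤ)
    (hreal : ∀ k : ℝ, (k : ℂ) ∈ U) {f : ℂ → ℂ}
    (hf : ContinuousOn f {k ∈ U | Complex.exp (4 * Complex.I * k * L) ≠ 1}) :
    IntervalIntegrable (fun k : ℝ => f k) volume (kn L n - Real.pi / (4 * L)) (kn L n - r) ∧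
    IntervalIntegrable (fun k : ℝ => f k) volume (kn L n + r) (kn L n + Real.pi / (4 * L)) := by
  constructor
  · refine (hf.comp Complex.continuous_ofReal.continuousOn fun k hk => ?_).intervalIntegrable
    have := flat_bounds hrL hr n (Or.inl hk)
    exact ⟨hreal k, exp_ne_one_of_flat hL hr n this.1 this.2⟩
  · refine (hf.comp Complex.continuous_ofReal.continuousOn fun k hk => ?_).intervalIntegrable
    have := flat_bounds hrL hr n (Or.inr hk)
    exact ⟨hreal k, exp_ne_one_of_flat hL hr n this.1 this.2⟩

/-- The contribution of one cell to three integrals whose integrands add up to zero. -/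
theorem cell_three (hL : 0 < L) (hr : 0 < r) (hrR : r < R) (hRL : R ≤ Real.pi / (4 * L)) (n : ℤ)
    (hball : ball (kn L n : ℂ) R ⊆ U) (hreal : ∀ k : ℝ, (k : ℂ) ∈ U) {F₁ F₂ F₃ : ℂ → ℂ}
    (h₁ : DifferentiableOn ℂ F₁ U)
    (h₃ : ContinuousOn F₃ {k ∈ U | Complex.exp (4 * Complex.I * k * L) ≠ 1})
    (h : ∀ k : ℂ, Complex.exp (4 * Complex.I * k * L) ≠ 1 → F₂ k = -(F₁ k + F₃ k)) :
    (∫ k in (kn L n - Real.pi / (4 * L))..(kn L n + Real.pi / (4 * L)), F₁ (k : ℂ)) +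
      (flatInt L r n F₂ + arcInt L r n Real.pi (2 * Real.pi) F₂) +
      (flatInt L r n F₃ + arcInt L r n Real.pi 0 F₃) = -∮ z in C((kn L n : ℂ), r), F₃ z := by
  have hrL : r < Real.pi / (4 * L) := hrR.trans_le hRL
  have h₁' : ContinuousOn F₁ {k ∈ U | Complex.exp (4 * Complex.I * k * L) ≠ 1} :=
    h₁.continuousOn.mono fun k hk => hk.1
  have hsub : sphere (kn L n : ℂ) r ⊆ {k ∈ U | Complex.exp (4 * Complex.I * k * L) ≠ 1} :=
    fun k hk => ⟨hball (by rw [mem_ball, mem_sphere.mp hk]; exact hrR),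
      exp_ne_one_of_sphere hL hr hrL n hk⟩
  have e1 : flatInt L r n F₂ = -(flatInt L r n F₁ + flatInt L r n F₃) := by
    rw [flatInt_congr_on hL hr hrL.le n (g := fun k => -(F₁ k + F₃ k)) fun k hk => h k hk,
      flatInt_neg]
    obtain ⟨i1, i2⟩ := intervalIntegrable_flat hL hr hrL.le n hreal h₁'
    obtain ⟨i3, i4⟩ := intervalIntegrable_flat hL hr hrL.le n hreal h₃
    simp only [flatInt]
    rw [intervalIntegral.integral_add i1 i3, intervalIntegral.integral_add i2 i4]
    ring
  have e2 : arcInt L r n Real.pi (2 * Real.pi) F₂ =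
      -(arcInt L r n Real.pi (2 * Real.pi) F₁ + arcInt L r n Real.pi (2 * Real.pi) F₃) := by
    rw [← arcInt_add hr.le (h₁'.mono hsub) (h₃.mono hsub), ← arcInt_neg]
    simp only [arcInt_eq_integral_circleMap]
    refine intervalIntegral.integral_congr fun θ _ => ?_
    have := h _ (hsub (circleMap_mem_sphere (kn L n : ℂ) hr.le θ)).2
    simp only [this]
  -- Only `F₁` is holomorphic across `k_n`, so only its path may be moved; it is moved to the lower
  -- arc to match the path of `F₂`.
  have e3 : (∫ k in (kn L n - Real.pi / (4 * L))..(kn L n + Real.pi / (4 * L)), F₁ (k : ℂ)) =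
      flatInt L r n F₁ + arcInt L r n Real.pi (2 * Real.pi) F₁ := by
    rw [← integral_diameter_eq_arcInt hr.le hrR (h₁.mono hball)]
    have hc : Continuous fun k : ℝ => F₁ k :=
      h₁.continuousOn.comp_continuous Complex.continuous_ofReal hreal
    have hi : ∀ a b : ℝ, IntervalIntegrable (fun k : ℝ => F₁ k) volume a b :=
      fun a b => hc.intervalIntegrable a b
    rw [← intervalIntegral.integral_add_adjacent_intervals (hi _ (kn L n + r)) (hi _ _),
      ← intervalIntegral.integral_add_adjacent_intervals (hi _ (kn L n - r)) (hi _ _), flatInt]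
    ring
  have e4 := arcInt_lower_sub_upper hr.le (h₃.mono hsub)
  -- All `F₁` terms and the flat pieces of `F₃` cancel. What remains is the upper minus the lower
  -- arc of `F₃`, a clockwise circle, hence the minus sign.
  rw [e1, e2, e3, ← e4]
  ring

/-- The contribution of one cell to the integrals of `f` over `𝓛⁻` and of `-f` over `𝓛⁺`. -/
theorem cell_two (hL : 0 < L) (hr : 0 < r) (hrR : r < R) (hRL : R ≤ Real.pi / (4 * L)) (n : ℤ)
    (hball : ball (kn L n : ℂ) R ⊆ U) {f : ℂ → ℂ}
    (hf : ContinuousOn f {k ∈ U | Complex.exp (4 * Complex.I * k * L) ≠ 1}) :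
    (flatInt L r n f + arcInt L r n Real.pi (2 * Real.pi) f) +
      (flatInt L r n (fun k => -f k) + arcInt L r n Real.pi 0 fun k => -f k) =
      ∮ z in C((kn L n : ℂ), r), f z := by
  have hsub : sphere (kn L n : ℂ) r ⊆ {k ∈ U | Complex.exp (4 * Complex.I * k * L) ≠ 1} :=
    fun k hk => ⟨hball (by rw [mem_ball, mem_sphere.mp hk]; exact hrR),
      exp_ne_one_of_sphere hL hr (hrR.trans_le hRL) n hk⟩
  rw [← arcInt_lower_sub_upper hr.le (hf.mono hsub), flatInt_neg, arcInt_neg]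
  ring

end cell

theorem sum_Icc_neg_succ (f : ℤ → ℂ) (N : ℕ) :
    ∑ n ∈ Finset.Icc (-((N + 1 : ℕ) : ℤ)) ((N + 1 : ℕ) : ℤ), f n =
      f (-((N : ℤ) + 1)) + ∑ n ∈ Finset.Icc (-(N : ℤ)) (N : ℤ), f n + f ((N : ℤ) + 1) := by
  have h1 : Finset.Icc (-((N + 1 : ℕ) : ℤ)) ((N + 1 : ℕ) : ℤ) =
      insert (-((N : ℤ) + 1)) (insert ((N : ℤ) + 1) (Finset.Icc (-(N : ℤ)) (N : ℤ))) := by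
    ext n
    simp only [Finset.mem_insert, Finset.mem_Icc]
    push_cast
    omega
  rw [h1, Finset.sum_insert (by simp; omega), Finset.sum_insert (by simp)]
  ring

/-- The half-width `π/(4L)` is half the spacing of the centres, so consecutive cells abut; passing
from `N` to `N + 1` adds one cell at each end. -/
theorem lineInt_eq_sum_cells {L : ℝ} (hL : 0 < L) {f : ℂ → ℂ}
    (hf : Continuous fun k : ℝ => f k) (N : ℕ) :
    lineInt L N f = ∑ n ∈ Finset.Icc (-(N : ℤ)) (N : ℤ),
      ∫ k in (kn L n - Real.pi / (4 * L))..(kn L n + Real.pi / (4 * L)), f (k : ℂ) := by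
  have hi : ∀ a b : ℝ, IntervalIntegrable (fun k : ℝ => f k) volume a b :=
    fun a b => hf.intervalIntegrable a b
  induction N with
  | zero => simp [lineInt, kn]
  | succ N ih =>
    rw [sum_Icc_neg_succ, ← ih]
    have a1 : kn L (-((N : ℤ) + 1)) - Real.pi / (4 * L) =
        -((2 * ((N + 1 : ℕ) : ℝ) + 1) * Real.pi / (4 * L)) := by
      simp only [kn]; push_cast; field_simp; ring
    have a2 : kn L (-((N : ℤ) + 1)) + Real.pi / (4 * L) =
        -((2 * (N : ℝ) + 1) * Real.pi / (4 * L)) := by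
      simp only [kn]; push_cast; field_simp; ring
    have a3 : kn L ((N : ℤ) + 1) - Real.pi / (4 * L) =
        (2 * (N : ℝ) + 1) * Real.pi / (4 * L) := by
      simp only [kn]; push_cast; field_simp; ring
    have a4 : kn L ((N : ℤ) + 1) + Real.pi / (4 * L) =
        (2 * ((N + 1 : ℕ) : ℝ) + 1) * Real.pi / (4 * L) := by
      simp only [kn]; push_cast; field_simp; ring
    rw [a1, a2, a3, a4]
    unfold lineInt
    rw [intervalIntegral.integral_add_adjacent_intervals (hi _ _) (hi _ _),
      intervalIntegral.integral_add_adjacent_intervals (hi _ _) (hi _ _)]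

/-- The seven truncated contour integrals with holomorphic data `X, Y, H, G` collapse to a sum of
residues. -/
theorem sum_contours_eq_residues {L r R : ℝ} {U : Set ℂ} (hL : 0 < L) (hr : 0 < r) (hrR : r < R)
    (hRL : R ≤ Real.pi / (4 * L)) (hball : ∀ n, ball (kn L n : ℂ) R ⊆ U)
    (hreal : ∀ k : ℝ, (k : ℂ) ∈ U) {X Y H G : ℂ → ℂ} (hX : DifferentiableOn ℂ X U)
    (hY : DifferentiableOn ℂ Y U) (hH : DifferentiableOn ℂ H U) (hG : DifferentiableOn ℂ G U)
    (x : ℝ) (N : ℕ) :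
    lineInt L N (fun k => Complex.exp (Complex.I * k * x) * (1 / 2) * X k) +
    lowerInt L r N (fun k => Complex.exp (Complex.I * k * (x - L)) /
      (2 * (1 - Complex.exp (-(4 * Complex.I * k * L)))) *
        (Complex.exp (-(3 * Complex.I * k * L)) * X k +
          Complex.exp (-(Complex.I * k * L)) * Y k)) +
    upperInt L r N (fun k => Complex.exp (Complex.I * k * (x + L)) /
      (2 * (1 - Complex.exp (4 * Complex.I * k * L))) *
        (Complex.exp (3 * Complex.I * k * L) * X k + Complex.exp (Complex.I * k * L) * Y k)) +
    lowerInt L r N (fun k => Complex.exp (Complex.I * k * (x - L)) /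
      (1 - Complex.exp (-(4 * Complex.I * k * L))) * H k) +
    upperInt L r N (fun k => Complex.exp (Complex.I * k * (x + L)) /
      (1 - Complex.exp (4 * Complex.I * k * L)) * -G k) +
    lowerInt L r N (fun k => Complex.exp (Complex.I * k * (x + L)) /
      (1 - Complex.exp (4 * Complex.I * k * L)) * G k) +
    upperInt L r N (fun k => Complex.exp (Complex.I * k * (x - L)) /
      (1 - Complex.exp (-(4 * Complex.I * k * L))) * -H k) =
    ∑ n ∈ Finset.Icc (-(N : ℤ)) (N : ℤ), (Real.pi / (2 * L) : ℂ) *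
      (Complex.exp (Complex.I * kn L n * (x + L)) *
        ((Complex.exp (-(Complex.I * kn L n * L)) * X (kn L n) +
          Complex.exp (Complex.I * kn L n * L) * Y (kn L n)) / 2 +
          Complex.exp (-(2 * Complex.I * kn L n * L)) * H (kn L n) - G (kn L n))) := by
  have hLC : (L : ℂ) ≠ 0 := Complex.ofReal_ne_zero.mpr hL.ne'
  have hd1 : DifferentiableOn ℂ (fun k => Complex.exp (Complex.I * k * x) * (1 / 2) * X k) U :=
    (Differentiable.differentiableOn (by fun_prop)).mul hX
  have hK : DifferentiableOn ℂ (fun k => Complex.exp (Complex.I * k * (x + L)) / 2 *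
      (Complex.exp (3 * Complex.I * k * L) * X k + Complex.exp (Complex.I * k * L) * Y k)) U :=
    (Differentiable.differentiableOn (by fun_prop)).mul
      (((Differentiable.differentiableOn (by fun_prop)).mul hX).add
        ((Differentiable.differentiableOn (by fun_prop)).mul hY))
  have hEH : DifferentiableOn ℂ (fun k => Complex.exp (Complex.I * k * (x - L)) * H k) U :=
    (Differentiable.differentiableOn (by fun_prop)).mul hH
  have hEG : DifferentiableOn ℂ (fun k => Complex.exp (Complex.I * k * (x + L)) * G k) U :=
    (Differentiable.differentiableOn (by fun_prop)).mul hG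
  set V : Set ℂ := {k ∈ U | Complex.exp (4 * Complex.I * k * L) ≠ 1} with hV
  have hp : ∀ k ∈ V, 1 - Complex.exp (4 * Complex.I * L * k) ≠ 0 := fun k hk h0 => hk.2 (by
    rw [show 4 * Complex.I * k * L = 4 * Complex.I * L * k by ring, ← sub_eq_zero.mp h0])
  have hm' : ∀ k : ℂ, Complex.exp (4 * Complex.I * k * L) ≠ 1 →
      1 - Complex.exp (-(4 * Complex.I * L) * k) ≠ 0 := fun k hk h0 => hk (by
    have h1 := (sub_eq_zero.mp h0).symm
    rw [neg_mul, Complex.exp_neg, inv_eq_one] at h1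
    rw [show 4 * Complex.I * k * L = 4 * Complex.I * L * k by ring, h1])
  have hm : ∀ k ∈ V, 1 - Complex.exp (-(4 * Complex.I * L) * k) ≠ 0 := fun k hk => hm' k hk.2
  have cK : ContinuousOn (fun k => Complex.exp (Complex.I * k * (x + L)) / 2 *
      (Complex.exp (3 * Complex.I * k * L) * X k + Complex.exp (Complex.I * k * L) * Y k) /
        (1 - Complex.exp (4 * Complex.I * L * k))) V := (hK.continuousOn.mono (fun k hk => hk.1 : V ⊆ U)).div
    (by fun_prop : Continuous fun k => 1 - Complex.exp (4 * Complex.I * L * k)).continuousOn hp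
  have cH : ContinuousOn (fun k => Complex.exp (Complex.I * k * (x - L)) * H k /
        (1 - Complex.exp (-(4 * Complex.I * L) * k))) V := (hEH.continuousOn.mono (fun k hk => hk.1 : V ⊆ U)).div
    (by fun_prop : Continuous fun k => 1 - Complex.exp (-(4 * Complex.I * L) * k)).continuousOn hm
  have cG : ContinuousOn (fun k => Complex.exp (Complex.I * k * (x + L)) * G k /
        (1 - Complex.exp (4 * Complex.I * L * k))) V := (hEG.continuousOn.mono (fun k hk => hk.1 : V ⊆ U)).div
    (by fun_prop : Continuous fun k => 1 - Complex.exp (4 * Complex.I * L * k)).continuousOn hp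
  have hc4 : (4 * Complex.I * L : ℂ) ≠ 0 :=
    mul_ne_zero (mul_ne_zero (by norm_num) Complex.I_ne_zero) hLC
  have f3 : (fun k => Complex.exp (Complex.I * k * (x + L)) /
      (2 * (1 - Complex.exp (4 * Complex.I * k * L))) *
        (Complex.exp (3 * Complex.I * k * L) * X k + Complex.exp (Complex.I * k * L) * Y k)) =
      fun k => Complex.exp (Complex.I * k * (x + L)) / 2 *
      (Complex.exp (3 * Complex.I * k * L) * X k + Complex.exp (Complex.I * k * L) * Y k) /
        (1 - Complex.exp (4 * Complex.I * L * k)) := by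
    ext k
    rw [show 4 * Complex.I * k * L = 4 * Complex.I * L * k by ring, div_mul_eq_div_div]
    ring
  have f4 : (fun k => Complex.exp (Complex.I * k * (x - L)) /
      (1 - Complex.exp (-(4 * Complex.I * k * L))) * H k) =
      fun k => Complex.exp (Complex.I * k * (x - L)) * H k /
        (1 - Complex.exp (-(4 * Complex.I * L) * k)) := by
    ext k
    rw [show -(4 * Complex.I * k * L) = -(4 * Complex.I * L) * k by ring]
    ring
  have f6 : (fun k => Complex.exp (Complex.I * k * (x + L)) /
      (1 - Complex.exp (4 * Complex.I * k * L)) * G k) =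
      fun k => Complex.exp (Complex.I * k * (x + L)) * G k /
        (1 - Complex.exp (4 * Complex.I * L * k)) := by
    ext k
    rw [show 4 * Complex.I * k * L = 4 * Complex.I * L * k by ring]
    ring
  have f5 : (fun k => Complex.exp (Complex.I * k * (x + L)) /
      (1 - Complex.exp (4 * Complex.I * k * L)) * -G k) =
      fun k => -(Complex.exp (Complex.I * k * (x + L)) * G k /
        (1 - Complex.exp (4 * Complex.I * L * k))) := by
    ext k
    rw [show 4 * Complex.I * k * L = 4 * Complex.I * L * k by ring]
    ring
  have f7 : (fun k => Complex.exp (Complex.I * k * (x - L)) /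
      (1 - Complex.exp (-(4 * Complex.I * k * L))) * -H k) =
      fun k => -(Complex.exp (Complex.I * k * (x - L)) * H k /
        (1 - Complex.exp (-(4 * Complex.I * L) * k))) := by
    ext k
    rw [show -(4 * Complex.I * k * L) = -(4 * Complex.I * L) * k by ring]
    ring
  rw [f3, f4, f5, f6, f7, lineInt_eq_sum_cells hL
    (hd1.continuousOn.comp_continuous Complex.continuous_ofReal hreal)]
  simp only [lowerInt, upperInt]
  simp only [← Finset.sum_add_distrib]
  refine Finset.sum_congr rfl fun n _ => ?_
  -- With `e = e^{ikL}`, the coefficients of `e^{ikx} X` are `1/2`, `1/(2(e⁴-1))` and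
  -- `e⁴/(2(1-e⁴))`, while those of `e^{ikx} Y` are `0`, `e²/(2(e⁴-1))` and `e²/(2(1-e⁴))`. Both
  -- triples add up to zero.
  have c3 := cell_three hL hr hrR hRL n (hball n) hreal hd1 cK
    (F₂ := fun k => Complex.exp (Complex.I * k * (x - L)) /
      (2 * (1 - Complex.exp (-(4 * Complex.I * k * L)))) *
        (Complex.exp (-(3 * Complex.I * k * L)) * X k +
          Complex.exp (-(Complex.I * k * L)) * Y k)) (by
    intro k hk
    have hk' := hm' k hk
    rw [show -(4 * Complex.I * L) * k = -(4 * (Complex.I * k * L)) by ring] at hk'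
    rw [show 4 * Complex.I * k * L = 4 * (Complex.I * k * L) by ring] at hk
    simp only [mul_add, mul_sub]
    rw [show 4 * Complex.I * L * k = (4 : ℕ) * (Complex.I * k * L) by push_cast; ring,
      show -(4 * Complex.I * k * L) = -((4 : ℕ) * (Complex.I * k * L)) by push_cast; ring,
      show -(3 * Complex.I * k * L) = -((3 : ℕ) * (Complex.I * k * L)) by push_cast; ring,
      show 3 * Complex.I * k * L = (3 : ℕ) * (Complex.I * k * L) by push_cast; ring]
    rw [show 4 * (Complex.I * k * L) = (4 : ℕ) * (Complex.I * k * L) by push_cast; ring] at hk hk'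
    simp only [Complex.exp_neg, Complex.exp_sub, Complex.exp_add, Complex.exp_nat_mul] at hk hk' ⊢
    have hE : Complex.exp (Complex.I * k * L) ≠ 0 := Complex.exp_ne_zero _
    generalize Complex.exp (Complex.I * k * L) = e at *
    have hk1 : 1 - e ^ 4 ≠ 0 := fun h => hk (sub_eq_zero.mp h).symm
    have hk2 : e ^ 4 - 1 ≠ 0 := sub_ne_zero.mpr hk
    have hk3 : 1 - (e ^ 4)⁻¹ = (e ^ 4 - 1) / e ^ 4 := by field_simp
    rw [show (2 : ℂ) * 1 - 2 * (e ^ 4)⁻¹ = 2 * ((e ^ 4 - 1) / e ^ 4) by rw [← hk3]; ring]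
    have hk4 : 1 - e ^ 4 = -(e ^ 4 - 1) := by ring
    rw [hk4]
    field_simp
    ring)
  have c4 := cell_two hL hr hrR hRL n (hball n) cH
  have c6 := cell_two hL hr hrR hRL n (hball n) cG
  have hne : ∀ z ∈ ball (kn L n : ℂ) R, Complex.exp (4 * Complex.I * L * z) = 1 → z = kn L n :=
    fun z hz h1 => eq_kn_of_exp_eq_one hL n
      (by rw [← h1]; ring_nf) (by rw [mem_ball, dist_eq_norm] at hz; exact hz.le.trans hRL)
  have hne' : ∀ z ∈ ball (kn L n : ℂ) R, Complex.exp (-(4 * Complex.I * L) * z) = 1 →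
      z = kn L n := fun z hz h1 => hne z hz (by
    rw [neg_mul, Complex.exp_neg, inv_eq_one] at h1; exact h1)
  have h1 : Complex.exp (4 * Complex.I * L * kn L n) = 1 := by
    rw [← exp_four_kn hL.ne' n]; ring_nf
  have h1' : Complex.exp (-(4 * Complex.I * L) * kn L n) = 1 := by
    rw [neg_mul, Complex.exp_neg, h1, inv_one]
  have r3 := circleIntegral_div_one_sub_exp hr hrR hc4 h1 hne (hK.mono (hball n))
  have r4 := circleIntegral_div_one_sub_exp hr hrR (neg_ne_zero.mpr hc4) h1' hne'
    (hEH.mono (hball n))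
  have r6 := circleIntegral_div_one_sub_exp hr hrR hc4 h1 hne (hEG.mono (hball n))
  rw [r3] at c3
  rw [r4] at c4
  rw [r6] at c6
  -- The seven terms are grouped as (1, 2, 3), (4, 7), (6, 5). Each group is one circle integral,
  -- with residue factor `±π/(2L)`.
  refine Eq.trans ?_ (Eq.trans (congrArg₂ (· + ·) (congrArg₂ (· + ·) c3 c4) c6) ?_)
  · ring
  · have h5 : Complex.exp (3 * Complex.I * kn L n * L) =
        Complex.exp (-(Complex.I * kn L n * L)) := by
      rw [show 3 * Complex.I * kn L n * L = 4 * Complex.I * L * kn L n +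
        -(Complex.I * kn L n * L) by ring, Complex.exp_add, h1, one_mul]
    have h6 : Complex.exp (Complex.I * kn L n * (x - L)) =
        Complex.exp (Complex.I * kn L n * (x + L)) *
          Complex.exp (-(2 * Complex.I * kn L n * L)) := by
      rw [← Complex.exp_add]; ring_nf
    rw [h5, h6]
    have hI := Complex.I_ne_zero
    field_simp
    ring

/-! ### Pointwise convergence of the half-range Fourier series -/

/-- The Riemann-Lebesgue lemma on a compact interval. -/
theorem tendsto_integral_exp_mul_of_le {a b : ℝ} (hab : a ≤ b) (g : ℝ → ℂ) :
    Tendsto (fun w : ℝ => ∫ y in a..b, Complex.exp (Complex.I * w * y) * g y)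
      (cocompact ℝ) (𝓝 0) := by
  have h1 := Real.tendsto_integral_exp_smul_cocompact ((Ioc a b).indicator g)
  have hne : -(1 / (2 * Real.pi)) ≠ 0 := by
    have := Real.pi_pos
    exact neg_ne_zero.mpr (by positivity)
  have h2 : Tendsto (fun w : ℝ => w * -(1 / (2 * Real.pi))) (cocompact ℝ) (cocompact ℝ) :=
    (Homeomorph.mulRight₀ _ hne).isClosedEmbedding.tendsto_cocompact
  refine (h1.comp h2).congr fun w => ?_
  rw [intervalIntegral.integral_of_le hab, ← integral_indicator measurableSet_Ioc]
  simp only [Function.comp]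
  congr 1
  ext y
  by_cases hy : y ∈ Ioc a b
  · simp only [indicator_of_mem hy, Circle.smul_def, Real.fourierChar_apply, smul_eq_mul]
    congr 2
    have : (Real.pi : ℂ) ≠ 0 := Complex.ofReal_ne_zero.mpr Real.pi_ne_zero
    push_cast
    field_simp
  · simp [indicator_of_notMem hy]

theorem kn_eq (L : ℝ) (n : ℤ) : kn L n = n * kn L 1 := by
  simp only [kn]; push_cast; ring

theorem exp_kn_mul (L : ℝ) (n : ℤ) (z : ℂ) :
    Complex.exp (Complex.I * kn L n * z) = Complex.exp (Complex.I * kn L 1 * z) ^ n := by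
  rw [← Complex.exp_int_mul, kn_eq]
  push_cast
  ring_nf

/-- A telescoping geometric sum, kept in product form so that it stays valid where `e^{ik_1 z} = 1`.
-/
theorem sum_exp_kn_mul (L : ℝ) (N : ℕ) (z : ℂ) :
    (∑ n ∈ Finset.Icc (-(N : ℤ)) (N : ℤ), Complex.exp (Complex.I * kn L n * z)) *
      (Complex.exp (Complex.I * kn L 1 * z) - 1) =
    Complex.exp (Complex.I * kn L (N + 1) * z) - Complex.exp (Complex.I * kn L (-N) * z) := by
  have h := fun n => exp_kn_mul L n z
  have hE : Complex.exp (Complex.I * kn L 1 * z) ≠ 0 := Complex.exp_ne_zero _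
  generalize Complex.exp (Complex.I * kn L 1 * z) = E at *
  simp only [h]
  induction N with
  | zero => simp
  | succ N ih =>
    rw [sum_Icc_neg_succ, add_mul, add_mul, ih]
    have e1 : E ^ ((N : ℤ) + 1 + 1) = E ^ ((N : ℤ) + 1) * E := zpow_add_one₀ hE _
    have e2 : E ^ (-(N : ℤ)) = E ^ (-((N : ℤ) + 1)) * E := by
      rw [← zpow_add_one₀ hE]; congr 1; ring
    push_cast
    rw [e1, e2]
    ring

theorem tendsto_kn_add_one {L : ℝ} (hL : 0 < L) :
    Tendsto (fun N : ℕ => kn L (N + 1)) atTop atTop := by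
  have h : ∀ N : ℕ, kn L (N + 1) = ((N : ℝ) + 1) * (Real.pi / (2 * L)) := fun N => by
    simp only [kn]; push_cast; ring
  simp only [h]
  have hp : 0 < Real.pi / (2 * L) := by positivity
  exact (tendsto_atTop_add_const_right _ _ tendsto_natCast_atTop_atTop).atTop_mul_const hp

theorem tendsto_kn_neg {L : ℝ} (hL : 0 < L) :
    Tendsto (fun N : ℕ => kn L (-N)) atTop atBot := by
  have h : ∀ N : ℕ, kn L (-N) = -((N : ℝ) * (Real.pi / (2 * L))) := fun N => by
    simp only [kn]; push_cast; ring
  simp only [h]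
  have hp : 0 < Real.pi / (2 * L) := by positivity
  exact tendsto_neg_atTop_atBot.comp (tendsto_natCast_atTop_atTop.atTop_mul_const hp)

theorem tendsto_integral_exp_affine {a b ε c : ℝ} (hab : a ≤ b) (hε : ε ≠ 0) (g : ℝ → ℂ)
    {w : ℕ → ℝ} (hw : Tendsto w atTop (cocompact ℝ)) :
    Tendsto (fun N => ∫ y in a..b, g y * Complex.exp (Complex.I * w N * ((ε * y + c : ℝ) : ℂ)))
      atTop (𝓝 0) := by
  have h2 : Tendsto (fun w : ℝ => w * ε) (cocompact ℝ) (cocompact ℝ) :=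
    (Homeomorph.mulRight₀ _ hε).isClosedEmbedding.tendsto_cocompact
  have h := (tendsto_integral_exp_mul_of_le hab g).comp (h2.comp hw)
  -- The shift `c` contributes a phase that varies with `N` but has modulus one, so norms are
  -- compared.
  rw [tendsto_zero_iff_norm_tendsto_zero] at h ⊢
  refine h.congr fun N => ?_
  have e : ∀ y : ℝ, g y * Complex.exp (Complex.I * w N * ((ε * y + c : ℝ) : ℂ)) =
      Complex.exp ((w N * c : ℝ) * Complex.I) *
        (Complex.exp (Complex.I * ((w N * ε : ℝ) : ℂ) * y) * g y) := fun y => by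
    rw [← mul_assoc, ← Complex.exp_add, mul_comm]
    push_cast
    ring_nf
  simp only [e, intervalIntegral.integral_const_mul, norm_mul, Complex.norm_exp_ofReal_mul_I,
    one_mul, Function.comp]

/-- The Dirichlet kernel integrates to zero in the limit against a function that is divisible by
`e^{i k_1 z} - 1`. -/
theorem tendsto_integral_mul_dirichlet {L a b ε c : ℝ} (hL : 0 < L) (hab : a ≤ b) (hε : ε ≠ 0)
    {f g : ℝ → ℂ} (hg : ContinuousOn g (Icc a b))
    (hfg : ∀ y ∈ Icc a b,
      f y = g y * (Complex.exp (Complex.I * kn L 1 * ((ε * y + c : ℝ) : ℂ)) - 1)) :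
    Tendsto (fun N : ℕ => ∫ y in a..b, f y * ∑ n ∈ Finset.Icc (-(N : ℤ)) (N : ℤ),
      Complex.exp (Complex.I * kn L n * ((ε * y + c : ℝ) : ℂ))) atTop (𝓝 0) := by
  have h1 := tendsto_integral_exp_affine (c := c) hab hε g
    ((tendsto_kn_add_one hL).mono_right atTop_le_cocompact)
  have h2 := tendsto_integral_exp_affine (c := c) hab hε g
    ((tendsto_kn_neg hL).mono_right atBot_le_cocompact)
  have h := h1.sub h2
  rw [sub_zero] at h
  refine h.congr fun N => ?_
  have hi : ∀ w : ℝ, IntervalIntegrable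
      (fun y : ℝ => g y * Complex.exp (Complex.I * w * ((ε * y + c : ℝ) : ℂ))) volume a b := by
    intro w
    refine ContinuousOn.intervalIntegrable ?_
    rw [uIcc_of_le hab]
    exact hg.mul (Continuous.continuousOn (by fun_prop))
  rw [← intervalIntegral.integral_sub (hi _) (hi _)]
  refine intervalIntegral.integral_congr fun y hy => ?_
  rw [uIcc_of_le hab] at hy
  rw [hfg y hy, ← mul_sub, ← sum_exp_kn_mul]
  ring

/-- The function `e^{ik_1 z}` has period `4L`, twice the length of the interval, and takes the value
one on the real line only at multiples of the period. -/
theorem exp_kn_one_ne_one {L z : ℝ} (hL : 0 < L) (h0 : z ≠ 0) (hz : |z| < 4 * L) :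
    Complex.exp (Complex.I * kn L 1 * (z : ℂ)) ≠ 1 := by
  intro h
  rw [Complex.exp_eq_one_iff] at h
  obtain ⟨m, hm⟩ := h
  have hLC : (L : ℂ) ≠ 0 := Complex.ofReal_ne_zero.mpr hL.ne'
  have hpC : (Real.pi : ℂ) ≠ 0 := Complex.ofReal_ne_zero.mpr Real.pi_ne_zero
  have hI := Complex.I_ne_zero
  have h1 : (z : ℂ) = m * (4 * L) := by
    simp only [kn] at hm
    push_cast at hm
    field_simp at hm
    linear_combination hm
  have h2 : z = m * (4 * L) := by exact_mod_cast h1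
  rw [h2, abs_mul, abs_of_pos (by linarith : 0 < 4 * L)] at hz
  have h3 : |(m : ℝ)| < 1 := by nlinarith
  rw [← Int.cast_abs] at h3
  have h4 : |m| < 1 := by exact_mod_cast h3
  rw [Int.abs_lt_one_iff.mp h4] at h2
  exact h0 (by simpa using h2)

/-- Over a full period every mode except `n = 0` integrates to zero. -/
theorem integral_dirichlet_period {L : ℝ} (hL : 0 < L) (x : ℝ) (N : ℕ) :
    ∫ y in (x - 2 * L)..(x + 2 * L), ∑ n ∈ Finset.Icc (-(N : ℤ)) (N : ℤ),
      Complex.exp (Complex.I * kn L n * ((-1 * y + x : ℝ) : ℂ)) = 4 * L := by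
  rw [intervalIntegral.integral_finsetSum
    (fun n _ => Continuous.intervalIntegrable (by fun_prop) _ _)]
  rw [Finset.sum_eq_single_of_mem 0 (by simp)]
  · simp [kn]; ring
  · intro n _ hn
    have hk : Complex.I * kn L n ≠ 0 := by
      refine mul_ne_zero Complex.I_ne_zero (Complex.ofReal_ne_zero.mpr ?_)
      have : (n : ℝ) ≠ 0 := Int.cast_ne_zero.mpr hn
      simp only [kn]
      positivity
    have e : ∀ y : ℝ, Complex.exp (Complex.I * kn L n * ((-1 * y + x : ℝ) : ℂ)) =
        Complex.exp (Complex.I * kn L n * x) * Complex.exp (-(Complex.I * kn L n) * y) :=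
      fun y => by rw [← Complex.exp_add]; push_cast; ring_nf
    simp only [e, intervalIntegral.integral_const_mul]
    rw [integral_exp_mul_complex (neg_ne_zero.mpr hk)]
    have e1 : Complex.exp (-(Complex.I * kn L n) * ((x - 2 * L : ℝ) : ℂ)) =
        Complex.exp (-(Complex.I * kn L n) * ((x + 2 * L : ℝ) : ℂ)) := by
      rw [show -(Complex.I * kn L n) * ((x - 2 * L : ℝ) : ℂ) =
        -(Complex.I * kn L n) * ((x + 2 * L : ℝ) : ℂ) + 4 * Complex.I * kn L n * L by
          push_cast; ring, Complex.exp_add, exp_four_kn hL.ne', mul_one]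
    rw [e1, sub_self, zero_div, mul_zero]

section series

variable {L x : ℝ} {f : ℝ → ℂ}

/-- The constant `f x` is split off. It carries the integral of the kernel over a full period about
`x`, up to the parts outside `[-L, L]`, which stay away from the singularity and vanish by
Riemann-Lebesgue. The remainder `f - f x` is divisible by `e^{ik_1(x-y)} - 1` with continuous
quotient, because `f` is differentiable at `x` and the exponential has nonzero derivative there. -/
theorem tendsto_integral_dirichlet (hx : x ∈ Ioo (-L) L) (hf : ContinuousOn f (Icc (-L) L))
    (hfx : DifferentiableAt ℝ f x) :
    Tendsto (fun N : ℕ => ∫ y in (-L)..L, f y * ∑ n ∈ Finset.Icc (-(N : ℤ)) (N : ℤ),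
      Complex.exp (Complex.I * kn L n * ((-1 * y + x : ℝ) : ℂ))) atTop (𝓝 (4 * L * f x)) := by
  obtain ⟨hx1, hx2⟩ := hx
  have hL : 0 < L := by linarith
  set E : ℝ → ℂ := fun y => Complex.exp (Complex.I * kn L 1 * ((-1 * y + x : ℝ) : ℂ)) with hE
  have hEc : Continuous E := by rw [hE]; fun_prop
  have hEx : E x = 1 := by simp [hE]
  have hne : ∀ y ∈ Icc (x - 2 * L) (x + 2 * L), y ≠ x → E y - 1 ≠ 0 := by
    intro y hy hyx
    refine sub_ne_zero.mpr (exp_kn_one_ne_one hL ?_ ?_)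
    · intro h; apply hyx; linarith
    · rw [abs_lt]; constructor <;> linarith [hy.1, hy.2]
  have hEd : HasDerivAt E (-(Complex.I * kn L 1)) x := by
    have h1 : HasDerivAt (fun y : ℝ => ((-1 * y + x : ℝ) : ℂ)) ((-1 : ℝ) : ℂ) x := by
      have := (((hasDerivAt_id x).const_mul (-1)).add_const x).ofReal_comp
      simpa using this
    have h2 := (h1.const_mul (Complex.I * kn L 1)).cexp
    simpa [hE] using h2
  have hEd0 : -(Complex.I * kn L 1 : ℂ) ≠ 0 := by
    refine neg_ne_zero.mpr (mul_ne_zero Complex.I_ne_zero (Complex.ofReal_ne_zero.mpr ?_))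
    simp only [kn]
    have := Real.pi_pos
    positivity
  have hout : ∀ a b : ℝ, a ≤ b → Icc a b ⊆ Icc (x - 2 * L) (x + 2 * L) → x ∉ Icc a b →
      Tendsto (fun N : ℕ => ∫ y in a..b, (1 : ℂ) * ∑ n ∈ Finset.Icc (-(N : ℤ)) (N : ℤ),
        Complex.exp (Complex.I * kn L n * ((-1 * y + x : ℝ) : ℂ))) atTop (𝓝 0) := by
    intro a b hab hsub hxab
    have hn : ∀ y ∈ Icc a b, E y - 1 ≠ 0 := fun y hy =>
      hne y (hsub hy) (fun h => hxab (h ▸ hy))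
    refine tendsto_integral_mul_dirichlet hL hab (by norm_num) (g := fun y => (E y - 1)⁻¹)
      ((hEc.sub continuous_const).continuousOn.inv₀ hn) fun y hy => ?_
    exact (inv_mul_cancel₀ (hn y hy)).symm
  have h1 := hout (x - 2 * L) (-L) (by linarith) (Icc_subset_Icc le_rfl (by linarith))
    (fun h => by linarith [h.2])
  have h2 := hout L (x + 2 * L) (by linarith) (Icc_subset_Icc (by linarith) le_rfl)
    (fun h => by linarith [h.1])
  have hmid : Tendsto (fun N : ℕ => ∫ y in (-L)..L, (f y - f x) *
      ∑ n ∈ Finset.Icc (-(N : ℤ)) (N : ℤ),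
        Complex.exp (Complex.I * kn L n * ((-1 * y + x : ℝ) : ℂ))) atTop (𝓝 0) := by
    have hnhds : Icc (-L) L ∈ 𝓝 x := Icc_mem_nhds hx1 hx2
    have hq : ∀ y ∈ Icc (-L) L, dslope E x y ≠ 0 := by
      intro y hy h0
      by_cases hyx : y = x
      · rw [hyx, dslope_same, hEd.deriv] at h0
        exact hEd0 h0
      · have := sub_smul_dslope E x y
        rw [h0, smul_zero, hEx] at this
        exact hne y ⟨by linarith [hy.1], by linarith [hy.2]⟩ hyx this.symm
    -- The factors `y - x` cancel in the quotient of the two difference quotients, whose value at `y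
    -- = x` is the ratio of the derivatives.
    refine tendsto_integral_mul_dirichlet hL (by linarith) (by norm_num)
      (g := fun y => dslope f x y / dslope E x y)
      (((continuousOn_dslope hnhds).mpr ⟨hf, hfx⟩).div
        ((continuousOn_dslope hnhds).mpr ⟨hEc.continuousOn, hEd.differentiableAt⟩) hq)
      fun y hy => ?_
    have e1 := sub_smul_dslope f x y
    have e2 := sub_smul_dslope E x y
    rw [hEx] at e2
    change f y - f x = dslope f x y / dslope E x y * (E y - 1)
    rw [← e1, ← e2, Complex.real_smul, Complex.real_smul]
    have := hq y hy
    field_simp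
  have h3 := hmid.add (((h1.add h2).const_mul (f x)).const_sub (f x * (4 * L)))
  simp only [add_zero, mul_zero, sub_zero, zero_add] at h3
  rw [mul_comm (f x)] at h3
  refine h3.congr fun N => ?_
  have hD : Continuous fun y : ℝ => ∑ n ∈ Finset.Icc (-(N : ℤ)) (N : ℤ),
      Complex.exp (Complex.I * kn L n * ((-1 * y + x : ℝ) : ℂ)) := by fun_prop
  have hDi : ∀ a b : ℝ, IntervalIntegrable (fun y : ℝ => ∑ n ∈ Finset.Icc (-(N : ℤ)) (N : ℤ),
      Complex.exp (Complex.I * kn L n * ((-1 * y + x : ℝ) : ℂ))) volume a b :=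
    fun a b => hD.intervalIntegrable a b
  have hper := integral_dirichlet_period hL x N
  rw [← intervalIntegral.integral_add_adjacent_intervals (hDi _ L) (hDi _ _),
    ← intervalIntegral.integral_add_adjacent_intervals (hDi _ (-L)) (hDi _ _)] at hper
  simp only [one_mul, sub_mul]
  rw [intervalIntegral.integral_sub, intervalIntegral.integral_const_mul, ← hper]
  · ring
  · refine ContinuousOn.intervalIntegrable ?_
    rw [uIcc_of_le (by linarith)]
    exact hf.mul hD.continuousOn
  · exact (hD.const_mul (f x)).intervalIntegrable _ _

/-- For interior `x` the argument `x + y + 2L` stays strictly between `0` and `4L`, so the kernel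
has no singularity on `[-L, L]`; continuity of `f` is enough. -/
theorem tendsto_integral_dirichlet_reflected (hx : x ∈ Ioo (-L) L)
    (hf : ContinuousOn f (Icc (-L) L)) :
    Tendsto (fun N : ℕ => ∫ y in (-L)..L, f y * ∑ n ∈ Finset.Icc (-(N : ℤ)) (N : ℤ),
      Complex.exp (Complex.I * kn L n * ((1 * y + (x + 2 * L) : ℝ) : ℂ))) atTop (𝓝 0) := by
  obtain ⟨hx1, hx2⟩ := hx
  have hL : 0 < L := by linarith
  have hn : ∀ y ∈ Icc (-L) L,
      Complex.exp (Complex.I * kn L 1 * ((1 * y + (x + 2 * L) : ℝ) : ℂ)) - 1 ≠ 0 := by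
    intro y hy
    refine sub_ne_zero.mpr (exp_kn_one_ne_one hL ?_ ?_)
    · have := hy.1; intro h; linarith
    · rw [abs_lt]; constructor <;> linarith [hy.1, hy.2]
  refine tendsto_integral_mul_dirichlet hL (by linarith) one_ne_zero
    (g := fun y => f y / (Complex.exp (Complex.I * kn L 1 * ((1 * y + (x + 2 * L) : ℝ) : ℂ)) - 1))
    (hf.div (Continuous.continuousOn (by fun_prop)) hn) fun y hy => ?_
  exact (div_mul_cancel₀ _ (hn y hy)).symm

theorem sum_mul_integral_eq (hL : 0 ≤ L) (hf : ContinuousOn f (Icc (-L) L)) (N : ℕ)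
    (w : ℤ → ℂ) (φ : ℤ → ℝ → ℂ) (hφ : ∀ n, Continuous (φ n)) :
    ∑ n ∈ Finset.Icc (-(N : ℤ)) (N : ℤ), w n * ∫ y in (-L)..L, f y * φ n y =
      ∫ y in (-L)..L, f y * ∑ n ∈ Finset.Icc (-(N : ℤ)) (N : ℤ), w n * φ n y := by
  simp only [Finset.mul_sum]
  rw [intervalIntegral.integral_finsetSum]
  · refine Finset.sum_congr rfl fun n _ => ?_
    rw [← intervalIntegral.integral_const_mul]
    congr 1
    ext y
    ring
  · intro n _
    refine ContinuousOn.intervalIntegrable ?_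
    rw [uIcc_of_le (by linarith)]
    exact hf.mul (continuous_const.mul (hφ n)).continuousOn

/-- The even (cosine) series on `[-L, L]` converges at interior points of differentiability. -/
theorem tendsto_cos_series (hx : x ∈ Ioo (-L) L) (hf : ContinuousOn f (Icc (-L) L))
    (hfx : DifferentiableAt ℝ f x) :
    Tendsto (fun N : ℕ => ∑ n ∈ Finset.Icc (-(N : ℤ)) (N : ℤ),
      Complex.exp (Complex.I * kn L n * (x + L)) *
        ∫ y in (-L)..L, f y * Complex.cos (kn L n * (y + L))) atTop (𝓝 (2 * L * f x)) := by
  have hL : 0 < L := by linarith [hx.1, hx.2]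
  have h := ((tendsto_integral_dirichlet hx hf hfx).add
    (tendsto_integral_dirichlet_reflected hx hf)).mul_const (1 / 2)
  rw [show (4 * L * f x + 0) * (1 / 2) = 2 * L * f x by ring] at h
  refine h.congr fun N => ?_
  -- Writing the cosine as a half-sum of exponentials turns `e^{ik_n(x+L)} cos(k_n(y+L))` into half
  -- of the reflected mode plus half of the direct mode.
  rw [sum_mul_integral_eq hL.le hf N _ (fun n y => Complex.cos (kn L n * (y + L)))
    (fun n => by fun_prop), ← intervalIntegral.integral_add,
    ← intervalIntegral.integral_mul_const]
  · congr 1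
    ext y
    rw [← mul_add, ← Finset.sum_add_distrib, mul_assoc, Finset.sum_mul]
    congr 1
    refine Finset.sum_congr rfl fun n _ => ?_
    have e1 : Complex.exp (Complex.I * kn L n * (x + L)) *
        Complex.exp (kn L n * (y + L) * Complex.I) =
        Complex.exp (Complex.I * kn L n * ((1 * y + (x + 2 * L) : ℝ) : ℂ)) := by
      rw [← Complex.exp_add]; push_cast; ring_nf
    have e2 : Complex.exp (Complex.I * kn L n * (x + L)) *
        Complex.exp (-(kn L n * (y + L)) * Complex.I) =
        Complex.exp (Complex.I * kn L n * ((-1 * y + x : ℝ) : ℂ)) := by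
      rw [← Complex.exp_add]; push_cast; ring_nf
    rw [← e1, ← e2, Complex.cos]
    ring
  all_goals
    refine ContinuousOn.intervalIntegrable ?_
    rw [uIcc_of_le (by linarith)]
    exact hf.mul (Continuous.continuousOn (by fun_prop))

/-- The odd (sine) series on `[-L, L]` converges at interior points of differentiability. -/
theorem tendsto_sin_series (hx : x ∈ Ioo (-L) L) (hf : ContinuousOn f (Icc (-L) L))
    (hfx : DifferentiableAt ℝ f x) :
    Tendsto (fun N : ℕ => ∑ n ∈ Finset.Icc (-(N : ℤ)) (N : ℤ),
      Complex.exp (Complex.I * kn L n * (x + L)) *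
        (-Complex.I * ∫ y in (-L)..L, f y * Complex.sin (kn L n * (y + L))))
      atTop (𝓝 (2 * L * f x)) := by
  have hL : 0 < L := by linarith [hx.1, hx.2]
  have h := ((tendsto_integral_dirichlet hx hf hfx).sub
    (tendsto_integral_dirichlet_reflected hx hf)).mul_const (1 / 2)
  rw [show (4 * L * f x - 0) * (1 / 2) = 2 * L * f x by ring] at h
  refine h.congr fun N => ?_
  simp only [← mul_assoc]
  rw [sum_mul_integral_eq hL.le hf N _ (fun n y => Complex.sin (kn L n * (y + L)))
    (fun n => by fun_prop), ← intervalIntegral.integral_sub,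
    ← intervalIntegral.integral_mul_const]
  · congr 1
    ext y
    rw [← mul_sub, ← Finset.sum_sub_distrib, mul_assoc, Finset.sum_mul]
    congr 1
    refine Finset.sum_congr rfl fun n _ => ?_
    have e1 : Complex.exp (Complex.I * kn L n * (x + L)) *
        Complex.exp (kn L n * (y + L) * Complex.I) =
        Complex.exp (Complex.I * kn L n * ((1 * y + (x + 2 * L) : ℝ) : ℂ)) := by
      rw [← Complex.exp_add]; push_cast; ring_nf
    have e2 : Complex.exp (Complex.I * kn L n * (x + L)) *
        Complex.exp (-(kn L n * (y + L)) * Complex.I) =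
        Complex.exp (Complex.I * kn L n * ((-1 * y + x : ℝ) : ℂ)) := by
      rw [← Complex.exp_add]; push_cast; ring_nf
    rw [← e1, ← e2, Complex.sin]
    linear_combination (1 / 2) * (Complex.exp (Complex.I * kn L n * (x + L)) *
        Complex.exp (-(kn L n * (y + L)) * Complex.I) -
        Complex.exp (Complex.I * kn L n * (x + L)) *
        Complex.exp (kn L n * (y + L) * Complex.I)) * Complex.I_sq
  all_goals
    refine ContinuousOn.intervalIntegrable ?_
    rw [uIcc_of_le (by linarith)]
    exact hf.mul (Continuous.continuousOn (by fun_prop))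

end series

/-! ### Partial derivatives of functions on `[-L, L] × [0, T)` -/

section partials

variable {L T : ℝ} {f : ℝ → ℝ → ℝ}

theorem uniqueDiffOn_strip (hL : 0 < L) (T : ℝ) :
    UniqueDiffOn ℝ (Icc (-L) L ×ˢ Ico 0 T) :=
  (uniqueDiffOn_Icc (by linarith)).prod (uniqueDiffOn_Ico 0 T)

theorem hasDerivWithinAt_fst
    (hf : DifferentiableOn ℝ (fun p : ℝ × ℝ => f p.1 p.2) (Icc (-L) L ×ˢ Ico 0 T))
    {x t : ℝ} (hx : x ∈ Icc (-L) L) (ht : t ∈ Ico 0 T) :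
    HasDerivWithinAt (fun y => f y t)
      (fderivWithin ℝ (fun p : ℝ × ℝ => f p.1 p.2) (Icc (-L) L ×ˢ Ico 0 T) (x, t) (1, 0))
      (Icc (-L) L) x := by
  have h1 := (hf (x, t) ⟨hx, ht⟩).hasFDerivWithinAt
  have h2 : HasDerivWithinAt (fun y : ℝ => (y, t)) ((1 : ℝ), (0 : ℝ)) (Icc (-L) L) x :=
    (hasDerivWithinAt_id x _).prodMk (hasDerivWithinAt_const x _ t)
  have h3 := h1.comp_hasDerivWithinAt x h2 fun y (hy : y ∈ Icc (-L) L) => ⟨hy, ht⟩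
  exact h3

theorem hasDerivWithinAt_snd
    (hf : DifferentiableOn ℝ (fun p : ℝ × ℝ => f p.1 p.2) (Icc (-L) L ×ˢ Ico 0 T))
    {x t : ℝ} (hx : x ∈ Icc (-L) L) (ht : t ∈ Ico 0 T) :
    HasDerivWithinAt (fun s => f x s)
      (fderivWithin ℝ (fun p : ℝ × ℝ => f p.1 p.2) (Icc (-L) L ×ˢ Ico 0 T) (x, t) (0, 1))
      (Ici 0) t := by
  have h1 := (hf (x, t) ⟨hx, ht⟩).hasFDerivWithinAt
  have h2 : HasDerivWithinAt (fun s : ℝ => (x, s)) ((0 : ℝ), (1 : ℝ)) (Ico 0 T) t :=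
    (hasDerivWithinAt_const t _ x).prodMk (hasDerivWithinAt_id t _)
  have h3 := h1.comp_hasDerivWithinAt t h2 fun s hs => ⟨hx, hs⟩
  -- The function is controlled only on `[0, T)`, whereas `dt` differentiates within `[0, ∞)`; near
  -- a point `t < T` the two sets coincide.
  refine h3.mono_of_mem_nhdsWithin ?_
  rw [← Ici_inter_Iio]
  exact inter_mem_nhdsWithin _ (Iio_mem_nhds ht.2)

theorem dx_eq_fderivWithin (hL : 0 < L)
    (hf : DifferentiableOn ℝ (fun p : ℝ × ℝ => f p.1 p.2) (Icc (-L) L ×ˢ Ico 0 T))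
    {x t : ℝ} (hx : x ∈ Icc (-L) L) (ht : t ∈ Ico 0 T) :
    dx L f x t =
      fderivWithin ℝ (fun p : ℝ × ℝ => f p.1 p.2) (Icc (-L) L ×ˢ Ico 0 T) (x, t) (1, 0) :=
  (hasDerivWithinAt_fst hf hx ht).derivWithin (uniqueDiffOn_Icc (by linarith) x hx)

theorem dt_eq_fderivWithin
    (hf : DifferentiableOn ℝ (fun p : ℝ × ℝ => f p.1 p.2) (Icc (-L) L ×ˢ Ico 0 T))
    {x t : ℝ} (hx : x ∈ Icc (-L) L) (ht : t ∈ Ico 0 T) :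
    dt f x t =
      fderivWithin ℝ (fun p : ℝ × ℝ => f p.1 p.2) (Icc (-L) L ×ˢ Ico 0 T) (x, t) (0, 1) :=
  (hasDerivWithinAt_snd hf hx ht).derivWithin (uniqueDiffOn_Ici 0 t ht.1)

theorem hasDerivWithinAt_dx (hL : 0 < L)
    (hf : DifferentiableOn ℝ (fun p : ℝ × ℝ => f p.1 p.2) (Icc (-L) L ×ˢ Ico 0 T))
    {x t : ℝ} (hx : x ∈ Icc (-L) L) (ht : t ∈ Ico 0 T) :
    HasDerivWithinAt (fun y => f y t) (dx L f x t) (Icc (-L) L) x := by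
  rw [dx_eq_fderivWithin hL hf hx ht]
  exact hasDerivWithinAt_fst hf hx ht

theorem hasDerivAt_dt
    (hf : DifferentiableOn ℝ (fun p : ℝ × ℝ => f p.1 p.2) (Icc (-L) L ×ˢ Ico 0 T))
    {x t : ℝ} (hx : x ∈ Icc (-L) L) (ht : t ∈ Ioo 0 T) :
    HasDerivAt (fun s => f x s) (dt f x t) t := by
  rw [dt_eq_fderivWithin hf hx (Ioo_subset_Ico_self ht)]
  exact (hasDerivWithinAt_snd hf hx (Ioo_subset_Ico_self ht)).hasDerivAt (Ici_mem_nhds ht.1)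

theorem contDiffOn_dx (hL : 0 < L) {m n : WithTop ℕ∞}
    (hf : ContDiffOn ℝ n (fun p : ℝ × ℝ => f p.1 p.2) (Icc (-L) L ×ˢ Ico 0 T)) (hmn : m + 1 ≤ n) :
    ContDiffOn ℝ m (fun p : ℝ × ℝ => dx L f p.1 p.2) (Icc (-L) L ×ˢ Ico 0 T) := by
  have hd := hf.differentiableOn (ne_of_gt (lt_of_lt_of_le (by simp) (le_trans le_add_self hmn)))
  have h := (hf.fderivWithin (uniqueDiffOn_strip hL T) hmn).clm_apply
    (contDiffOn_const (c := ((1 : ℝ), (0 : ℝ))))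
  exact h.congr fun p hp => dx_eq_fderivWithin hL hd hp.1 hp.2

theorem contDiffOn_dt (hL : 0 < L) {m n : WithTop ℕ∞}
    (hf : ContDiffOn ℝ n (fun p : ℝ × ℝ => f p.1 p.2) (Icc (-L) L ×ˢ Ico 0 T)) (hmn : m + 1 ≤ n) :
    ContDiffOn ℝ m (fun p : ℝ × ℝ => dt f p.1 p.2) (Icc (-L) L ×ˢ Ico 0 T) := by
  have hd := hf.differentiableOn (ne_of_gt (lt_of_lt_of_le (by simp) (le_trans le_add_self hmn)))
  have h := (hf.fderivWithin (uniqueDiffOn_strip hL T) hmn).clm_apply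
    (contDiffOn_const (c := ((0 : ℝ), (1 : ℝ))))
  exact h.congr fun p hp => dt_eq_fderivWithin hd hp.1 hp.2

theorem continuousOn_slice_fst
    (hf : ContinuousOn (fun p : ℝ × ℝ => f p.1 p.2) (Icc (-L) L ×ˢ Ico 0 T))
    {t : ℝ} (ht : t ∈ Ico 0 T) : ContinuousOn (fun x => f x t) (Icc (-L) L) :=
  hf.comp (f := fun x : ℝ => (x, t)) (Continuous.continuousOn (by fun_prop))
    fun _ hx => ⟨hx, ht⟩

theorem continuousOn_slice_snd
    (hf : ContinuousOn (fun p : ℝ × ℝ => f p.1 p.2) (Icc (-L) L ×ˢ Ico 0 T))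
    {x : ℝ} (hx : x ∈ Icc (-L) L) : ContinuousOn (fun t => f x t) (Ico 0 T) :=
  hf.comp (f := fun t : ℝ => (x, t)) (Continuous.continuousOn (by fun_prop))
    fun _ ht => ⟨hx, ht⟩

/-- Nothing is assumed up to `t = T`, so uniform bounds come from compactness of `[-L, L] × [0, T']`
with `T' < T`. -/
theorem exists_bound_strip
    (hf : ContinuousOn (fun p : ℝ × ℝ => f p.1 p.2) (Icc (-L) L ×ˢ Ico 0 T)) {T' : ℝ}
    (hT' : T' < T) : ∃ M, ∀ x ∈ Icc (-L) L, ∀ s ∈ Icc 0 T', ‖f x s‖ ≤ M := by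
  obtain ⟨M, hM⟩ := (isCompact_Icc.prod isCompact_Icc).exists_bound_of_continuousOn
    (hf.mono (prod_mono le_rfl fun s (hs : s ∈ Icc 0 T') => ⟨hs.1, hs.2.trans_lt hT'⟩))
  exact ⟨M, fun x hx s hs => hM (x, s) ⟨hx, hs⟩⟩

theorem continuousOn_integral_mul (hL : 0 < L)
    (hf : ContinuousOn (fun p : ℝ × ℝ => f p.1 p.2) (Icc (-L) L ×ˢ Ico 0 T)) {φ : ℝ → ℝ}
    (hφ : Continuous φ) : ContinuousOn (fun t => ∫ x in (-L)..L, f x t * φ x) (Ico 0 T) := by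
  intro t ht
  obtain ⟨T', hT1, hT2⟩ := exists_between ht.2
  obtain ⟨M, hM⟩ := exists_bound_strip hf hT2
  have hmem : ∀ᶠ s in 𝓝[Ico 0 T] t, s ∈ Ico 0 T ∧ s ∈ Icc 0 T' := by
    filter_upwards [self_mem_nhdsWithin, mem_nhdsWithin_of_mem_nhds (Iio_mem_nhds hT1)] with s h1 h2
    exact ⟨h1, h1.1, le_of_lt h2⟩
  have hsub : uIoc (-L) L ⊆ Icc (-L) L := by
    rw [uIoc_of_le (by linarith)]; exact Ioc_subset_Icc_self
  refine intervalIntegral.continuousWithinAt_of_dominated_interval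
    (bound := fun x => M * ‖φ x‖) ?_ ?_ ?_ ?_
  · filter_upwards [hmem] with s hs
    have : ContinuousOn (fun x => f x s * φ x) (Icc (-L) L) :=
      (continuousOn_slice_fst hf hs.1).mul hφ.continuousOn
    exact (this.mono hsub).aestronglyMeasurable measurableSet_uIoc
  · filter_upwards [hmem] with s hs
    refine Eventually.of_forall fun x hx => ?_
    rw [norm_mul]
    exact mul_le_mul_of_nonneg_right (hM x (hsub hx) s hs.2) (norm_nonneg _)
  · exact (continuous_const.mul hφ.norm).intervalIntegrable _ _
  · refine Eventually.of_forall fun x hx => ?_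
    exact (continuousOn_slice_snd hf (hsub hx) t ht).mul continuousWithinAt_const

/-- Differentiation under the integral sign. -/
theorem hasDerivAt_integral_mul (hL : 0 < L)
    (hf : ContDiffOn ℝ 1 (fun p : ℝ × ℝ => f p.1 p.2) (Icc (-L) L ×ˢ Ico 0 T)) {φ : ℝ → ℝ}
    (hφ : Continuous φ) {t : ℝ} (ht : t ∈ Ioo 0 T) :
    HasDerivAt (fun t => ∫ x in (-L)..L, f x t * φ x) (∫ x in (-L)..L, dt f x t * φ x) t := by
  have hd := hf.differentiableOn one_ne_zero
  have hdt := (contDiffOn_dt hL hf (m := 0) (by simp)).continuousOn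
  obtain ⟨T', hT1, hT2⟩ := exists_between ht.2
  obtain ⟨M, hM⟩ := exists_bound_strip hdt hT2
  have hsub : uIoc (-L) L ⊆ Icc (-L) L := by
    rw [uIoc_of_le (by linarith)]; exact Ioc_subset_Icc_self
  have hc : ∀ s ∈ Ico 0 T, ContinuousOn (fun x => f x s * φ x) (Icc (-L) L) := fun s hs =>
    (continuousOn_slice_fst hf.continuousOn hs).mul hφ.continuousOn
  refine (intervalIntegral.hasDerivAt_integral_of_dominated_loc_of_deriv_le
    (F := fun s x => f x s * φ x) (F' := fun s x => dt f x s * φ x) (s := Ioo 0 T')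
    (bound := fun x => M * ‖φ x‖)
    (Ioo_mem_nhds ht.1 hT1) ?_ ?_ ?_ ?_ ?_ ?_).2
  · filter_upwards [Ioo_mem_nhds ht.1 ht.2] with s hs
    exact ((hc s (Ioo_subset_Ico_self hs)).mono hsub).aestronglyMeasurable measurableSet_uIoc
  · refine ContinuousOn.intervalIntegrable ?_
    rw [uIcc_of_le (by linarith)]
    exact hc t (Ioo_subset_Ico_self ht)
  · exact (((continuousOn_slice_fst hdt (Ioo_subset_Ico_self ht)).mul
      hφ.continuousOn).mono hsub).aestronglyMeasurable measurableSet_uIoc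
  · refine Eventually.of_forall fun x hx s hs => ?_
    rw [norm_mul]
    exact mul_le_mul_of_nonneg_right (hM x (hsub hx) s (Ioo_subset_Icc_self hs)) (norm_nonneg _)
  · exact (continuous_const.mul hφ.norm).intervalIntegrable _ _
  · refine Eventually.of_forall fun x hx s hs => ?_
    exact (hasDerivAt_dt hd (hsub hx) ⟨hs.1, hs.2.trans hT2⟩).mul_const _

end partials

/-! ### Integration by parts against the half-range modes -/

section parts

variable {L k : ℝ} {f f' : ℝ → ℝ}

theorem integral_deriv_mul_cos (hL : 0 < L)
    (hf : ∀ x ∈ Icc (-L) L, HasDerivWithinAt f (f' x) (Icc (-L) L) x)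
    (hf' : ContinuousOn f' (Icc (-L) L)) :
    ∫ x in (-L)..L, f' x * Real.cos (k * (x + L)) =
      Real.cos (k * (2 * L)) * f L - f (-L) + k * ∫ x in (-L)..L, f x * Real.sin (k * (x + L)) := by
  have hfc : ContinuousOn f (Icc (-L) L) := fun x hx => (hf x hx).continuousWithinAt
  have hcos : ∀ x, HasDerivAt (fun x => Real.cos (k * (x + L))) (-Real.sin (k * (x + L)) * k) x :=
    fun x => by simpa using (((hasDerivAt_id x).add_const L).const_mul k).cos
  have i1 : IntervalIntegrable (fun x => f' x * Real.cos (k * (x + L))) volume (-L) L := by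
    refine ContinuousOn.intervalIntegrable ?_
    rw [uIcc_of_le (by linarith)]
    exact hf'.mul (Continuous.continuousOn (by fun_prop))
  have i2 : IntervalIntegrable (fun x => f x * Real.sin (k * (x + L))) volume (-L) L := by
    refine ContinuousOn.intervalIntegrable ?_
    rw [uIcc_of_le (by linarith)]
    exact hfc.mul (Continuous.continuousOn (by fun_prop))
  have h := intervalIntegral.integral_eq_sub_of_hasDerivAt_of_le
    (f := fun x => f x * Real.cos (k * (x + L)))
    (f' := fun x => f' x * Real.cos (k * (x + L)) - k * (f x * Real.sin (k * (x + L))))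
    (a := -L) (b := L) (by linarith) (hfc.mul (Continuous.continuousOn (by fun_prop)))
    (fun x hx => by
      have := ((hf x (Ioo_subset_Icc_self hx)).hasDerivAt (Icc_mem_nhds hx.1 hx.2)).mul (hcos x)
      exact this.congr_deriv (by ring)) (i1.sub (i2.const_mul k))
  rw [intervalIntegral.integral_sub i1 (i2.const_mul k), intervalIntegral.integral_const_mul] at h
  simp only [neg_add_cancel, mul_zero, Real.cos_zero, mul_one] at h
  rw [show k * (2 * L) = k * (L + L) by ring]
  linarith

/-- The sine vanishes at `-L` by the shift and at `L` by `hk`, so no boundary values of `f` appear.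
-/
theorem integral_deriv_mul_sin (hL : 0 < L) (hk : Real.sin (k * (2 * L)) = 0)
    (hf : ∀ x ∈ Icc (-L) L, HasDerivWithinAt f (f' x) (Icc (-L) L) x)
    (hf' : ContinuousOn f' (Icc (-L) L)) :
    ∫ x in (-L)..L, f' x * Real.sin (k * (x + L)) =
      -k * ∫ x in (-L)..L, f x * Real.cos (k * (x + L)) := by
  have hfc : ContinuousOn f (Icc (-L) L) := fun x hx => (hf x hx).continuousWithinAt
  have hsin : ∀ x, HasDerivAt (fun x => Real.sin (k * (x + L))) (Real.cos (k * (x + L)) * k) x :=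
    fun x => by simpa using (((hasDerivAt_id x).add_const L).const_mul k).sin
  have i1 : IntervalIntegrable (fun x => f' x * Real.sin (k * (x + L))) volume (-L) L := by
    refine ContinuousOn.intervalIntegrable ?_
    rw [uIcc_of_le (by linarith)]
    exact hf'.mul (Continuous.continuousOn (by fun_prop))
  have i2 : IntervalIntegrable (fun x => f x * Real.cos (k * (x + L))) volume (-L) L := by
    refine ContinuousOn.intervalIntegrable ?_
    rw [uIcc_of_le (by linarith)]
    exact hfc.mul (Continuous.continuousOn (by fun_prop))
  have h := intervalIntegral.integral_eq_sub_of_hasDerivAt_of_le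
    (f := fun x => f x * Real.sin (k * (x + L)))
    (f' := fun x => f' x * Real.sin (k * (x + L)) + k * (f x * Real.cos (k * (x + L))))
    (a := -L) (b := L) (by linarith) (hfc.mul (Continuous.continuousOn (by fun_prop)))
    (fun x hx => by
      have := ((hf x (Ioo_subset_Icc_self hx)).hasDerivAt (Icc_mem_nhds hx.1 hx.2)).mul (hsin x)
      exact this.congr_deriv (by ring)) (i1.add (i2.const_mul k))
  rw [intervalIntegral.integral_add i1 (i2.const_mul k), intervalIntegral.integral_const_mul] at h
  simp only [neg_add_cancel, mul_zero, Real.sin_zero] at h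
  rw [show k * (L + L) = k * (2 * L) by ring, hk] at h
  linarith

end parts

/-! ### The evolution of the half-range modes -/

/-- `∫ f(x, t) cos(k (x + L)) dx`. -/
noncomputable def cosMode (L k : ℝ) (f : ℝ → ℝ → ℝ) (t : ℝ) : ℝ :=
  ∫ x in (-L)..L, f x t * Real.cos (k * (x + L))

/-- `∫ f(x, t) sin(k (x + L)) dx`. -/
noncomputable def sinMode (L k : ℝ) (f : ℝ → ℝ → ℝ) (t : ℝ) : ℝ :=
  ∫ x in (-L)..L, f x t * Real.sin (k * (x + L))

/-- The endpoint combination `cos(2kL) f(L, t) - f(-L, t)`. -/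
noncomputable def bdryDiff (L k : ℝ) (f : ℝ → ℝ → ℝ) (t : ℝ) : ℝ :=
  Real.cos (k * (2 * L)) * f L t - f (-L) t

section modes

variable {α β δ L T k : ℝ} {η u f : ℝ → ℝ → ℝ}

theorem cosMode_dx (hL : 0 < L)
    (hf : ContDiffOn ℝ 1 (fun p : ℝ × ℝ => f p.1 p.2) (Icc (-L) L ×ˢ Ico 0 T))
    {t : ℝ} (ht : t ∈ Ico 0 T) :
    cosMode L k (dx L f) t = bdryDiff L k f t + k * sinMode L k f t :=
  integral_deriv_mul_cos hL
    (fun _ hx => hasDerivWithinAt_dx hL (hf.differentiableOn one_ne_zero) hx ht)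
    (continuousOn_slice_fst (contDiffOn_dx hL hf (m := 0) (by simp)).continuousOn ht)

theorem sinMode_dx (hL : 0 < L) (hk : Real.sin (k * (2 * L)) = 0)
    (hf : ContDiffOn ℝ 1 (fun p : ℝ × ℝ => f p.1 p.2) (Icc (-L) L ×ˢ Ico 0 T))
    {t : ℝ} (ht : t ∈ Ico 0 T) :
    sinMode L k (dx L f) t = -k * cosMode L k f t :=
  integral_deriv_mul_sin hL hk
    (fun _ hx => hasDerivWithinAt_dx hL (hf.differentiableOn one_ne_zero) hx ht)
    (continuousOn_slice_fst (contDiffOn_dx hL hf (m := 0) (by simp)).continuousOn ht)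

theorem hasDerivAt_cosMode (hL : 0 < L) (k : ℝ)
    (hf : ContDiffOn ℝ 1 (fun p : ℝ × ℝ => f p.1 p.2) (Icc (-L) L ×ˢ Ico 0 T))
    {t : ℝ} (ht : t ∈ Ioo 0 T) : HasDerivAt (cosMode L k f) (cosMode L k (dt f) t) t :=
  hasDerivAt_integral_mul hL hf (by fun_prop) ht

theorem hasDerivAt_sinMode (hL : 0 < L) (k : ℝ)
    (hf : ContDiffOn ℝ 1 (fun p : ℝ × ℝ => f p.1 p.2) (Icc (-L) L ×ˢ Ico 0 T))
    {t : ℝ} (ht : t ∈ Ioo 0 T) : HasDerivAt (sinMode L k f) (sinMode L k (dt f) t) t :=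
  hasDerivAt_integral_mul hL hf (by fun_prop) ht

theorem hasDerivAt_bdryDiff (hL : 0 < L) (k : ℝ)
    (hf : ContDiffOn ℝ 1 (fun p : ℝ × ℝ => f p.1 p.2) (Icc (-L) L ×ˢ Ico 0 T))
    {t : ℝ} (ht : t ∈ Ioo 0 T) : HasDerivAt (bdryDiff L k f) (bdryDiff L k (dt f) t) t :=
  ((hasDerivAt_dt (hf.differentiableOn one_ne_zero) ⟨by linarith, le_rfl⟩ ht).const_mul _).sub
    (hasDerivAt_dt (hf.differentiableOn one_ne_zero) ⟨le_rfl, by linarith⟩ ht)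

theorem continuousOn_bdryDiff (hL : 0 < L) (k : ℝ)
    (hf : ContinuousOn (fun p : ℝ × ℝ => f p.1 p.2) (Icc (-L) L ×ˢ Ico 0 T)) :
    ContinuousOn (bdryDiff L k f) (Ico 0 T) :=
  ((continuousOn_slice_snd hf ⟨by linarith, le_rfl⟩).const_mul _).sub
    (continuousOn_slice_snd hf ⟨le_rfl, by linarith⟩)

/-- The second equation of the system, up to the endpoints. -/
theorem second_equation_closed (hL : 0 < L)
    (hη : ContDiffOn ℝ 3 (fun p : ℝ × ℝ => η p.1 p.2) (Icc (-L) L ×ˢ Ico 0 T))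
    (hu : ContDiffOn ℝ 4 (fun p : ℝ × ℝ => u p.1 p.2) (Icc (-L) L ×ˢ Ico 0 T))
    (hsys : SolvesSystem α β δ L T η u) {x t : ℝ} (hx : x ∈ Icc (-L) L) (ht : t ∈ Ioo 0 T) :
    dx L η x t = δ * dt (dx L (dx L u)) x t - dt u x t := by
  have ht' := Ioo_subset_Ico_self ht
  have hu1 : ContDiffOn ℝ 3 (fun p : ℝ × ℝ => dx L u p.1 p.2) (Icc (-L) L ×ˢ Ico 0 T) :=
    contDiffOn_dx hL hu (by norm_num)
  have hu2 : ContDiffOn ℝ 2 (fun p : ℝ × ℝ => dx L (dx L u) p.1 p.2) (Icc (-L) L ×ˢ Ico 0 T) :=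
    contDiffOn_dx hL hu1 (by norm_num)
  have c1 := continuousOn_slice_fst (contDiffOn_dx hL hη (m := 0) (by norm_num)).continuousOn ht'
  have c2 := continuousOn_slice_fst (contDiffOn_dt hL hu2 (m := 0) (by norm_num)).continuousOn ht'
  have c3 := continuousOn_slice_fst (contDiffOn_dt hL hu (m := 0) (by norm_num)).continuousOn ht'
  have h : EqOn (fun x => dx L η x t) (fun x => δ * dt (dx L (dx L u)) x t - dt u x t)
      (Ioo (-L) L) := fun y hy => by
    have := (hsys y hy t ht).2
    simp only
    linarith
  -- Both sides are continuous on the closed interval and agree on its dense interior.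
  have hcl : Icc (-L) L ⊆ closure (Ioo (-L) L) := by
    rw [closure_Ioo (by linarith)]
  exact h.of_subset_closure c1 ((c2.const_mul δ).sub c3) Ioo_subset_Icc_self hcl hx

/-- The first equation of the system, tested against the cosine modes. -/
theorem cosMode_ode (hL : 0 < L) (hk : Real.sin (k * (2 * L)) = 0)
    (hη : ContDiffOn ℝ 3 (fun p : ℝ × ℝ => η p.1 p.2) (Icc (-L) L ×ˢ Ico 0 T))
    (hu : ContDiffOn ℝ 4 (fun p : ℝ × ℝ => u p.1 p.2) (Icc (-L) L ×ˢ Ico 0 T))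
    (hsys : SolvesSystem α β δ L T η u) {t : ℝ} (ht : t ∈ Ioo 0 T) :
    (1 + β * k ^ 2) * cosMode L k (dt η) t + k * (1 + α * k ^ 2) * sinMode L k u t +
      (1 + α * k ^ 2) * bdryDiff L k u t - α * bdryDiff L k (dx L (dx L u)) t -
      β * (δ * bdryDiff L k (dt (dt (dx L (dx L u)))) t - bdryDiff L k (dt (dt u)) t) = 0 := by
  have ht' := Ioo_subset_Ico_self ht
  have hη1 : ContDiffOn ℝ 2 (fun p : ℝ × ℝ => dx L η p.1 p.2) (Icc (-L) L ×ˢ Ico 0 T) :=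
    contDiffOn_dx hL hη (by norm_num)
  have hη2 : ContDiffOn ℝ 1 (fun p : ℝ × ℝ => dx L (dx L η) p.1 p.2) (Icc (-L) L ×ˢ Ico 0 T) :=
    contDiffOn_dx hL hη1 (by norm_num)
  have hu1 : ContDiffOn ℝ 3 (fun p : ℝ × ℝ => dx L u p.1 p.2) (Icc (-L) L ×ˢ Ico 0 T) :=
    contDiffOn_dx hL hu (by norm_num)
  have hu2 : ContDiffOn ℝ 2 (fun p : ℝ × ℝ => dx L (dx L u) p.1 p.2) (Icc (-L) L ×ˢ Ico 0 T) :=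
    contDiffOn_dx hL hu1 (by norm_num)
  have hu3 : ContDiffOn ℝ 1 (fun p : ℝ × ℝ => dx L (dx L (dx L u)) p.1 p.2)
      (Icc (-L) L ×ˢ Ico 0 T) := contDiffOn_dx hL hu2 (by norm_num)
  have hut : ContDiffOn ℝ 3 (fun p : ℝ × ℝ => dt u p.1 p.2) (Icc (-L) L ×ˢ Ico 0 T) :=
    contDiffOn_dt hL hu (by norm_num)
  have hu2t : ContDiffOn ℝ 1 (fun p : ℝ × ℝ => dt (dx L (dx L u)) p.1 p.2)
      (Icc (-L) L ×ˢ Ico 0 T) := contDiffOn_dt hL hu2 (by norm_num)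
  have e1 : cosMode L k (dx L u) t = bdryDiff L k u t + k * sinMode L k u t :=
    cosMode_dx hL (hu.of_le (by norm_num)) ht'
  have e2 : cosMode L k (dx L (dx L (dx L u))) t =
      bdryDiff L k (dx L (dx L u)) t + k * sinMode L k (dx L (dx L u)) t :=
    cosMode_dx hL (hu2.of_le (by norm_num)) ht'
  have e3 : sinMode L k (dx L (dx L u)) t = -k * cosMode L k (dx L u) t :=
    sinMode_dx hL hk (hu1.of_le (by norm_num)) ht'
  -- The order of `dt` and `dx` is never exchanged. At each time the mode of `η_xx` is integrated by
  -- parts, its boundary value `η_x` is replaced through the second equation, and the resulting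
  -- identity is differentiated in time.
  have e4 : cosMode L k (dt (dx L (dx L η))) t =
      (δ * bdryDiff L k (dt (dt (dx L (dx L u)))) t - bdryDiff L k (dt (dt u)) t) -
        k ^ 2 * cosMode L k (dt η) t := by
    have d1 := hasDerivAt_cosMode hL k hη2 ht
    have d2 := (((hasDerivAt_bdryDiff hL k hu2t ht).const_mul δ).sub
      (hasDerivAt_bdryDiff hL k (hut.of_le (by norm_num)) ht)).sub
      ((hasDerivAt_cosMode hL k (hη.of_le (by norm_num)) ht).const_mul (k ^ 2))
    refine d1.unique (d2.congr_of_eventuallyEq ?_)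
    filter_upwards [Ioo_mem_nhds ht.1 ht.2] with s hs
    have hs' := Ioo_subset_Ico_self hs
    rw [cosMode_dx hL (hη1.of_le (by norm_num)) hs', sinMode_dx hL hk (hη.of_le (by norm_num)) hs']
    simp only [bdryDiff, Pi.sub_apply]
    rw [second_equation_closed hL hη hu hsys ⟨by linarith, le_rfl⟩ hs,
      second_equation_closed hL hη hu hsys ⟨le_rfl, by linarith⟩ hs]
    ring
  have hi : ∀ {f : ℝ → ℝ → ℝ},
      ContinuousOn (fun p : ℝ × ℝ => f p.1 p.2) (Icc (-L) L ×ˢ Ico 0 T) →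
      IntervalIntegrable (fun x => f x t * Real.cos (k * (x + L))) volume (-L) L := by
    intro f hf
    refine ContinuousOn.intervalIntegrable ?_
    rw [uIcc_of_le (by linarith)]
    exact (continuousOn_slice_fst hf ht').mul (Continuous.continuousOn (by fun_prop))
  have i1 := hi (contDiffOn_dt hL hη (m := 0) (by norm_num)).continuousOn
  have i2 := hi hu1.continuousOn
  have i3 := hi hu3.continuousOn
  have i4 := hi (contDiffOn_dt hL hη2 (m := 0) (by norm_num)).continuousOn
  have key : cosMode L k (dt η) t + cosMode L k (dx L u) t -
      α * cosMode L k (dx L (dx L (dx L u))) t - β * cosMode L k (dt (dx L (dx L η))) t = 0 := by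
    simp only [cosMode]
    rw [← intervalIntegral.integral_const_mul, ← intervalIntegral.integral_const_mul,
      ← intervalIntegral.integral_add i1 i2,
      ← intervalIntegral.integral_sub (i1.add i2) (i3.const_mul α),
      ← intervalIntegral.integral_sub ((i1.add i2).sub (i3.const_mul α)) (i4.const_mul β)]
    rw [intervalIntegral.integral_congr_Ioo_of_le (g := fun _ => (0 : ℝ)) (by linarith)]
    · simp
    · intro x hx
      have := (hsys x hx t ht).1
      simp only
      linear_combination Real.cos (k * (x + L)) * this
  rw [e1, e2, e3, e1, e4] at key
  linear_combination key

/-- The second equation of the system, tested against the sine modes. -/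
theorem sinMode_ode (hL : 0 < L) (hk : Real.sin (k * (2 * L)) = 0)
    (hη : ContDiffOn ℝ 3 (fun p : ℝ × ℝ => η p.1 p.2) (Icc (-L) L ×ˢ Ico 0 T))
    (hu : ContDiffOn ℝ 4 (fun p : ℝ × ℝ => u p.1 p.2) (Icc (-L) L ×ˢ Ico 0 T))
    (hsys : SolvesSystem α β δ L T η u) {t : ℝ} (ht : t ∈ Ioo 0 T) :
    (1 + δ * k ^ 2) * sinMode L k (dt u) t - k * cosMode L k η t +
      δ * k * bdryDiff L k (dt u) t = 0 := by
  have ht' := Ioo_subset_Ico_self ht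
  have hu1 : ContDiffOn ℝ 3 (fun p : ℝ × ℝ => dx L u p.1 p.2) (Icc (-L) L ×ˢ Ico 0 T) :=
    contDiffOn_dx hL hu (by norm_num)
  have hu2 : ContDiffOn ℝ 2 (fun p : ℝ × ℝ => dx L (dx L u) p.1 p.2) (Icc (-L) L ×ˢ Ico 0 T) :=
    contDiffOn_dx hL hu1 (by norm_num)
  have e1 : sinMode L k (dx L η) t = -k * cosMode L k η t :=
    sinMode_dx hL hk (hη.of_le (by norm_num)) ht'
  -- As for the cosine modes: integrate by parts at fixed time, then differentiate in time.
  have e2 : sinMode L k (dt (dx L (dx L u))) t =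
      -k * (bdryDiff L k (dt u) t + k * sinMode L k (dt u) t) := by
    have d1 := hasDerivAt_sinMode hL k (hu2.of_le (by norm_num)) ht
    have d2 := ((hasDerivAt_bdryDiff hL k (hu.of_le (by norm_num)) ht).add
      ((hasDerivAt_sinMode hL k (hu.of_le (by norm_num)) ht).const_mul k)).const_mul (-k)
    refine d1.unique (d2.congr_of_eventuallyEq ?_)
    filter_upwards [Ioo_mem_nhds ht.1 ht.2] with s hs
    have hs' := Ioo_subset_Ico_self hs
    rw [sinMode_dx hL hk (hu1.of_le (by norm_num)) hs', cosMode_dx hL (hu.of_le (by norm_num)) hs']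
    rfl
  have hi : ∀ {f : ℝ → ℝ → ℝ},
      ContinuousOn (fun p : ℝ × ℝ => f p.1 p.2) (Icc (-L) L ×ˢ Ico 0 T) →
      IntervalIntegrable (fun x => f x t * Real.sin (k * (x + L))) volume (-L) L := by
    intro f hf
    refine ContinuousOn.intervalIntegrable ?_
    rw [uIcc_of_le (by linarith)]
    exact (continuousOn_slice_fst hf ht').mul (Continuous.continuousOn (by fun_prop))
  have i1 := hi (contDiffOn_dt hL hu (m := 0) (by norm_num)).continuousOn
  have i2 := hi (contDiffOn_dx hL hη (m := 0) (by norm_num)).continuousOn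
  have i3 := hi (contDiffOn_dt hL hu2 (m := 0) (by norm_num)).continuousOn
  have key : sinMode L k (dt u) t + sinMode L k (dx L η) t -
      δ * sinMode L k (dt (dx L (dx L u))) t = 0 := by
    simp only [sinMode]
    rw [← intervalIntegral.integral_const_mul,
      ← intervalIntegral.integral_add i1 i2,
      ← intervalIntegral.integral_sub (i1.add i2) (i3.const_mul δ)]
    rw [intervalIntegral.integral_congr_Ioo_of_le (g := fun _ => (0 : ℝ)) (by linarith)]
    · simp
    · intro x hx
      have := (hsys x hx t ht).2
      simp only
      linear_combination Real.sin (k * (x + L)) * this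
  rw [e1, e2] at key
  linear_combination key

end modes

/-! ### Linearity of the boundary transforms -/

section transforms

variable {f g : ℝ → ℝ} {ω : ℂ} {t : ℝ}

theorem intervalIntegrable_exp_mul (hf : IntervalIntegrable f volume 0 t) (c : ℂ) :
    IntervalIntegrable (fun τ : ℝ => Complex.exp (c * τ) * (f τ : ℂ)) volume 0 t :=
  IntervalIntegrable.continuousOn_mul (f := fun τ : ℝ => (f τ : ℂ)) ⟨hf.1.ofReal, hf.2.ofReal⟩
    (Continuous.continuousOn (by fun_prop))

theorem integral_exp_mul_add (hf : IntervalIntegrable f volume 0 t)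
    (hg : IntervalIntegrable g volume 0 t) (c : ℂ) :
    ∫ τ in (0 : ℝ)..t, Complex.exp (c * τ) * ((f τ + g τ : ℝ) : ℂ) =
      (∫ τ in (0 : ℝ)..t, Complex.exp (c * τ) * (f τ : ℂ)) +
        ∫ τ in (0 : ℝ)..t, Complex.exp (c * τ) * (g τ : ℂ) := by
  rw [← intervalIntegral.integral_add (intervalIntegrable_exp_mul hf c)
    (intervalIntegrable_exp_mul hg c)]
  simp only [Complex.ofReal_add, mul_add]

theorem integral_exp_mul_const_mul (a : ℝ) (f : ℝ → ℝ) (c : ℂ) :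
    ∫ τ in (0 : ℝ)..t, Complex.exp (c * τ) * ((a * f τ : ℝ) : ℂ) =
      a * ∫ τ in (0 : ℝ)..t, Complex.exp (c * τ) * (f τ : ℂ) := by
  rw [← intervalIntegral.integral_const_mul]
  congr 1
  ext τ
  push_cast
  ring

theorem Bplus_add (hf : IntervalIntegrable f volume 0 t) (hg : IntervalIntegrable g volume 0 t) :
    Bplus (fun τ => f τ + g τ) ω t = Bplus f ω t + Bplus g ω t := by
  simp only [Bplus, ← neg_mul]
  rw [integral_exp_mul_add hf hg, integral_exp_mul_add hf hg]
  ring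

theorem Bminus_add (hf : IntervalIntegrable f volume 0 t) (hg : IntervalIntegrable g volume 0 t) :
    Bminus (fun τ => f τ + g τ) ω t = Bminus f ω t + Bminus g ω t := by
  simp only [Bminus, ← neg_mul]
  rw [integral_exp_mul_add hf hg, integral_exp_mul_add hf hg]
  ring

theorem Bplus_const_mul (a : ℝ) (f : ℝ → ℝ) :
    Bplus (fun τ => a * f τ) ω t = a * Bplus f ω t := by
  simp only [Bplus, ← neg_mul]
  rw [integral_exp_mul_const_mul, integral_exp_mul_const_mul]
  ring

theorem Bminus_const_mul (a : ℝ) (f : ℝ → ℝ) :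
    Bminus (fun τ => a * f τ) ω t = a * Bminus f ω t := by
  simp only [Bminus, ← neg_mul]
  rw [integral_exp_mul_const_mul, integral_exp_mul_const_mul]
  ring

/-- Equality on the open interval is what is available: the boundary data are prescribed only for `0
< t < T`. -/
theorem Bplus_congr (ht : 0 ≤ t) (h : EqOn f g (Ioo 0 t)) : Bplus f ω t = Bplus g ω t := by
  unfold Bplus
  congr 2
  all_goals
    refine intervalIntegral.integral_congr_Ioo_of_le ht fun τ hτ => ?_
    simp only [h hτ]

theorem Bminus_congr (ht : 0 ≤ t) (h : EqOn f g (Ioo 0 t)) : Bminus f ω t = Bminus g ω t := by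
  unfold Bminus
  congr 2
  all_goals
    refine intervalIntegral.integral_congr_Ioo_of_le ht fun τ hτ => ?_
    simp only [h hτ]

theorem fhat_congr {L : ℝ} (hL : 0 ≤ L) {f g : ℝ → ℝ} (h : EqOn f g (Ioo (-L) L)) (k : ℂ) :
    fhat L f k = fhat L g k := by
  refine intervalIntegral.integral_congr_Ioo_of_le (by linarith) fun x hx => ?_
  simp only [h hx]

end transforms

/-! ### Solution of the mode equations -/

/-- Duhamel's formula on `[0, T)`. -/
theorem duhamel {T : ℝ} {V F : ℝ → ℂ} {c : ℂ} (hV : ContinuousOn V (Ico 0 T))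
    (hF : ContinuousOn F (Ico 0 T)) (hd : ∀ s ∈ Ioo 0 T, HasDerivAt V (c * V s - F s) s) {t : ℝ}
    (ht : t ∈ Ioo 0 T) :
    V t = Complex.exp (c * t) * (V 0 - ∫ τ in (0 : ℝ)..t, Complex.exp (-c * τ) * F τ) := by
  have hsub : Icc 0 t ⊆ Ico 0 T := fun s hs => ⟨hs.1, hs.2.trans_lt ht.2⟩
  have hexp : ∀ s : ℝ, HasDerivAt (fun s : ℝ => Complex.exp (-c * s))
      (Complex.exp (-c * s) * -c) s := fun s => by
    have h1 : HasDerivAt (fun s : ℝ => (s : ℂ)) 1 s := Complex.ofRealCLM.hasDerivAt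
    simpa using (h1.const_mul (-c)).cexp
  have hi : ContinuousOn (fun τ : ℝ => Complex.exp (-c * τ) * F τ) (Icc 0 t) :=
    ContinuousOn.mul (Continuous.continuousOn (by fun_prop)) (hF.mono hsub)
  have h := intervalIntegral.integral_eq_sub_of_hasDerivAt_of_le
    (f := fun s : ℝ => Complex.exp (-c * s) * V s)
    (f' := fun s : ℝ => -(Complex.exp (-c * s) * F s)) ht.1.le
    (ContinuousOn.mul (Continuous.continuousOn (by fun_prop)) (hV.mono hsub))
    (fun s hs => ((hexp s).mul (hd s ⟨hs.1, hs.2.trans ht.2⟩)).congr_deriv (by ring))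
    (ContinuousOn.intervalIntegrable (by rw [uIcc_of_le ht.1.le]; exact hi.neg))
  rw [intervalIntegral.integral_neg] at h
  simp only [Complex.ofReal_zero, mul_zero, Complex.exp_zero, one_mul] at h
  have h2 : V 0 - (∫ τ in (0 : ℝ)..t, Complex.exp (-c * τ) * F τ) = Complex.exp (-c * t) * V t := by
    linear_combination h
  rw [h2, ← mul_assoc, ← Complex.exp_add]
  simp

/-- The solution of `C' = -mω S - P`, `S' = (ω / m) C - Q`. -/
theorem oscillator_solution {T : ℝ} {C S P Q : ℝ → ℝ} {m ω : ℂ} (hm : m ≠ 0)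
    (hC : ContinuousOn C (Ico 0 T)) (hS : ContinuousOn S (Ico 0 T))
    (hP : ContinuousOn P (Ico 0 T)) (hQ : ContinuousOn Q (Ico 0 T))
    (hC' : ∀ s ∈ Ioo 0 T, ∃ c : ℝ, HasDerivAt C c s ∧ (c : ℂ) = -(m * ω) * S s - P s)
    (hS' : ∀ s ∈ Ioo 0 T, ∃ c : ℝ, HasDerivAt S c s ∧ (c : ℂ) = ω / m * C s - Q s)
    {t : ℝ} (ht : t ∈ Ioo 0 T) :
    (2 * C t : ℂ) = expSum ω t * C 0 + Complex.I * m * expDiff ω t * S 0 -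
      (Bplus P ω t + Complex.I * m * Bminus Q ω t) ∧
    (2 * S t : ℂ) = expSum ω t * S 0 - Complex.I / m * expDiff ω t * C 0 +
      Complex.I * (1 / m * Bminus P ω t + Complex.I * Bplus Q ω t) := by
  have cC : ContinuousOn (fun s => (C s : ℂ)) (Ico 0 T) :=
    Complex.continuous_ofReal.comp_continuousOn hC
  have cS : ContinuousOn (fun s => (S s : ℂ)) (Ico 0 T) :=
    Complex.continuous_ofReal.comp_continuousOn hS
  have cP : ContinuousOn (fun s => (P s : ℂ)) (Ico 0 T) :=
    Complex.continuous_ofReal.comp_continuousOn hP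
  have cQ : ContinuousOn (fun s => (Q s : ℂ)) (Ico 0 T) :=
    Complex.continuous_ofReal.comp_continuousOn hQ
  have hi : ∀ {f : ℝ → ℝ}, ContinuousOn f (Ico 0 T) → IntervalIntegrable f volume 0 t := by
    intro f hf
    refine ContinuousOn.intervalIntegrable ?_
    rw [uIcc_of_le ht.1.le]
    exact hf.mono fun s hs => ⟨hs.1, hs.2.trans_lt ht.2⟩
  -- The combinations `C + e m S` with `e = ±i` diagonalise the system: each satisfies a scalar
  -- equation with rate `eω`, to which Duhamel's formula applies. Their sum and difference recover
  -- `C` and `S`.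
  have key : ∀ e : ℂ, e ^ 2 = -1 →
      (C t : ℂ) + e * m * S t = Complex.exp (e * ω * t) * (((C 0 : ℂ) + e * m * S 0) -
        ((∫ τ in (0 : ℝ)..t, Complex.exp (-(e * ω) * τ) * (P τ : ℂ)) +
          e * m * ∫ τ in (0 : ℝ)..t, Complex.exp (-(e * ω) * τ) * (Q τ : ℂ))) := by
    intro e he
    have h := duhamel (V := fun s => (C s : ℂ) + e * m * S s) (c := e * ω)
      (F := fun s => (P s : ℂ) + e * m * Q s) (cC.add (cS.const_mul _)) (cP.add (cQ.const_mul _))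
      (fun s hs => by
        obtain ⟨c₁, h1, h2⟩ := hC' s hs
        obtain ⟨c₂, h3, h4⟩ := hS' s hs
        refine (h1.ofReal_comp.add (h3.ofReal_comp.const_mul (e * m))).congr_deriv ?_
        rw [h2, h4]
        field_simp
        linear_combination -(m * ω * S s) * he) ht
    rw [h]
    congr 2
    rw [← intervalIntegral.integral_const_mul, ← intervalIntegral.integral_add
      (intervalIntegrable_exp_mul (hi hP) _) ((intervalIntegrable_exp_mul (hi hQ) _).const_mul _)]
    congr 1
    ext τ
    ring
  have h1 := key Complex.I Complex.I_sq
  have h2 := key (-Complex.I) (by rw [neg_sq, Complex.I_sq])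
  simp only [neg_mul, neg_neg] at h1 h2
  have hI := Complex.I_sq
  constructor
  · simp only [expSum, expDiff, Bplus, Bminus]
    linear_combination h1 + h2
  · have h3 : Complex.I * m * (2 * S t) = Complex.I * m * (expSum ω t * S 0 -
        Complex.I / m * expDiff ω t * C 0 +
        Complex.I * (1 / m * Bminus P ω t + Complex.I * Bplus Q ω t)) := by
      simp only [expSum, expDiff, Bplus, Bminus]
      field_simp
      linear_combination -Complex.I * (h1 - h2) + (2 * m * S t - m * S 0 *
        (Complex.exp (Complex.I * ω * t) + Complex.exp (-(Complex.I * ω * t)))) * hI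
    exact mul_left_cancel₀ (mul_ne_zero Complex.I_ne_zero hm) h3

/-! ### Half-range modes and Fourier transforms -/

section modes

variable {L k : ℝ} {f : ℝ → ℝ → ℝ} {t : ℝ}

theorem ofReal_cosMode (L k : ℝ) (f : ℝ → ℝ → ℝ) (t : ℝ) :
    (cosMode L k f t : ℂ) = ∫ y in (-L)..L, (f y t : ℂ) * Complex.cos (k * (y + L)) := by
  rw [cosMode, ← intervalIntegral.integral_ofReal]
  push_cast
  rfl

theorem ofReal_sinMode (L k : ℝ) (f : ℝ → ℝ → ℝ) (t : ℝ) :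
    (sinMode L k f t : ℂ) = ∫ y in (-L)..L, (f y t : ℂ) * Complex.sin (k * (y + L)) := by
  rw [sinMode, ← intervalIntegral.integral_ofReal]
  push_cast
  rfl

/-- The factors `e^{∓ikL}` shift the origin to the left endpoint, where `e^{-ik(x+L)} + e^{ik(x+L)}
= 2 cos(k(x+L))`. This is the form in which the initial data enter the residues. -/
theorem fhat_add_eq_cosMode (hL : 0 ≤ L) (hf : ContinuousOn (fun x => f x t) (Icc (-L) L)) :
    Complex.exp (-(Complex.I * k * L)) * fhat L (fun x => f x t) k +
      Complex.exp (Complex.I * k * L) * fhat L (fun x => f x t) (-k) = 2 * cosMode L k f t := by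
  rw [ofReal_cosMode, fhat, fhat]
  simp only [← intervalIntegral.integral_const_mul]
  rw [← intervalIntegral.integral_add]
  · congr 1
    ext x
    rw [← mul_assoc, ← mul_assoc, ← Complex.exp_add, ← Complex.exp_add, Complex.cos]
    ring_nf
  all_goals
    refine ContinuousOn.intervalIntegrable ?_
    rw [uIcc_of_le (by linarith)]
    exact continuousOn_const.mul (ContinuousOn.mul (Continuous.continuousOn (by fun_prop))
      (Complex.continuous_ofReal.comp_continuousOn hf))

theorem fhat_sub_eq_sinMode (hL : 0 ≤ L) (hf : ContinuousOn (fun x => f x t) (Icc (-L) L)) :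
    Complex.exp (-(Complex.I * k * L)) * fhat L (fun x => f x t) k -
      Complex.exp (Complex.I * k * L) * fhat L (fun x => f x t) (-k) =
      -(2 * Complex.I) * sinMode L k f t := by
  rw [ofReal_sinMode, fhat, fhat]
  simp only [← intervalIntegral.integral_const_mul]
  rw [← intervalIntegral.integral_sub]
  · congr 1
    ext x
    have e1 : Complex.exp (-(Complex.I * k * L)) * Complex.exp (-(Complex.I * k * x)) =
        Complex.exp (-(k * (x + L)) * Complex.I) := by
      rw [← Complex.exp_add]; ring_nf
    have e2 : Complex.exp (Complex.I * k * L) * Complex.exp (-(Complex.I * -k * x)) =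
        Complex.exp (k * (x + L) * Complex.I) := by
      rw [← Complex.exp_add]; ring_nf
    rw [← mul_assoc, ← mul_assoc, e1, e2, Complex.sin]
    linear_combination (Complex.exp (-(k * (x + L)) * Complex.I) -
      Complex.exp (k * (x + L) * Complex.I)) * (f x t : ℂ) * Complex.I_sq
  all_goals
    refine ContinuousOn.intervalIntegrable ?_
    rw [uIcc_of_le (by linarith)]
    exact continuousOn_const.mul (ContinuousOn.mul (Continuous.continuousOn (by fun_prop))
      (Complex.continuous_ofReal.comp_continuousOn hf))

end modes

/-! ### Entire functions of the square of the frequency -/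

theorem differentiable_tsum_of_le_inv_factorial {a : ℕ → ℂ}
    (ha : ∀ n, ‖a n‖ ≤ 1 / (n.factorial : ℝ)) : Differentiable ℂ fun z => ∑' n, a n * z ^ n := by
  intro z
  have h : DifferentiableOn ℂ (fun z => ∑' n, a n * z ^ n) (ball 0 (‖z‖ + 1)) := by
    refine Complex.differentiableOn_tsum_of_summable_norm
      (Real.summable_pow_div_factorial (‖z‖ + 1))
      (fun n => Differentiable.differentiableOn (by fun_prop)) isOpen_ball fun n w hw => ?_
    rw [mem_ball_zero_iff] at hw
    rw [norm_mul, norm_pow, div_eq_mul_one_div, mul_comm]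
    exact mul_le_mul (pow_le_pow_left₀ (norm_nonneg _) hw.le n) (ha n) (norm_nonneg _)
      (by positivity)
  exact h.differentiableAt (isOpen_ball.mem_nhds (by simp))

/-- The entire function with `cosSqrt (w ^ 2) = cos w`. -/
noncomputable def cosSqrt (z : ℂ) : ℂ := ∑' n : ℕ, (-1) ^ n / ((2 * n).factorial : ℂ) * z ^ n

/-- The entire function with `w * sinSqrt (w ^ 2) = sin w`. -/
noncomputable def sinSqrt (z : ℂ) : ℂ := ∑' n : ℕ, (-1) ^ n / ((2 * n + 1).factorial : ℂ) * z ^ n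

theorem differentiable_cosSqrt : Differentiable ℂ cosSqrt := by
  refine differentiable_tsum_of_le_inv_factorial fun n => ?_
  rw [norm_div, norm_pow, norm_neg, norm_one, one_pow, Complex.norm_natCast]
  have h : (n.factorial : ℝ) ≤ (2 * n).factorial := by
    exact_mod_cast Nat.factorial_le (by omega)
  exact one_div_le_one_div_of_le (by exact_mod_cast n.factorial_pos) h

theorem differentiable_sinSqrt : Differentiable ℂ sinSqrt := by
  refine differentiable_tsum_of_le_inv_factorial fun n => ?_
  rw [norm_div, norm_pow, norm_neg, norm_one, one_pow, Complex.norm_natCast]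
  have h : (n.factorial : ℝ) ≤ (2 * n + 1).factorial := by
    exact_mod_cast Nat.factorial_le (by omega)
  exact one_div_le_one_div_of_le (by exact_mod_cast n.factorial_pos) h

theorem cosSqrt_sq (w : ℂ) : cosSqrt (w ^ 2) = Complex.cos w := by
  rw [Complex.cos_eq_tsum, cosSqrt]
  refine tsum_congr fun n => ?_
  rw [← pow_mul]
  ring

theorem mul_sinSqrt_sq (w : ℂ) : w * sinSqrt (w ^ 2) = Complex.sin w := by
  rw [Complex.sin_eq_tsum, sinSqrt, ← tsum_mul_left]
  refine tsum_congr fun n => ?_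
  rw [← pow_mul, pow_succ]
  ring

/-- Holomorphic dependence on a parameter that enters an entire function linearly. -/
theorem differentiable_integral_comp_mul {G : ℂ → ℂ} (hG : Differentiable ℂ G) {a b : ℝ}
    {φ f : ℝ → ℂ} (hφ : Continuous φ) (hf : IntervalIntegrable f volume a b) :
    Differentiable ℂ fun z => ∫ τ in a..b, G (z * φ τ) * f τ := by
  intro z₀
  have hG' : Continuous (deriv G) := (hG.contDiff (n := 1)).continuous_deriv le_rfl
  have hGc : Continuous G := hG.continuous
  obtain ⟨M, hM⟩ := ((isCompact_closedBall z₀ 1).prod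
    (isCompact_uIcc (a := a) (b := b))).exists_bound_of_continuousOn
    (f := fun p : ℂ × ℝ => deriv G (p.1 * φ p.2) * φ p.2)
    (Continuous.continuousOn (by fun_prop))
  have hi : ∀ {g : ℝ → ℂ}, Continuous g → IntervalIntegrable (fun τ => g τ * f τ) volume a b :=
    fun hg => IntervalIntegrable.continuousOn_mul hf hg.continuousOn
  refine ((intervalIntegral.hasDerivAt_integral_of_dominated_loc_of_deriv_le
    (F := fun z τ => G (z * φ τ) * f τ) (F' := fun z τ => deriv G (z * φ τ) * φ τ * f τ)
    (bound := fun τ => M * ‖f τ‖) (ball_mem_nhds z₀ one_pos) ?_ ?_ ?_ ?_ ?_ ?_).2).differentiableAt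
  · exact Eventually.of_forall fun z =>
      (intervalIntegrable_iff.mp (hi (by fun_prop))).aestronglyMeasurable
  · exact hi (by fun_prop)
  · exact (intervalIntegrable_iff.mp (hi (by fun_prop))).aestronglyMeasurable
  · refine Eventually.of_forall fun τ hτ z hz => ?_
    rw [norm_mul]
    exact mul_le_mul_of_nonneg_right
      (hM (z, τ) ⟨ball_subset_closedBall hz, uIoc_subset_uIcc hτ⟩) (norm_nonneg _)
  · exact hf.norm.const_mul M
  · refine Eventually.of_forall fun τ _ z _ => ?_
    have h1 : HasDerivAt (fun z => z * φ τ) (φ τ) z := by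
      simpa using (hasDerivAt_id z).mul_const (φ τ)
    exact ((hG (z * φ τ)).hasDerivAt.comp z h1).mul_const (f τ)

theorem differentiable_fhat {L : ℝ} {f : ℝ → ℝ} (hf : IntervalIntegrable f volume (-L) L) :
    Differentiable ℂ (fhat L f) := by
  have h := differentiable_integral_comp_mul Complex.differentiable_exp
    (φ := fun x => -(Complex.I * x)) (f := fun x => (f x : ℂ)) (by fun_prop)
    (⟨hf.1.ofReal, hf.2.ofReal⟩ : IntervalIntegrable (fun x => (f x : ℂ)) volume (-L) L)
  convert h using 2 with k
  unfold fhat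
  congr 1
  ext x
  ring_nf

/-- The integrand is `2 cos(ω(t-τ)) f(τ)`, even in `ω`, so `B^+` depends only on `ω²`. -/
theorem Bplus_eq_integral {f : ℝ → ℝ} {t : ℝ} (hf : IntervalIntegrable f volume 0 t) (ω : ℂ) :
    Bplus f ω t =
      2 * ∫ τ in (0 : ℝ)..t, cosSqrt (ω ^ 2 * (((t - τ) ^ 2 : ℝ) : ℂ)) * (f τ : ℂ) := by
  simp only [Bplus, ← neg_mul]
  simp only [← intervalIntegral.integral_const_mul]
  rw [← intervalIntegral.integral_add ((intervalIntegrable_exp_mul hf _).const_mul _)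
    ((intervalIntegrable_exp_mul hf _).const_mul _)]
  congr 1
  ext τ
  rw [show ω ^ 2 * (((t - τ) ^ 2 : ℝ) : ℂ) = (ω * (t - τ)) ^ 2 by push_cast; ring, cosSqrt_sq,
    Complex.cos, ← mul_assoc, ← mul_assoc, ← Complex.exp_add, ← Complex.exp_add]
  ring_nf

/-- The integrand is `2i sin(ω(t-τ)) f(τ)`, odd in `ω`: one factor `ω` is extracted and the rest
depends only on `ω²`. -/
theorem Bminus_eq_integral {f : ℝ → ℝ} {t : ℝ} (hf : IntervalIntegrable f volume 0 t) (ω : ℂ) :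
    Bminus f ω t = ω * (2 * Complex.I *
      ∫ τ in (0 : ℝ)..t, sinSqrt (ω ^ 2 * (((t - τ) ^ 2 : ℝ) : ℂ)) * (((t - τ) * f τ : ℝ) : ℂ)) := by
  simp only [Bminus, ← neg_mul]
  simp only [← intervalIntegral.integral_const_mul]
  rw [← intervalIntegral.integral_sub ((intervalIntegrable_exp_mul hf _).const_mul _)
    ((intervalIntegrable_exp_mul hf _).const_mul _)]
  congr 1
  ext τ
  have h := mul_sinSqrt_sq (ω * (t - τ))
  rw [show ω ^ 2 * (((t - τ) ^ 2 : ℝ) : ℂ) = (ω * (t - τ)) ^ 2 by push_cast; ring]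
  have h2 : ω * (2 * Complex.I * (sinSqrt ((ω * (t - τ)) ^ 2) * (((t - τ) * f τ : ℝ) : ℂ))) =
      2 * Complex.I * Complex.sin (ω * (t - τ)) * f τ := by
    rw [← h]; push_cast; ring
  rw [h2, Complex.sin, ← mul_assoc, ← mul_assoc, ← Complex.exp_add, ← Complex.exp_add]
  rw [show Complex.I * ω * t + -Complex.I * ω * τ = ω * (t - τ) * Complex.I by ring,
    show -Complex.I * ω * t + Complex.I * ω * τ = -(ω * (t - τ)) * Complex.I by ring]
  linear_combination (Complex.exp (ω * (t - τ) * Complex.I) -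
    Complex.exp (-(ω * (t - τ)) * Complex.I)) * (f τ : ℂ) * Complex.I_sq

theorem expSum_eq_cosSqrt (ω : ℂ) (t : ℝ) : expSum ω t = 2 * cosSqrt (ω ^ 2 * (t : ℂ) ^ 2) := by
  rw [← mul_pow, cosSqrt_sq, Complex.cos, expSum]
  ring_nf

theorem expDiff_eq_sinSqrt (ω : ℂ) (t : ℝ) :
    expDiff ω t = ω * (2 * Complex.I * t * sinSqrt (ω ^ 2 * (t : ℂ) ^ 2)) := by
  have h := mul_sinSqrt_sq (ω * t)
  have h2 : ω * (2 * Complex.I * t * sinSqrt (ω ^ 2 * (t : ℂ) ^ 2)) =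
      2 * Complex.I * Complex.sin (ω * t) := by
    rw [← h, mul_pow]; ring
  rw [h2, Complex.sin, expDiff,
    show Complex.I * ω * t = ω * t * Complex.I by ring,
    show -(ω * t * Complex.I) = -(ω * t) * Complex.I by ring]
  linear_combination (Complex.exp (ω * t * Complex.I) -
    Complex.exp (-(ω * t) * Complex.I)) * Complex.I_sq

/-! ### Functions that agree with a holomorphic function off an exceptional set -/

/-- `f` coincides outside `Z` with a function that is holomorphic on `U`. -/
def HolomorphicOff (U Z : Set ℂ) (f : ℂ → ℂ) : Prop :=
  ∃ g : ℂ → ℂ, DifferentiableOn ℂ g U ∧ ∀ k ∉ Z, f k = g k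

namespace HolomorphicOff

variable {U Z : Set ℂ} {f g : ℂ → ℂ}

theorem of_differentiableOn (h : DifferentiableOn ℂ f U) : HolomorphicOff U Z f :=
  ⟨f, h, fun _ _ => rfl⟩

theorem congr (h : HolomorphicOff U Z f) (hg : ∀ k ∉ Z, g k = f k) : HolomorphicOff U Z g := by
  obtain ⟨F, hF, hf⟩ := h
  exact ⟨F, hF, fun k hk => (hg k hk).trans (hf k hk)⟩

theorem add (hf : HolomorphicOff U Z f) (hg : HolomorphicOff U Z g) :
    HolomorphicOff U Z fun k => f k + g k := by
  obtain ⟨F, hF, hf⟩ := hf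
  obtain ⟨G, hG, hg⟩ := hg
  exact ⟨fun k => F k + G k, hF.add hG, fun k hk => by simp only [hf k hk, hg k hk]⟩

theorem sub (hf : HolomorphicOff U Z f) (hg : HolomorphicOff U Z g) :
    HolomorphicOff U Z fun k => f k - g k := by
  obtain ⟨F, hF, hf⟩ := hf
  obtain ⟨G, hG, hg⟩ := hg
  exact ⟨fun k => F k - G k, hF.sub hG, fun k hk => by simp only [hf k hk, hg k hk]⟩

theorem mul (hf : HolomorphicOff U Z f) (hg : HolomorphicOff U Z g) :
    HolomorphicOff U Z fun k => f k * g k := by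
  obtain ⟨F, hF, hf⟩ := hf
  obtain ⟨G, hG, hg⟩ := hg
  exact ⟨fun k => F k * G k, hF.mul hG, fun k hk => by simp only [hf k hk, hg k hk]⟩

end HolomorphicOff

/-- The points where the boundary data enter the formulas holomorphically. -/
def regularSet (β δ : ℝ) : Set ℂ := {k | (1 + β * k ^ 2 : ℂ) ≠ 0 ∧ (1 + δ * k ^ 2 : ℂ) ≠ 0}

/-- The zeros of the three square roots. -/
def branchSet (α β δ : ℝ) : Set ℂ :=
  {k | (1 + α * k ^ 2 : ℂ) = 0 ∨ (1 + β * k ^ 2 : ℂ) = 0 ∨ (1 + δ * k ^ 2 : ℂ) = 0}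

theorem countable_branchSet (α β δ : ℝ) : (branchSet α β δ).Countable := by
  have h : ∀ a : ℝ, {k : ℂ | (1 + a * k ^ 2 : ℂ) = 0}.Countable := by
    intro a
    by_cases hne : {k : ℂ | (1 + a * k ^ 2 : ℂ) = 0}.Nonempty
    · obtain ⟨z, hz⟩ := hne
      have hz' : (1 + a * z ^ 2 : ℂ) = 0 := hz
      have ha : (a : ℂ) ≠ 0 := by
        rintro h0
        rw [h0] at hz'
        simp at hz'
      refine ((countable_singleton (-z)).insert z).mono fun k hk => ?_
      have hk' : (1 + a * k ^ 2 : ℂ) = 0 := hk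
      exact sq_eq_sq_iff_eq_or_eq_neg.mp (mul_left_cancel₀ ha (by linear_combination hk' - hz'))
    · rw [not_nonempty_iff_eq_empty.mp hne]
      exact countable_empty
  exact (h α).union ((h β).union (h δ))

theorem one_add_mul_sq_ne_zero_of_real {a : ℝ} (ha : 0 ≤ a) (k : ℝ) :
    (1 + a * (k : ℂ) ^ 2 : ℂ) ≠ 0 := by
  have : (0 : ℝ) < 1 + a * k ^ 2 := by positivity
  exact_mod_cast this.ne'

/-- The real part is `1 + a (Re k)² - a (Im k)²`, and `a (Im k)² ≤ a R² < 1`. -/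
theorem one_add_mul_sq_ne_zero_of_im {a R : ℝ} (ha : 0 ≤ a) (hR : 0 ≤ R)
    (hRa : R * Real.sqrt a < 1) {k : ℂ} (hk : |k.im| ≤ R) : (1 + a * k ^ 2 : ℂ) ≠ 0 := by
  intro h
  have h1 := congrArg Complex.re h
  simp only [Complex.add_re, Complex.one_re, Complex.mul_re, Complex.ofReal_re, Complex.ofReal_im,
    zero_mul, sub_zero, Complex.zero_re, pow_two] at h1
  have h2 : R ^ 2 * a < 1 := by
    have h3 : (R * Real.sqrt a) ^ 2 < 1 :=
      pow_lt_one₀ (mul_nonneg hR (Real.sqrt_nonneg a)) hRa two_ne_zero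
    rwa [mul_pow, Real.sq_sqrt ha] at h3
  have h4 : k.im ^ 2 ≤ R ^ 2 := sq_le_sq.mpr (by rwa [abs_of_nonneg hR])
  nlinarith [mul_le_mul_of_nonneg_left h4 ha, mul_nonneg ha (sq_nonneg k.re)]

theorem ball_kn_subset_regularSet {β δ R : ℝ} (hβ : 0 ≤ β) (hδ : 0 ≤ δ) (hRβ : R * Real.sqrt β < 1)
    (hRδ : R * Real.sqrt δ < 1) (L : ℝ) (n : ℤ) :
    ball (kn L n : ℂ) R ⊆ regularSet β δ := by
  intro k hk
  rw [mem_ball, dist_eq_norm] at hk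
  have him : |k.im| ≤ R := by
    have := (Complex.abs_im_le_norm (k - kn L n)).trans hk.le
    simpa using this
  have hR : 0 ≤ R := (norm_nonneg _).trans hk.le
  exact ⟨one_add_mul_sq_ne_zero_of_im hβ hR hRβ him, one_add_mul_sq_ne_zero_of_im hδ hR hRδ him⟩

/-! ### Independence of the choice of square roots. -/

section data

variable {α β δ : ℝ} {μα μβ μδ : ℂ → ℂ}

theorem sqrtBranch_ne_zero (hμα : IsSqrtBranch α μα) (hμβ : IsSqrtBranch β μβ)
    (hμδ : IsSqrtBranch δ μδ) {k : ℂ} (hk : k ∉ branchSet α β δ) :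
    μα k ≠ 0 ∧ μβ k ≠ 0 ∧ μδ k ≠ 0 := by
  simp only [branchSet, mem_ofPred_eq, not_or] at hk
  rw [← hμα k, ← hμβ k, ← hμδ k] at hk
  simpa using hk

/-- The roots enter `ω²` only through their squares, so it is rational in `k` whatever the branches.
-/
theorem omega_sq (hμα : IsSqrtBranch α μα) (hμβ : IsSqrtBranch β μβ) (hμδ : IsSqrtBranch δ μδ)
    (k : ℂ) : omega μα μβ μδ k ^ 2 =
      k ^ 2 * (1 + α * k ^ 2) / ((1 + β * k ^ 2) * (1 + δ * k ^ 2)) := by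
  rw [← hμα k, ← hμβ k, ← hμδ k, omega]
  ring

theorem differentiableOn_div_regular {p : ℂ → ℂ} (hp : Differentiable ℂ p) :
    DifferentiableOn ℂ (fun k => p k / (1 + β * k ^ 2)) (regularSet β δ) ∧
    DifferentiableOn ℂ (fun k => p k / (1 + δ * k ^ 2)) (regularSet β δ) ∧
    DifferentiableOn ℂ (fun k => p k / ((1 + β * k ^ 2) * (1 + δ * k ^ 2))) (regularSet β δ) :=
  ⟨hp.differentiableOn.div (Differentiable.differentiableOn (by fun_prop)) fun _ hk => hk.1,
    hp.differentiableOn.div (Differentiable.differentiableOn (by fun_prop)) fun _ hk => hk.2,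
    hp.differentiableOn.div (Differentiable.differentiableOn (by fun_prop))
      fun _ hk => mul_ne_zero hk.1 hk.2⟩

theorem differentiableOn_freq_sq : DifferentiableOn ℂ
    (fun k : ℂ => k ^ 2 * (1 + α * k ^ 2) / ((1 + β * k ^ 2) * (1 + δ * k ^ 2)))
    (regularSet β δ) :=
  (differentiableOn_div_regular (by fun_prop)).2.2

theorem holomorphicOff_expSum (hμα : IsSqrtBranch α μα) (hμβ : IsSqrtBranch β μβ)
    (hμδ : IsSqrtBranch δ μδ) (t : ℝ) (Z : Set ℂ) :
    HolomorphicOff (regularSet β δ) Z fun k => expSum (omega μα μβ μδ k) t := by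
  simp only [expSum_eq_cosSqrt, omega_sq hμα hμβ hμδ]
  exact .of_differentiableOn ((differentiable_cosSqrt.comp_differentiableOn
    (differentiableOn_freq_sq.mul_const _)).const_mul _)

theorem holomorphicOff_Bplus (hμα : IsSqrtBranch α μα) (hμβ : IsSqrtBranch β μβ)
    (hμδ : IsSqrtBranch δ μδ) {f : ℝ → ℝ} {t : ℝ} (hf : IntervalIntegrable f volume 0 t)
    (Z : Set ℂ) :
    HolomorphicOff (regularSet β δ) Z fun k => Bplus f (omega μα μβ μδ k) t := by
  simp only [Bplus_eq_integral hf, omega_sq hμα hμβ hμδ]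
  have h := differentiable_integral_comp_mul differentiable_cosSqrt
    (φ := fun τ => (((t - τ) ^ 2 : ℝ) : ℂ)) (f := fun τ => (f τ : ℂ)) (by fun_prop)
    (⟨hf.1.ofReal, hf.2.ofReal⟩ : IntervalIntegrable (fun τ => (f τ : ℂ)) volume 0 t)
  exact .of_differentiableOn ((h.comp_differentiableOn differentiableOn_freq_sq).const_mul _)

/-- Since `s` is `ω` times a holomorphic function of `ω²`, it suffices that the prefactor times `ω`
be holomorphic. The product is only required off `Z`, where the roots can be cancelled. -/
theorem holomorphicOff_mul_expDiff (hμα : IsSqrtBranch α μα) (hμβ : IsSqrtBranch β μβ)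
    (hμδ : IsSqrtBranch δ μδ) (t : ℝ) {Z : Set ℂ} {c d : ℂ → ℂ}
    (hd : DifferentiableOn ℂ d (regularSet β δ)) (hcd : ∀ k ∉ Z, c k * omega μα μβ μδ k = d k) :
    HolomorphicOff (regularSet β δ) Z fun k => c k * expDiff (omega μα μβ μδ k) t := by
  refine (HolomorphicOff.of_differentiableOn (hd.mul
    ((differentiable_sinSqrt.comp_differentiableOn
      ((differentiableOn_freq_sq (α := α)).mul_const ((t : ℂ) ^ 2))).const_mul
        (2 * Complex.I * t)))).congr fun k hk => ?_
  rw [expDiff_eq_sinSqrt, ← mul_assoc, hcd k hk, omega_sq hμα hμβ hμδ]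
  rfl

theorem holomorphicOff_mul_Bminus (hμα : IsSqrtBranch α μα) (hμβ : IsSqrtBranch β μβ)
    (hμδ : IsSqrtBranch δ μδ) {f : ℝ → ℝ} {t : ℝ} (hf : IntervalIntegrable f volume 0 t)
    {Z : Set ℂ} {c d : ℂ → ℂ} (hd : DifferentiableOn ℂ d (regularSet β δ))
    (hcd : ∀ k ∉ Z, c k * omega μα μβ μδ k = d k) :
    HolomorphicOff (regularSet β δ) Z fun k => c k * Bminus f (omega μα μβ μδ k) t := by
  have hf' : IntervalIntegrable (fun τ => (t - τ) * f τ) volume 0 t :=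
    hf.continuousOn_mul (Continuous.continuousOn (by fun_prop))
  have h := differentiable_integral_comp_mul differentiable_sinSqrt
    (φ := fun τ => (((t - τ) ^ 2 : ℝ) : ℂ)) (f := fun τ => (((t - τ) * f τ : ℝ) : ℂ))
    (by fun_prop) (⟨hf'.1.ofReal, hf'.2.ofReal⟩ :
      IntervalIntegrable (fun τ => (((t - τ) * f τ : ℝ) : ℂ)) volume 0 t)
  refine (HolomorphicOff.of_differentiableOn (hd.mul
    ((h.comp_differentiableOn (differentiableOn_freq_sq (α := α))).const_mul (2 * Complex.I)))).congr
      fun k hk => ?_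
  rw [Bminus_eq_integral hf, ← mul_assoc, hcd k hk, omega_sq hμα hμβ hμδ]
  rfl

theorem holomorphicOff_etaBdry (hμα : IsSqrtBranch α μα) (hμβ : IsSqrtBranch β μβ)
    (hμδ : IsSqrtBranch δ μδ) {f₀ f₂ : ℝ → ℝ} {t : ℝ} (h₀ : IntervalIntegrable f₀ volume 0 t)
    (h₀' : IntervalIntegrable (deriv f₀) volume 0 t)
    (h₀'' : IntervalIntegrable (deriv (deriv f₀)) volume 0 t)
    (h₂ : IntervalIntegrable f₂ volume 0 t)
    (h₂'' : IntervalIntegrable (deriv (deriv f₂)) volume 0 t) :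
    HolomorphicOff (regularSet β δ) (branchSet α β δ) (etaBdry α β δ μα μβ μδ f₀ f₂ t) := by
  refine .sub (.sub (.add (.add (.mul ?_ ?_) (.mul ?_ ?_)) (.mul ?_ ?_)) (.mul ?_ ?_)) ?_
  · exact .of_differentiableOn (differentiableOn_div_regular (by fun_prop)).1.neg
  · exact holomorphicOff_Bplus hμα hμβ hμδ h₀ _
  · exact .of_differentiableOn (differentiableOn_div_regular (by fun_prop)).1
  · exact holomorphicOff_Bplus hμα hμβ hμδ h₂ _
  · exact .of_differentiableOn (differentiableOn_div_regular (by fun_prop)).1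
  · exact holomorphicOff_Bplus hμα hμβ hμδ h₂'' _
  · exact .of_differentiableOn (differentiableOn_div_regular (by fun_prop)).1
  · exact holomorphicOff_Bplus hμα hμβ hμδ h₀'' _
  · refine holomorphicOff_mul_Bminus hμα hμβ hμδ h₀'
      (d := fun k => Complex.I * δ * (k ^ 2 * (1 + α * k ^ 2)) /
        ((1 + β * k ^ 2) * (1 + δ * k ^ 2)))
      (differentiableOn_div_regular (by fun_prop)).2.2 fun k hk => ?_
    obtain ⟨ha, hb, hd⟩ := sqrtBranch_ne_zero hμα hμβ hμδ hk
    rw [← hμα k, ← hμβ k, ← hμδ k, omega]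
    field_simp

theorem holomorphicOff_uBdry (hμα : IsSqrtBranch α μα) (hμβ : IsSqrtBranch β μβ)
    (hμδ : IsSqrtBranch δ μδ) {f₀ f₂ : ℝ → ℝ} {t : ℝ} (h₀ : IntervalIntegrable f₀ volume 0 t)
    (h₀' : IntervalIntegrable (deriv f₀) volume 0 t)
    (h₀'' : IntervalIntegrable (deriv (deriv f₀)) volume 0 t)
    (h₂ : IntervalIntegrable f₂ volume 0 t)
    (h₂'' : IntervalIntegrable (deriv (deriv f₂)) volume 0 t) :
    HolomorphicOff (regularSet β δ) (branchSet α β δ) (uBdry α β δ μα μβ μδ f₀ f₂ t) := by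
  have hc : ∀ c : ℂ, ∀ k ∉ branchSet α β δ,
      c / (μα k * μδ k * μβ k) * omega μα μβ μδ k =
        c * k / ((1 + β * k ^ 2) * (1 + δ * k ^ 2)) := by
    intro c k hk
    obtain ⟨ha, hb, hd⟩ := sqrtBranch_ne_zero hμα hμβ hμδ hk
    rw [← hμβ k, ← hμδ k, omega]
    field_simp
  refine .sub (.sub (.add (.add ?_ (.mul ?_ ?_)) ?_) ?_) ?_
  · refine holomorphicOff_mul_Bminus hμα hμβ hμδ h₀
      (d := fun k => k * (1 + α * k ^ 2) / ((1 + β * k ^ 2) * (1 + δ * k ^ 2)))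
      (differentiableOn_div_regular (by fun_prop)).2.2 fun k hk => ?_
    obtain ⟨ha, hb, hd⟩ := sqrtBranch_ne_zero hμα hμβ hμδ hk
    rw [← hμα k, ← hμβ k, ← hμδ k, omega]
    field_simp
  · exact .of_differentiableOn (differentiableOn_div_regular (by fun_prop)).2.1
  · exact holomorphicOff_Bplus hμα hμβ hμδ h₀' _
  · exact holomorphicOff_mul_Bminus hμα hμβ hμδ h₀''
      (differentiableOn_div_regular (by fun_prop)).2.2 (hc β)
  · exact holomorphicOff_mul_Bminus hμα hμβ hμδ h₂
      (differentiableOn_div_regular (by fun_prop)).2.2 (hc α)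
  · exact holomorphicOff_mul_Bminus hμα hμβ hμδ h₂''
      (differentiableOn_div_regular (by fun_prop)).2.2 (hc (β * δ))

theorem holomorphicOff_etaFactor (hμα : IsSqrtBranch α μα) (hμβ : IsSqrtBranch β μβ)
    (hμδ : IsSqrtBranch δ μδ) (t : ℝ) :
    HolomorphicOff (regularSet β δ) (branchSet α β δ)
      fun k => μα k * μδ k / μβ k * expDiff (omega μα μβ μδ k) t := by
  refine holomorphicOff_mul_expDiff hμα hμβ hμδ t
    (d := fun k => k * (1 + α * k ^ 2) / (1 + β * k ^ 2))
    (differentiableOn_div_regular (by fun_prop)).1 fun k hk => ?_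
  obtain ⟨ha, hb, hd⟩ := sqrtBranch_ne_zero hμα hμβ hμδ hk
  rw [← hμα k, ← hμβ k, omega]
  field_simp

theorem holomorphicOff_uFactor (hμα : IsSqrtBranch α μα) (hμβ : IsSqrtBranch β μβ)
    (hμδ : IsSqrtBranch δ μδ) (t : ℝ) :
    HolomorphicOff (regularSet β δ) (branchSet α β δ)
      fun k => -(μβ k / (μα k * μδ k)) * expDiff (omega μα μβ μδ k) t := by
  refine holomorphicOff_mul_expDiff hμα hμβ hμδ t
    (d := fun k => -k / (1 + δ * k ^ 2))
    (differentiableOn_div_regular (by fun_prop)).2.1 fun k hk => ?_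
  obtain ⟨ha, hb, hd⟩ := sqrtBranch_ne_zero hμα hμβ hμδ hk
  rw [← hμδ k, omega]
  field_simp

theorem holomorphicOff_fhat {U Z : Set ℂ} {L : ℝ} {f : ℝ → ℝ}
    (hf : IntervalIntegrable f volume (-L) L) :
    HolomorphicOff U Z (fun k => fhat L f k) ∧ HolomorphicOff U Z (fun k => fhat L f (-k)) :=
  ⟨.of_differentiableOn (differentiable_fhat hf).differentiableOn,
    .of_differentiableOn ((differentiable_fhat hf).comp differentiable_neg).differentiableOn⟩

end data

/-! ### Boundary traces -/

section traces

variable {L T t k : ℝ} {f : ℝ → ℝ → ℝ} {g h : ℝ → ℝ} {ω : ℂ}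

/-- The datum `g` is arbitrary outside `(0, T)`, but each interior time has a neighbourhood on which
it equals the trace. -/
theorem dt_eq_deriv_of_trace
    (hf : DifferentiableOn ℝ (fun p : ℝ × ℝ => f p.1 p.2) (Icc (-L) L ×ˢ Ico 0 T))
    {x : ℝ} (hx : x ∈ Icc (-L) L) (hg : ∀ t ∈ Ioo 0 T, f x t = g t) :
    ∀ t ∈ Ioo 0 T, dt f x t = deriv g t := by
  intro t ht
  refine ((hasDerivAt_dt hf hx ht).congr_of_eventuallyEq ?_).deriv.symm
  filter_upwards [Ioo_mem_nhds ht.1 ht.2] with s hs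
  exact (hg s hs).symm

theorem intervalIntegrable_of_trace
    (hf : ContinuousOn (fun p : ℝ × ℝ => f p.1 p.2) (Icc (-L) L ×ˢ Ico 0 T))
    {x : ℝ} (hx : x ∈ Icc (-L) L) (hg : ∀ t ∈ Ioo 0 T, f x t = g t) (ht : t ∈ Ioo 0 T) :
    IntervalIntegrable g volume 0 t := by
  have h1 : IntervalIntegrable (fun s => f x s) volume 0 t := by
    refine ContinuousOn.intervalIntegrable ?_
    rw [uIcc_of_le ht.1.le]
    exact (continuousOn_slice_snd hf hx).mono fun s hs => ⟨hs.1, hs.2.trans_lt ht.2⟩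
  refine h1.congr_uIoo fun s hs => ?_
  rw [uIoo_of_le ht.1.le] at hs
  exact hg s ⟨hs.1, hs.2.trans ht.2⟩

theorem bdryDiff_eqOn (hh : ∀ t ∈ Ioo 0 T, f L t = h t) (hg : ∀ t ∈ Ioo 0 T, f (-L) t = g t)
    (ht : t ∈ Ioo 0 T) : EqOn (bdryDiff L k f)
      (fun s => Real.cos (k * (2 * L)) * h s + -1 * g s) (Ioo 0 t) := fun s hs => by
  have hs' : s ∈ Ioo 0 T := ⟨hs.1, hs.2.trans ht.2⟩
  simp only [bdryDiff, hh s hs', hg s hs']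
  ring

theorem Bplus_bdryDiff (hL : 0 < L)
    (hf : ContinuousOn (fun p : ℝ × ℝ => f p.1 p.2) (Icc (-L) L ×ˢ Ico 0 T))
    (hh : ∀ t ∈ Ioo 0 T, f L t = h t) (hg : ∀ t ∈ Ioo 0 T, f (-L) t = g t) (ht : t ∈ Ioo 0 T) :
    Bplus (bdryDiff L k f) ω t = Real.cos (k * (2 * L)) * Bplus h ω t - Bplus g ω t := by
  rw [Bplus_congr ht.1.le (bdryDiff_eqOn hh hg ht), Bplus_add, Bplus_const_mul, Bplus_const_mul]
  · push_cast; ring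
  · exact (intervalIntegrable_of_trace hf ⟨by linarith, le_rfl⟩ hh ht).const_mul _
  · exact (intervalIntegrable_of_trace hf ⟨le_rfl, by linarith⟩ hg ht).const_mul _

theorem Bminus_bdryDiff (hL : 0 < L)
    (hf : ContinuousOn (fun p : ℝ × ℝ => f p.1 p.2) (Icc (-L) L ×ˢ Ico 0 T))
    (hh : ∀ t ∈ Ioo 0 T, f L t = h t) (hg : ∀ t ∈ Ioo 0 T, f (-L) t = g t) (ht : t ∈ Ioo 0 T) :
    Bminus (bdryDiff L k f) ω t = Real.cos (k * (2 * L)) * Bminus h ω t - Bminus g ω t := by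
  rw [Bminus_congr ht.1.le (bdryDiff_eqOn hh hg ht), Bminus_add, Bminus_const_mul,
    Bminus_const_mul]
  · push_cast; ring
  · exact (intervalIntegrable_of_trace hf ⟨by linarith, le_rfl⟩ hh ht).const_mul _
  · exact (intervalIntegrable_of_trace hf ⟨le_rfl, by linarith⟩ hg ht).const_mul _

theorem intervalIntegrable_bdryDiff (hL : 0 < L) (k : ℝ)
    (hf : ContinuousOn (fun p : ℝ × ℝ => f p.1 p.2) (Icc (-L) L ×ˢ Ico 0 T)) (ht : t ∈ Ioo 0 T) :
    IntervalIntegrable (bdryDiff L k f) volume 0 t := by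
  refine ContinuousOn.intervalIntegrable ?_
  rw [uIcc_of_le ht.1.le]
  exact (continuousOn_bdryDiff hL k hf).mono fun s hs => ⟨hs.1, hs.2.trans_lt ht.2⟩

end traces

/-! ### The modes in terms of the data -/

/-- The mode equations divided by `1+βk²` and `1+δk²` form an oscillator. With `m = μα μδ / μβ` its
two coupling constants are `mω = k(1+αk²)/(1+βk²)` and `ω/m = k/(1+δk²)`; the boundary terms are the
forcing. Linearity of `B^±` then separates the contributions of the two endpoints. -/
theorem modes_eq {α β δ L T k : ℝ} (hα : 0 < α) (hβ : 0 ≤ β) (hδ : 0 < δ) (hL : 0 < L)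
    {μα μβ μδ : ℂ → ℂ} (hμα : IsSqrtBranch α μα) (hμβ : IsSqrtBranch β μβ)
    (hμδ : IsSqrtBranch δ μδ) {η u : ℝ → ℝ → ℝ} {g₀ h₀ g₂ h₂ : ℝ → ℝ}
    (hη : ContDiffOn ℝ 3 (fun p : ℝ × ℝ => η p.1 p.2) (Icc (-L) L ×ˢ Ico 0 T))
    (hu : ContDiffOn ℝ 4 (fun p : ℝ × ℝ => u p.1 p.2) (Icc (-L) L ×ˢ Ico 0 T))
    (hsys : SolvesSystem α β δ L T η u)
    (hg₀ : ∀ t ∈ Ioo 0 T, u (-L) t = g₀ t) (hh₀ : ∀ t ∈ Ioo 0 T, u L t = h₀ t)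
    (hg₂ : ∀ t ∈ Ioo 0 T, dx L (dx L u) (-L) t = g₂ t)
    (hh₂ : ∀ t ∈ Ioo 0 T, dx L (dx L u) L t = h₂ t) (hk : Real.sin (k * (2 * L)) = 0)
    {t : ℝ} (ht : t ∈ Ioo 0 T) :
    (2 * cosMode L k η t : ℂ) = expSum (omega μα μβ μδ k) t * cosMode L k η 0 +
      Complex.I * (μα k * μδ k / μβ k) * expDiff (omega μα μβ μδ k) t * sinMode L k u 0 +
      (Real.cos (k * (2 * L)) * etaBdry α β δ μα μβ μδ h₀ h₂ t k -
        etaBdry α β δ μα μβ μδ g₀ g₂ t k) ∧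
    (2 * sinMode L k u t : ℂ) = expSum (omega μα μβ μδ k) t * sinMode L k u 0 -
      Complex.I / (μα k * μδ k / μβ k) * expDiff (omega μα μβ μδ k) t * cosMode L k η 0 +
      Complex.I * (Real.cos (k * (2 * L)) * uBdry α β δ μα μβ μδ h₀ h₂ t k -
        uBdry α β δ μα μβ μδ g₀ g₂ t k) := by
  have hLm : L ∈ Icc (-L) L := ⟨by linarith, le_rfl⟩
  have hLm' : -L ∈ Icc (-L) L := ⟨le_rfl, by linarith⟩
  have hq : ContDiffOn ℝ 2 (fun p : ℝ × ℝ => dx L (dx L u) p.1 p.2) (Icc (-L) L ×ˢ Ico 0 T) :=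
    contDiffOn_dx hL (contDiffOn_dx hL hu (m := 3) (by norm_num)) (by norm_num)
  have hut : ContDiffOn ℝ 3 (fun p : ℝ × ℝ => dt u p.1 p.2) (Icc (-L) L ×ˢ Ico 0 T) :=
    contDiffOn_dt hL hu (by norm_num)
  have hutt : ContDiffOn ℝ 2 (fun p : ℝ × ℝ => dt (dt u) p.1 p.2) (Icc (-L) L ×ˢ Ico 0 T) :=
    contDiffOn_dt hL hut (by norm_num)
  have hqt : ContDiffOn ℝ 1 (fun p : ℝ × ℝ => dt (dx L (dx L u)) p.1 p.2)
      (Icc (-L) L ×ˢ Ico 0 T) := contDiffOn_dt hL hq (by norm_num)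
  have hqtt : ContDiffOn ℝ 0 (fun p : ℝ × ℝ => dt (dt (dx L (dx L u))) p.1 p.2)
      (Icc (-L) L ×ˢ Ico 0 T) := contDiffOn_dt hL hqt (by norm_num)
  have dut : ∀ {x : ℝ} {g : ℝ → ℝ}, x ∈ Icc (-L) L → (∀ t ∈ Ioo 0 T, u x t = g t) →
      ∀ t ∈ Ioo 0 T, dt u x t = deriv g t := fun hx hg =>
    dt_eq_deriv_of_trace (hu.differentiableOn (by norm_num)) hx hg
  have dutt : ∀ {x : ℝ} {g : ℝ → ℝ}, x ∈ Icc (-L) L → (∀ t ∈ Ioo 0 T, u x t = g t) →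
      ∀ t ∈ Ioo 0 T, dt (dt u) x t = deriv (deriv g) t := fun hx hg =>
    dt_eq_deriv_of_trace (hut.differentiableOn (by norm_num)) hx (dut hx hg)
  have dqtt : ∀ {x : ℝ} {g : ℝ → ℝ}, x ∈ Icc (-L) L →
      (∀ t ∈ Ioo 0 T, dx L (dx L u) x t = g t) →
      ∀ t ∈ Ioo 0 T, dt (dt (dx L (dx L u))) x t = deriv (deriv g) t := fun hx hg =>
    dt_eq_deriv_of_trace (hqt.differentiableOn (by norm_num)) hx
      (dt_eq_deriv_of_trace (hq.differentiableOn (by norm_num)) hx hg)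
  have hA := one_add_mul_sq_ne_zero_of_real hα.le k
  have hB := one_add_mul_sq_ne_zero_of_real hβ k
  have hD := one_add_mul_sq_ne_zero_of_real hδ.le k
  have hBr : (1 + β * k ^ 2 : ℝ) ≠ 0 := by exact_mod_cast hB
  have hDr : (1 + δ * k ^ 2 : ℝ) ≠ 0 := by exact_mod_cast hD
  obtain ⟨ha, hb, hd⟩ := sqrtBranch_ne_zero hμα hμβ hμδ
    (k := (k : ℂ)) (fun h => by rcases h with h | h | h <;> contradiction)
  have hm : μα k * μδ k / μβ k ≠ 0 := div_ne_zero (mul_ne_zero ha hd) hb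
  have cb := fun {f : ℝ → ℝ → ℝ} => continuousOn_bdryDiff (f := f) (T := T) hL k
  have ib := fun {f : ℝ → ℝ → ℝ}
    (hf : ContinuousOn (fun p : ℝ × ℝ => f p.1 p.2) (Icc (-L) L ×ˢ Ico 0 T)) =>
    intervalIntegrable_bdryDiff hL k hf ht
  -- `P` and `Q` are the boundary parts of `cosMode_ode` and `sinMode_ode` after division by the
  -- coefficients of the time derivatives.
  set P : ℝ → ℝ := fun s => (1 + α * k ^ 2) / (1 + β * k ^ 2) * bdryDiff L k u s +
    -(α / (1 + β * k ^ 2)) * bdryDiff L k (dx L (dx L u)) s +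
    -(β * δ / (1 + β * k ^ 2)) * bdryDiff L k (dt (dt (dx L (dx L u)))) s +
    β / (1 + β * k ^ 2) * bdryDiff L k (dt (dt u)) s with hP
  set Q : ℝ → ℝ := fun s => δ * k / (1 + δ * k ^ 2) * bdryDiff L k (dt u) s with hQ
  obtain ⟨s1, s2⟩ := oscillator_solution (C := cosMode L k η) (S := sinMode L k u) (P := P)
    (Q := Q) (ω := omega μα μβ μδ k) hm
    (continuousOn_integral_mul hL hη.continuousOn (by fun_prop))
    (continuousOn_integral_mul hL hu.continuousOn (by fun_prop))
    ((((cb hu.continuousOn).const_mul _).add ((cb hq.continuousOn).const_mul _)).add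
      ((cb hqtt.continuousOn).const_mul _) |>.add ((cb hutt.continuousOn).const_mul _))
    ((cb hut.continuousOn).const_mul _)
    (fun s hs => ⟨_, hasDerivAt_cosMode hL k (hη.of_le (by norm_num)) hs, by
      have h1 := cosMode_ode hL hk hη hu hsys hs
      have h2 : μα k * μδ k / μβ k * omega μα μβ μδ k =
          k * (1 + α * k ^ 2) / (1 + β * k ^ 2) := by
        rw [← hμα k, ← hμβ k, omega]
        field_simp
      rw [h2]
      have h3 : cosMode L k (dt η) s =
          -(k * (1 + α * k ^ 2) / (1 + β * k ^ 2)) * sinMode L k u s - P s := by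
        simp only [hP]
        field_simp
        linear_combination h1
      rw [h3]
      push_cast
      ring⟩)
    (fun s hs => ⟨_, hasDerivAt_sinMode hL k (hu.of_le (by norm_num)) hs, by
      have h1 := sinMode_ode hL hk hη hu hsys hs
      have h2 : omega μα μβ μδ k / (μα k * μδ k / μβ k) = k / (1 + δ * k ^ 2) := by
        rw [← hμδ k, omega]
        field_simp
      rw [h2]
      have h3 : sinMode L k (dt u) s = k / (1 + δ * k ^ 2) * cosMode L k η s - Q s := by
        simp only [hQ]
        field_simp
        linear_combination h1
      rw [h3]
      push_cast
      ring⟩) ht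
  have b0 := (ib hu.continuousOn).const_mul ((1 + α * k ^ 2) / (1 + β * k ^ 2))
  have b2 := (ib hq.continuousOn).const_mul (-(α / (1 + β * k ^ 2)))
  have b2' := (ib hqtt.continuousOn).const_mul (-(β * δ / (1 + β * k ^ 2)))
  have b0' := (ib hutt.continuousOn).const_mul (β / (1 + β * k ^ 2))
  rw [hP, Bplus_add ((b0.add b2).add b2') b0', Bplus_add (b0.add b2) b2', Bplus_add b0 b2,
    Bplus_const_mul, Bplus_const_mul, Bplus_const_mul, Bplus_const_mul,
    Bplus_bdryDiff hL hu.continuousOn hh₀ hg₀ ht, Bplus_bdryDiff hL hq.continuousOn hh₂ hg₂ ht,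
    Bplus_bdryDiff hL hqtt.continuousOn (dqtt hLm hh₂) (dqtt hLm' hg₂) ht,
    Bplus_bdryDiff hL hutt.continuousOn (dutt hLm hh₀) (dutt hLm' hg₀) ht,
    hQ, Bminus_const_mul, Bminus_bdryDiff hL hut.continuousOn (dut hLm hh₀) (dut hLm' hg₀) ht] at s1
  rw [hP, Bminus_add ((b0.add b2).add b2') b0', Bminus_add (b0.add b2) b2', Bminus_add b0 b2,
    Bminus_const_mul, Bminus_const_mul, Bminus_const_mul, Bminus_const_mul,
    Bminus_bdryDiff hL hu.continuousOn hh₀ hg₀ ht, Bminus_bdryDiff hL hq.continuousOn hh₂ hg₂ ht,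
    Bminus_bdryDiff hL hqtt.continuousOn (dqtt hLm hh₂) (dqtt hLm' hg₂) ht,
    Bminus_bdryDiff hL hutt.continuousOn (dutt hLm hh₀) (dutt hLm' hg₀) ht,
    hQ, Bplus_const_mul, Bplus_bdryDiff hL hut.continuousOn (dut hLm hh₀) (dut hLm' hg₀) ht] at s2
  set σ : ℂ := ((Real.cos (k * (2 * L)) : ℝ) : ℂ)
  constructor
  · rw [s1]
    have hc : μα k * μδ k / μβ k * (δ * k / (1 + δ * k ^ 2)) =
        δ * k * μα k / (μδ k * μβ k) := by
      rw [← hμδ k]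
      field_simp
    simp only [etaBdry]
    push_cast
    linear_combination -Complex.I * (σ * Bminus (deriv h₀) (omega μα μβ μδ k) t -
      Bminus (deriv g₀) (omega μα μβ μδ k) t) * hc
  · rw [s2]
    have hc0 : 1 / (μα k * μδ k / μβ k) * ((1 + α * k ^ 2) / (1 + β * k ^ 2)) =
        μα k / (μδ k * μβ k) := by
      rw [← hμα k, ← hμβ k]
      field_simp
    have hc : 1 / (μα k * μδ k / μβ k) * (1 / (1 + β * k ^ 2)) =
        1 / (μα k * μδ k * μβ k) := by
      rw [← hμβ k]
      field_simp
    simp only [uBdry]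
    push_cast
    linear_combination Complex.I * (σ * Bminus h₀ (omega μα μβ μδ k) t -
        Bminus g₀ (omega μα μβ μδ k) t) * hc0 +
      Complex.I * (β * (σ * Bminus (deriv (deriv h₀)) (omega μα μβ μδ k) t -
        Bminus (deriv (deriv g₀)) (omega μα μβ μδ k) t) -
        α * (σ * Bminus h₂ (omega μα μβ μδ k) t - Bminus g₂ (omega μα μβ μδ k) t) -
        β * δ * (σ * Bminus (deriv (deriv h₂)) (omega μα μβ μδ k) t -
        Bminus (deriv (deriv g₂)) (omega μα μβ μδ k) t)) * hc

/-! ### Summation of the contour integrals -/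

/-- The clause on separate convergence follows from the joint limit by uniqueness of limits. -/
theorem eqContourSum_of_tendsto {v : ℝ} {I : ℕ → Fin 7 → ℂ}
    (h : Tendsto (fun N => ∑ j, I N j) atTop (𝓝 (2 * Real.pi * v))) : EqContourSum v I := by
  have hpi : (Real.pi : ℂ) ≠ 0 := Complex.ofReal_ne_zero.mpr Real.pi_ne_zero
  have h1 : Tendsto (fun N => 1 / (2 * Real.pi) * ∑ j, I N j) atTop (𝓝 (v : ℂ)) := by
    have := h.const_mul (1 / (2 * Real.pi : ℂ))
    rwa [← mul_assoc, one_div_mul_cancel (mul_ne_zero two_ne_zero hpi), one_mul] at this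
  exact ⟨h1, fun J hJ => tendsto_nhds_unique h1
    ((tendsto_finsetSum _ fun j _ => hJ j).const_mul _)⟩

theorem sin_kn {L : ℝ} (hL : L ≠ 0) (n : ℤ) : Real.sin (kn L n * (2 * L)) = 0 := by
  rw [show kn L n * (2 * L) = n * Real.pi by simp only [kn]; field_simp]
  exact Real.sin_int_mul_pi n

/-- Since `2 k_n L = nπ`, the sine part vanishes. This matches the factor of `H` in the residue with
the weight of the right endpoint in `bdryDiff`. -/
theorem exp_neg_two_kn {L : ℝ} (hL : L ≠ 0) (n : ℤ) :
    Complex.exp (-(2 * Complex.I * kn L n * L)) = (Real.cos (kn L n * (2 * L)) : ℝ) := by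
  rw [show -(2 * Complex.I * kn L n * L) = ((-(kn L n * (2 * L)) : ℝ) : ℂ) * Complex.I by
    push_cast; ring, Complex.exp_mul_I, ← Complex.ofReal_cos, ← Complex.ofReal_sin, Real.cos_neg,
    Real.sin_neg, sin_kn hL]
  simp

/-- `sum_contours_eq_residues` for data that agree with holomorphic functions off a countable set;
the residues are evaluated in terms of the data themselves. -/
theorem sum_contours_eq_of_holomorphicOff {L r R : ℝ} {U Z : Set ℂ} (hL : 0 < L) (hr : 0 < r)
    (hrR : r < R) (hRL : R ≤ Real.pi / (4 * L)) (hball : ∀ n, ball (kn L n : ℂ) R ⊆ U)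
    (hreal : ∀ k : ℝ, (k : ℂ) ∈ U) (hZ : Z.Countable) (hZreal : ∀ k : ℝ, (k : ℂ) ∉ Z)
    {X Y H G : ℂ → ℂ} (hX : HolomorphicOff U Z X) (hY : HolomorphicOff U Z Y)
    (hH : HolomorphicOff U Z H) (hG : HolomorphicOff U Z G) {c : ℤ → ℂ}
    (hc : ∀ n, (Complex.exp (-(Complex.I * kn L n * L)) * X (kn L n) +
      Complex.exp (Complex.I * kn L n * L) * Y (kn L n)) / 2 +
      Complex.exp (-(2 * Complex.I * kn L n * L)) * H (kn L n) - G (kn L n) = c n)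
    (x : ℝ) (N : ℕ) :
    lineInt L N (fun k => Complex.exp (Complex.I * k * x) * (1 / 2) * X k) +
    lowerInt L r N (fun k => Complex.exp (Complex.I * k * (x - L)) /
      (2 * (1 - Complex.exp (-(4 * Complex.I * k * L)))) *
        (Complex.exp (-(3 * Complex.I * k * L)) * X k +
          Complex.exp (-(Complex.I * k * L)) * Y k)) +
    upperInt L r N (fun k => Complex.exp (Complex.I * k * (x + L)) /
      (2 * (1 - Complex.exp (4 * Complex.I * k * L))) *
        (Complex.exp (3 * Complex.I * k * L) * X k + Complex.exp (Complex.I * k * L) * Y k)) +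
    lowerInt L r N (fun k => Complex.exp (Complex.I * k * (x - L)) /
      (1 - Complex.exp (-(4 * Complex.I * k * L))) * H k) +
    upperInt L r N (fun k => Complex.exp (Complex.I * k * (x + L)) /
      (1 - Complex.exp (4 * Complex.I * k * L)) * -G k) +
    lowerInt L r N (fun k => Complex.exp (Complex.I * k * (x + L)) /
      (1 - Complex.exp (4 * Complex.I * k * L)) * G k) +
    upperInt L r N (fun k => Complex.exp (Complex.I * k * (x - L)) /
      (1 - Complex.exp (-(4 * Complex.I * k * L))) * -H k) =
    (Real.pi / (2 * L) : ℂ) * ∑ n ∈ Finset.Icc (-(N : ℤ)) (N : ℤ),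
      Complex.exp (Complex.I * kn L n * (x + L)) * c n := by
  obtain ⟨X', hX', eX⟩ := hX
  obtain ⟨Y', hY', eY⟩ := hY
  obtain ⟨H', hH', eH⟩ := hH
  obtain ⟨G', hG', eG⟩ := hG
  have h := sum_contours_eq_residues hL hr hrR hRL hball hreal hX' hY' hH' hG' x N
  have hsum : ∀ n : ℤ, (Real.pi / (2 * L) : ℂ) *
      (Complex.exp (Complex.I * kn L n * (x + L)) *
        ((Complex.exp (-(Complex.I * kn L n * L)) * X' (kn L n) +
          Complex.exp (Complex.I * kn L n * L) * Y' (kn L n)) / 2 +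
          Complex.exp (-(2 * Complex.I * kn L n * L)) * H' (kn L n) - G' (kn L n))) =
      (Real.pi / (2 * L) : ℂ) * (Complex.exp (Complex.I * kn L n * (x + L)) * c n) := by
    intro n
    have hn := hZreal (kn L n)
    -- The centres are real, hence outside `Z`, so the holomorphic representatives take the values
    -- of the original data there.
    rw [← hc n, eX _ hn, eY _ hn, eH _ hn, eG _ hn]
  rw [Finset.mul_sum]
  rw [Finset.sum_congr rfl fun n _ => hsum n] at h
  rw [← h]
  congr 1
  · congr 1
    · congr 1
      · congr 1
        · congr 1
          · congr 1
            · exact lineInt_congr L N hZ fun k hk => by rw [eX k hk]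
            · exact lowerInt_congr L hr.ne' N hZ fun k hk => by rw [eX k hk, eY k hk]
          · exact upperInt_congr L hr.ne' N hZ fun k hk => by rw [eX k hk, eY k hk]
        · exact lowerInt_congr L hr.ne' N hZ fun k hk => by rw [eH k hk]
      · exact upperInt_congr L hr.ne' N hZ fun k hk => by rw [eG k hk]
    · exact lowerInt_congr L hr.ne' N hZ fun k hk => by rw [eG k hk]
  · exact upperInt_congr L hr.ne' N hZ fun k hk => by rw [eH k hk]

theorem sum_fin_seven (a b c d e f g : ℂ) :
    ∑ j, ![a, b, c, d, e, f, g] j = a + b + c + d + e + f + g := by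
  simp [Fin.sum_univ_seven]

/-- The conditions on `r` are strict. The slack gives an open disc of holomorphy strictly larger
than the disc bounded by the arcs. -/
theorem exists_larger_radius {β δ L r : ℝ} (hrL : r < Real.pi / (4 * L))
    (hrδ : r * Real.sqrt δ < 1) (hrβ : r * Real.sqrt β < 1) :
    ∃ R, r < R ∧ R ≤ Real.pi / (4 * L) ∧ R * Real.sqrt β < 1 ∧ R * Real.sqrt δ < 1 := by
  have h1 : ∀ᶠ R in 𝓝[>] r, R < Real.pi / (4 * L) :=
    mem_nhdsWithin_of_mem_nhds (Iio_mem_nhds hrL)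
  have h2 : ∀ a : ℝ, r * Real.sqrt a < 1 → ∀ᶠ R in 𝓝[>] r, R * Real.sqrt a < 1 := fun a ha =>
    nhdsWithin_le_nhds
      ((continuous_id.mul continuous_const).tendsto r |>.eventually (Iio_mem_nhds ha))
  obtain ⟨R, ⟨⟨hR1, hR2⟩, hR3⟩, hR4⟩ :=
    (((h1.and (h2 β hrβ)).and (h2 δ hrδ)).and self_mem_nhdsWithin).exists
  exact ⟨R, hR4, hR1.le, hR2, hR3⟩

end Nwogu

/-! ### Assembly of the two solution formulas. -/

theorem mainTheorem7 (α β δ L T r : ℝ) (hα : 0 < α) (hβ : 0 ≤ β) (hδ : 0 < δ) (hL : 0 < L)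
    (hr : 0 < r) (hrL : r < Real.pi / (4 * L)) (hrδ : r * Real.sqrt δ < 1)
    (hrβ : r * Real.sqrt β < 1)
    (μα μβ μδ : ℂ → ℂ) (hμα : Nwogu.IsSqrtBranch α μα) (hμβ : Nwogu.IsSqrtBranch β μβ)
    (hμδ : Nwogu.IsSqrtBranch δ μδ)
    (η u : ℝ → ℝ → ℝ) (η₀ u₀ g₀ h₀ g₂ h₂ : ℝ → ℝ)
    (hη : ContDiffOn ℝ 3 (fun p : ℝ × ℝ => η p.1 p.2) (Icc (-L) L ×ˢ Ico 0 T))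
    (hu : ContDiffOn ℝ 4 (fun p : ℝ × ℝ => u p.1 p.2) (Icc (-L) L ×ˢ Ico 0 T))
    (hsys : Nwogu.SolvesSystem α β δ L T η u)
    (hη₀ : ∀ x ∈ Ioo (-L) L, η x 0 = η₀ x) (hu₀ : ∀ x ∈ Ioo (-L) L, u x 0 = u₀ x)
    (hg₀ : ∀ t ∈ Ioo 0 T, u (-L) t = g₀ t) (hh₀ : ∀ t ∈ Ioo 0 T, u L t = h₀ t)
    (hg₂ : ∀ t ∈ Ioo 0 T, Nwogu.dx L (Nwogu.dx L u) (-L) t = g₂ t)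
    (hh₂ : ∀ t ∈ Ioo 0 T, Nwogu.dx L (Nwogu.dx L u) L t = h₂ t) :
    ∀ x ∈ Ioo (-L) L, ∀ t ∈ Ioo 0 T,
      Nwogu.EqContourSum (η x t)
        (Nwogu.etaTerms α β δ L r μα μβ μδ η₀ u₀ g₀ h₀ g₂ h₂ x t) ∧
      Nwogu.EqContourSum (u x t)
        (Nwogu.uTerms α β δ L r μα μβ μδ η₀ u₀ g₀ h₀ g₂ h₂ x t) := by
  open Nwogu in
  intro x hx t ht
  have ht' := Ioo_subset_Ico_self ht
  have h0T : (0 : ℝ) ∈ Ico 0 T := ⟨le_rfl, ht.1.trans ht.2⟩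
  obtain ⟨R, hrR, hRL, hRβ, hRδ⟩ := exists_larger_radius hrL hrδ hrβ
  have hball := ball_kn_subset_regularSet hβ hδ.le hRβ hRδ L
  have hreal : ∀ k : ℝ, (k : ℂ) ∈ regularSet β δ := fun k =>
    ⟨one_add_mul_sq_ne_zero_of_real hβ k, one_add_mul_sq_ne_zero_of_real hδ.le k⟩
  have hZreal : ∀ k : ℝ, (k : ℂ) ∉ branchSet α β δ := fun k hk => by
    rcases hk with h | h | h
    · exact one_add_mul_sq_ne_zero_of_real hα.le k h
    · exact one_add_mul_sq_ne_zero_of_real hβ k h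
    · exact one_add_mul_sq_ne_zero_of_real hδ.le k h
  have hLm : L ∈ Icc (-L) L := ⟨by linarith, le_rfl⟩
  have hLm' : -L ∈ Icc (-L) L := ⟨le_rfl, by linarith⟩
  -- integrability of the data
  have hq : ContDiffOn ℝ 2 (fun p : ℝ × ℝ => dx L (dx L u) p.1 p.2) (Icc (-L) L ×ˢ Ico 0 T) :=
    contDiffOn_dx hL (contDiffOn_dx hL hu (m := 3) (by norm_num)) (by norm_num)
  have hut : ContDiffOn ℝ 3 (fun p : ℝ × ℝ => dt u p.1 p.2) (Icc (-L) L ×ˢ Ico 0 T) :=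
    contDiffOn_dt hL hu (by norm_num)
  have hutt : ContDiffOn ℝ 2 (fun p : ℝ × ℝ => dt (dt u) p.1 p.2) (Icc (-L) L ×ˢ Ico 0 T) :=
    contDiffOn_dt hL hut (by norm_num)
  have hqt : ContDiffOn ℝ 1 (fun p : ℝ × ℝ => dt (dx L (dx L u)) p.1 p.2)
      (Icc (-L) L ×ˢ Ico 0 T) := contDiffOn_dt hL hq (by norm_num)
  have hqtt : ContDiffOn ℝ 0 (fun p : ℝ × ℝ => dt (dt (dx L (dx L u))) p.1 p.2)
      (Icc (-L) L ×ˢ Ico 0 T) := contDiffOn_dt hL hqt (by norm_num)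
  have hint : ∀ {y : ℝ} {f₀ f₂ : ℝ → ℝ}, y ∈ Icc (-L) L → (∀ t ∈ Ioo 0 T, u y t = f₀ t) →
      (∀ t ∈ Ioo 0 T, dx L (dx L u) y t = f₂ t) →
      HolomorphicOff (regularSet β δ) (branchSet α β δ) (etaBdry α β δ μα μβ μδ f₀ f₂ t) ∧
      HolomorphicOff (regularSet β δ) (branchSet α β δ) (uBdry α β δ μα μβ μδ f₀ f₂ t) := by
    intro y f₀ f₂ hy hf₀ hf₂
    have e1 := dt_eq_deriv_of_trace (hu.differentiableOn (by norm_num)) hy hf₀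
    have e2 := dt_eq_deriv_of_trace (hut.differentiableOn (by norm_num)) hy e1
    have e3 := dt_eq_deriv_of_trace (hqt.differentiableOn (by norm_num)) hy
      (dt_eq_deriv_of_trace (hq.differentiableOn (by norm_num)) hy hf₂)
    have i0 := intervalIntegrable_of_trace hu.continuousOn hy hf₀ ht
    have i1 := intervalIntegrable_of_trace hut.continuousOn hy e1 ht
    have i2 := intervalIntegrable_of_trace hutt.continuousOn hy e2 ht
    have i3 := intervalIntegrable_of_trace hq.continuousOn hy hf₂ ht
    have i4 := intervalIntegrable_of_trace hqtt.continuousOn hy e3 ht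
    exact ⟨holomorphicOff_etaBdry hμα hμβ hμδ i0 i1 i2 i3 i4,
      holomorphicOff_uBdry hμα hμβ hμδ i0 i1 i2 i3 i4⟩
  obtain ⟨hEh, hUh⟩ := hint hLm hh₀ hh₂
  obtain ⟨hEg, hUg⟩ := hint hLm' hg₀ hg₂
  have hinit : ∀ {f : ℝ → ℝ → ℝ} {f₀ : ℝ → ℝ},
      ContinuousOn (fun p : ℝ × ℝ => f p.1 p.2) (Icc (-L) L ×ˢ Ico 0 T) →
      (∀ x ∈ Ioo (-L) L, f x 0 = f₀ x) → IntervalIntegrable f₀ volume (-L) L := by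
    intro f f₀ hf hf₀
    have h1 : IntervalIntegrable (fun x => f x 0) MeasureTheory.volume (-L) L := by
      refine ContinuousOn.intervalIntegrable ?_
      rw [uIcc_of_le (by linarith)]
      exact continuousOn_slice_fst hf h0T
    refine h1.congr_uIoo fun s hs => ?_
    rw [uIoo_of_le (by linarith)] at hs
    exact hf₀ s hs
  obtain ⟨hη1, hη2⟩ := holomorphicOff_fhat (U := regularSet β δ) (Z := branchSet α β δ)
    (hinit hη.continuousOn hη₀)
  obtain ⟨hu1, hu2⟩ := holomorphicOff_fhat (U := regularSet β δ) (Z := branchSet α β δ)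
    (hinit hu.continuousOn hu₀)
  have hS := holomorphicOff_expSum hμα hμβ hμδ t (branchSet α β δ)
  have hDη := holomorphicOff_etaFactor hμα hμβ hμδ t
  have hDu := holomorphicOff_uFactor hμα hμβ hμδ t
  -- the transforms of the initial data at the centres
  have hfη : ∀ k : ℂ, fhat L η₀ k = fhat L (fun x => η x 0) k := fun k =>
    fhat_congr hL.le (fun x hx => (hη₀ x hx).symm) k
  have hfu : ∀ k : ℂ, fhat L u₀ k = fhat L (fun x => u x 0) k := fun k =>
    fhat_congr hL.le (fun x hx => (hu₀ x hx).symm) k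
  have hC0 := fun n => fhat_add_eq_cosMode (k := kn L n) hL.le
    (continuousOn_slice_fst hη.continuousOn h0T)
  have hS0 := fun n => fhat_sub_eq_sinMode (k := kn L n) hL.le
    (continuousOn_slice_fst hu.continuousOn h0T)
  have hmodes := fun n => modes_eq hα hβ hδ hL hμα hμβ hμδ hη hu hsys hg₀ hh₀ hg₂ hh₂
    (sin_kn hL.ne' n) ht
  have hLC : (L : ℂ) ≠ 0 := Complex.ofReal_ne_zero.mpr hL.ne'
  have hdiff : ∀ {f : ℝ → ℝ → ℝ},
      DifferentiableOn ℝ (fun p : ℝ × ℝ => f p.1 p.2) (Icc (-L) L ×ˢ Ico 0 T) →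
      ContinuousOn (fun y => (f y t : ℂ)) (Icc (-L) L) ∧
        DifferentiableAt ℝ (fun y => (f y t : ℂ)) x := by
    intro f hf
    refine ⟨Complex.continuous_ofReal.comp_continuousOn
      (continuousOn_slice_fst hf.continuousOn ht'), ?_⟩
    exact (((hasDerivWithinAt_dx hL hf (Ioo_subset_Icc_self hx) ht').hasDerivAt
      (Icc_mem_nhds hx.1 hx.2)).ofReal_comp).differentiableAt
  constructor
  -- Here `X` and `Y` collect the initial-data terms at `k` and `-k`. The transform of `u₀` changes
  -- sign between them, so the residue pairs `η₀` with a cosine mode and `u₀` with a sine mode.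
  · have key := sum_contours_eq_of_holomorphicOff hL hr hrR hRL hball hreal
      (countable_branchSet α β δ) hZreal ((hS.mul hη1).sub (hDη.mul hu1))
      ((hS.mul hη2).add (hDη.mul hu2)) hEh hEg (c := fun n => 2 * cosMode L (kn L n) η t)
      (fun n => by
        rw [(hmodes n).1, exp_neg_two_kn hL.ne']
        simp only [hfη, hfu]
        linear_combination (1 / 2) * expSum (omega μα μβ μδ (kn L n)) t * hC0 n -
          (1 / 2) * (μα (kn L n) * μδ (kn L n) / μβ (kn L n)) *
            expDiff (omega μα μβ μδ (kn L n)) t * hS0 n) x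
    obtain ⟨hc, hd⟩ := hdiff (hη.differentiableOn (by norm_num))
    -- The factor is `π/(2L)` from the residues times the `2` in `c_n`; against the limit `2L η` it
    -- yields `2π η`.
    have hlim := (tendsto_cos_series hx hc hd).const_mul (Real.pi / (2 * L) * 2 : ℂ)
    refine eqContourSum_of_tendsto ?_
    rw [show (2 * Real.pi * η x t : ℂ) = Real.pi / (2 * L) * 2 * (2 * L * η x t) by field_simp]
    refine hlim.congr fun N => ?_
    simp only [← ofReal_cosMode]
    rw [mul_assoc, Finset.mul_sum (a := (2 : ℂ))]
    refine Eq.trans ?_ ((key N).symm.trans ?_)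
    · congr 1
      refine Finset.sum_congr rfl fun n _ => ?_
      ring
    · rw [etaTerms, sum_fin_seven]
      -- The four boundary integrals already agree definitionally; only the second and third
      -- integrands need regrouping into `X` and `Y`.
      iterate 4 refine congrArg₂ _ ?_ rfl
      refine congrArg₂ _ (congrArg₂ _ rfl (congrArg _ ?_)) (congrArg _ ?_) <;>
      · ext k
        ring
  · have key := sum_contours_eq_of_holomorphicOff hL hr hrR hRL hball hreal
      (countable_branchSet α β δ) hZreal ((hDu.mul hη1).add (hS.mul hu1))
      ((hDu.mul hη2).sub (hS.mul hu2)) hUh hUg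
      -- The factor `-i` comes from `e^{-iθ} - e^{iθ} = -2i sin θ` and is the weight of the sine
      -- modes in `tendsto_sin_series`.
      (c := fun n => 2 * (-Complex.I * sinMode L (kn L n) u t))
      (fun n => by
        rw [exp_neg_two_kn hL.ne']
        simp only [hfη, hfu]
        have h2 := (hmodes n).2
        rw [div_div_eq_mul_div Complex.I] at h2
        linear_combination -(1 / 2) * (μβ (kn L n) / (μα (kn L n) * μδ (kn L n))) *
            expDiff (omega μα μβ μδ (kn L n)) t * hC0 n +
          (1 / 2) * expSum (omega μα μβ μδ (kn L n)) t * hS0 n + Complex.I * h2 +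
          ((Real.cos (kn L n * (2 * L)) : ℝ) * uBdry α β δ μα μβ μδ h₀ h₂ t (kn L n) -
            uBdry α β δ μα μβ μδ g₀ g₂ t (kn L n) -
            μβ (kn L n) / (μα (kn L n) * μδ (kn L n)) *
            expDiff (omega μα μβ μδ (kn L n)) t * cosMode L (kn L n) η 0) * Complex.I_sq) x
    obtain ⟨hc, hd⟩ := hdiff (hu.differentiableOn (by norm_num))
    have hlim := (tendsto_sin_series hx hc hd).const_mul (Real.pi / (2 * L) * 2 : ℂ)
    refine eqContourSum_of_tendsto ?_
    rw [show (2 * Real.pi * u x t : ℂ) = Real.pi / (2 * L) * 2 * (2 * L * u x t) by field_simp]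
    refine hlim.congr fun N => ?_
    simp only [← ofReal_sinMode]
    rw [mul_assoc, Finset.mul_sum (a := (2 : ℂ))]
    refine Eq.trans ?_ ((key N).symm.trans ?_)
    · congr 1
      refine Finset.sum_congr rfl fun n _ => ?_
      ring
    · rw [uTerms, sum_fin_seven]
      iterate 4 refine congrArg₂ _ ?_ rfl
      refine congrArg₂ _ (congrArg₂ _ rfl (congrArg _ ?_)) (congrArg _ ?_) <;>
      · ext k
        ring
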